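/- **Notation.** A partition $\lambda=(\lambda_{(1)}\ge\dots\ge\lambda_{(d)}\ge1)$, possibly empty, has $p(\lambda)=d$ parts and size $|\lambda|=\sum_i\lambda_{(i)}$. Partitions are ordered lexicographically (a proper initial segment is smaller). For partition pairs put $l(\lambda,\mu)=p(\lambda)-p(\mu)$, and let $(\lambda,\mu)>(\lambda',\mu')$ if $l(\lambda,\mu)>l(\lambda',\mu')$; or $l(\lambda,\mu)=l(\lambda',\mu')$ and $\lambda>\lambda'$; or $\lambda=\lambda'$, $p(\mu)=p(\mu')$ and $\mu<\mu'$. Let $\mathcal U$ be the associative $\mathbb C$-algebra generated by $a_n,b_n$ ($n\in\mathbb Z$) with $[a_m,b_n]=\delta_{m,-n}$, $[a_m,a_n]=[b_m,b_n]=0$, graded by letting $a_{n},b_{n}$ have weight $-n$; let $\bar{\mathcal U}$ be its completion for the topology whose neighbourhoods of $0$ are the left ideals generated by the elements of weight $\le -n$, and $K$ the closed left ideal of $\bar{\mathcal U}$ generated by $a_n,b_n$, $n\ge1$. Then $\bar{\mathcal U}/K=\mathcal U/\sum_{n\ge1}(\mathcal U a_n+\mathcal U b_n)$, with basis $a_{-\lambda}b_{-\mu}a_0^kb_0^l$,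 where $a_{-\lambda}=\prod_i a_{-\lambda_{(i)}}$, $b_{-\mu}=\prod_i b_{-\mu_{(i)}}$. This basis is ordered by: $a_{-\lambda}b_{-\mu}a_0^kb_0^l>a_{-\lambda'}b_{-\mu'}a_0^{k'}b_0^{l'}$ if $(\lambda,\mu)>(\lambda',\mu')$; or the pairs agree and $k>k'$; or the pairs and $k=k'$ agree and $l<l'$. For $x=E,F,H$, the zero modes $x_{(0)}$ of $E=-a_{-1}$, $F=a_{-1}b_0^2+2b_{-1}$, $H=-2a_{-1}b_0$, that is $E_{(0)}=-a_0$, $F_{(0)}=\sum_{i+j+k=0}{:}a_ib_jb_k{:}$ and $H_{(0)}=-2\sum_i{:}a_ib_{-i}{:}$, act on $\bar{\mathcal U}/K$ by $x_{(0)}.B=x_{(0)}B-Bx_{(0)}$; this is an action of $\mathfrak{sl}_2$. Fix partitions $\lambda_0,\mu_0$ and put $l_0=p(\lambda_0)-p(\mu_0)$. Let $M=M_{\lambda_0,\mu_0}\subset\bar{\mathcal U}/K$ be the $\mathfrak{sl}_2$-submodule spanned by the basis elements $a_{-\lambda}b_{-\mu}a_0^kb_0^l\le a_{-\lambda_0}b_{-\mu_0}$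 with $|\lambda|+|\mu|=|\lambda_0|+|\mu_0|$ and $l(\lambda,\mu)+k\le l_0$, and let $M(m)=\{B\in M: H_{(0)}.B=mB\}$. Let $\mathscr D^{\rm ch}(\mathbb H)$ be the space of finite sums $\sum a_{-\lambda}b_{-\mu}f_{\lambda,\mu}$ with $f_{\lambda,\mu}\in\mathcal O(\mathbb H)$. On it $a_{-n},b_{-n}$ ($n\ge1$) act by multiplication, $b_0$ by multiplication by the coordinate $b$ of $\mathbb H$, $a_0$ by $d/db$ on the coefficients, $a_n$ by $\partial/\partial b_{-n}$ and $b_n$ by $-\partial/\partial a_{-n}$; since $K$ kills $\mathcal O(\mathbb H)$, $Af\in\mathscr D^{\rm ch}(\mathbb H)$ is defined for $A\in\bar{\mathcal U}/K$, $f\in\mathcal O(\mathbb H)$. For $g=\begin{pmatrix}\alpha&\beta\\ \gamma&\delta\end{pmatrix}\in SL(2,\mathbb R)$ let $\pi(g)$ be the linear map of $\mathscr D^{\rm ch}(\mathbb H)$ with $$\pi(g)\,a_{-\lambda}b_{-\mu}f(b)=(\pi(g)a)_{-\lambda_{(1)}}\cdots(\pi(g)a)_{-\lambda_{(d)}}(\pi(g)b)_{-\mu_{(1)}}\cdots(\pi(g)b)_{-\mu_{(e)}}f(gb),$$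 where $(\pi(g)a)_{-n}=\sum_{k\ge1}a_{-k}\big((\gamma b+\delta)^2\big)_{-n+k}+\sum_{k\ge0}\big((\gamma b+\delta)^2\big)_{-n-k}a_k+2n\gamma^2b_{-n}$ with $\big((\gamma b+\delta)^2\big)_m=\sum_{i+j=m}(\gamma b_i+\delta\,\delta_{i,0})(\gamma b_j+\delta\,\delta_{j,0})$, and $(\pi(g)b)_{-n}=\sum_{r\ge1}\sum(-\gamma)^{r-1}(\gamma b+\delta)^{-r-1}b_{-i_1}\cdots b_{-i_r}$, the inner sum over $i_1,\dots,i_r\in\mathbb Z\setminus\{0\}$ with $i_1+\dots+i_r=n$ (it is applied only to vectors without $a$'s, on which only the terms with all $i_j\ge1$ contribute). For a congruence subgroup $\Gamma\subset SL(2,\mathbb Z)$ let $(V_{\lambda_0,\mu_0})^\Gamma_0$ be the set of the $v=\sum a_{-\lambda}b_{-\mu}f_{\lambda,\mu}$, summed over $(\lambda,\mu)\le(\lambda_0,\mu_0)$ with $|\lambda|+|\mu|=|\lambda_0|+|\mu_0|$, such that $\pi(g)v=v$ for all $g\in\Gamma$ and $v$ is holomorphic at the cusps: for each $\rho\in SL(2,\mathbb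 Z)$ every coefficient of $\pi(\rho)v$ has a Fourier expansion $\sum_{m\ge0}u(m)e^{2\pi imb/N}$ for some integer $N\ge1$. **Theorem 3.5.** Let $l_0=p(\lambda_0)-p(\mu_0)\le-1$. Then $F_{(0)}.M(2l_0)\subset M(2l_0-2)$ and $M(2l_0)b_0\subset M(2l_0-2)$, and the map $$\bar F: M(2l_0)\xrightarrow{\;F_{(0)}.\;}M(2l_0-2)\longrightarrow M(2l_0-2)/M(2l_0)b_0$$ has in its kernel an element of the form $A=a_{-\lambda_0}b_{-\mu_0}+(\text{a linear combination of basis elements strictly less than }a_{-\lambda_0}b_{-\mu_0})$. Moreover, every element $A$ of this form in the kernel of $\bar F$ lifts the modular forms of weight $2(p(\mu_0)-p(\lambda_0))$: for every congruence subgroup $\Gamma\subset SL(2,\mathbb Z)$ and every $f\in M_{2(p(\mu_0)-p(\lambda_0))}(\Gamma)$, one has $Af\in(V_{\lambda_0,\mu_0})^\Gamma_0$, and the coefficient of $a_{-\lambda_0}b_{-\mu_0}$ in $Af$ is $f$. -/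

import Mathlib

open scoped MatrixGroups Manifold UpperHalfPlane

noncomputable section

namespace CDO

/-! ### Partitions and their orders -/

/-- A partition (of any size, possibly empty): a finite multiset of positive integers.
The number of parts `p(λ)` is `Multiset.card λ`. -/
abbrev Ptn := Multiset ℕ+

/-- The parts of a partition in weakly decreasing order. -/
def parts (l : Ptn) : List ℕ+ := l.sort (· ≥ ·)

/-- The size `|λ|`: the sum of the parts. -/
def size (l : Ptn) : ℕ := (l.map (fun n => (n : ℕ))).sum

/-- `l(λ, μ) = p(λ) - p(μ)`. -/
def ldiff (x : Ptn × Ptn) : ℤ := (Multiset.card x.1 : ℤ) - (Multiset.card x.2 : ℤ)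

/-- The conformal weight `|λ| + |μ|`. -/
def wt (x : Ptn × Ptn) : ℕ := size x.1 + size x.2

/-- The order on partitions: lexicographic on the decreasing lists of parts, where a proper
initial segment is smaller. -/
def ptnLT (l m : Ptn) : Prop := parts l < parts m

/-- The total order on partition pairs: `pairLT x y` means `x < y`. -/
def pairLT (x y : Ptn × Ptn) : Prop :=
  ldiff x < ldiff y ∨
  (ldiff x = ldiff y ∧ ptnLT x.1 y.1) ∨
  (x.1 = y.1 ∧ Multiset.card x.2 = Multiset.card y.2 ∧ ptnLT y.2 x.2)

/-- The index `(λ, μ, k, l)` of the basis element `a_{-λ} b_{-μ} a_0^k b_0^l`. -/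
structure Idx where
  pr : Ptn × Ptn
  k : ℕ
  l : ℕ

/-- The order on the basis elements: `idxLT x y` means `x < y`. -/
def idxLT (x y : Idx) : Prop :=
  pairLT x.pr y.pr ∨
  (x.pr = y.pr ∧ x.k < y.k) ∨
  (x.pr = y.pr ∧ x.k = y.k ∧ y.l < x.l)

/-! ### The Heisenberg algebra with `C = 1`, the left ideal `K` and the quotient by it -/

/-- The generators `a_n`, `b_n`, `n ∈ ℤ`. -/
inductive Gen where
  | a (n : ℤ) : Gen
  | b (n : ℤ) : Gen

/-- The relations `[a_m, b_n] = δ_{m,-n}`, `[a_m, a_n] = 0 = [b_m, b_n]`. -/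
inductive HeisRel : FreeAlgebra ℂ Gen → FreeAlgebra ℂ Gen → Prop where
  | aa (m n : ℤ) : HeisRel
      (FreeAlgebra.ι ℂ (Gen.a m) * FreeAlgebra.ι ℂ (Gen.a n))
      (FreeAlgebra.ι ℂ (Gen.a n) * FreeAlgebra.ι ℂ (Gen.a m))
  | bb (m n : ℤ) : HeisRel
      (FreeAlgebra.ι ℂ (Gen.b m) * FreeAlgebra.ι ℂ (Gen.b n))
      (FreeAlgebra.ι ℂ (Gen.b n) * FreeAlgebra.ι ℂ (Gen.b m))
  | ab (m n : ℤ) : HeisRel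
      (FreeAlgebra.ι ℂ (Gen.a m) * FreeAlgebra.ι ℂ (Gen.b n))
      (FreeAlgebra.ι ℂ (Gen.b n) * FreeAlgebra.ι ℂ (Gen.a m) + (if m = -n then 1 else 0))

/-- `𝒰`: the universal enveloping algebra of the Heisenberg Lie algebra modulo `C - 1`, by
generators and relations. -/
abbrev U := RingQuot HeisRel

/-- `a_n` in `𝒰`. -/
def a (n : ℤ) : U := RingQuot.mkAlgHom ℂ HeisRel (FreeAlgebra.ι ℂ (Gen.a n))

/-- `b_n` in `𝒰`. -/
def b (n : ℤ) : U := RingQuot.mkAlgHom ℂ HeisRel (FreeAlgebra.ι ℂ (Gen.b n))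

theorem a_comm (m n : ℤ) : a m * a n = a n * a m := by
  have := RingQuot.mkAlgHom_rel ℂ (HeisRel.aa m n)
  simpa [a] using this

theorem b_comm (m n : ℤ) : b m * b n = b n * b m := by
  have := RingQuot.mkAlgHom_rel ℂ (HeisRel.bb m n)
  simpa [b] using this

theorem ab_comm (m n : ℤ) : a m * b n = b n * a m + (if m = -n then 1 else 0) := by
  have := RingQuot.mkAlgHom_rel ℂ (HeisRel.ab m n)
  simp only [map_mul, map_add] at this
  rw [a, b, this]
  congr 1
  split_ifs <;> simp

/-- The left ideal `K` generated by `a_n`, `b_n` for `n ≥ 1`. -/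
def K : Submodule U U := Submodule.span U {x | ∃ n : ℤ, 1 ≤ n ∧ (x = a n ∨ x = b n)}

/-- The quotient of `𝒰` by `K`. An element of `𝒰` of negative conformal weight lies in `K`, so
`K` contains every neighbourhood `𝒰_n`, `n ≥ 1`, of `0`; the quotient is therefore discrete and
agrees with the quotient of the completion of `𝒰` by the closed left ideal generated by the
`a_n`, `b_n`, `n ≥ 1`. Infinite sums of elements of `𝒰` that converge in the completion have only
finitely many terms outside `K`. -/
abbrev Q := U ⧸ K

/-- The class modulo `K`. -/
def mk (u : U) : Q := Submodule.Quotient.mk u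

/-- The operator `a_{-λ} b_{-μ} a_0^k b_0^l` in `𝒰`. -/
def mono (x : Idx) : U :=
  ((parts x.pr.1).map (fun n : ℕ+ => a (-(n : ℤ)))).prod *
  ((parts x.pr.2).map (fun n : ℕ+ => b (-(n : ℤ)))).prod * a 0 ^ x.k * b 0 ^ x.l

/-! ### The adjoint action of zero modes -/

theorem a_mem_K {n : ℤ} (h : 1 ≤ n) : a n ∈ K := Submodule.subset_span ⟨n, h, Or.inl rfl⟩

theorem b_mem_K {n : ℤ} (h : 1 ≤ n) : b n ∈ K := Submodule.subset_span ⟨n, h, Or.inr rfl⟩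

theorem mul_mem_K (u : U) {v : U} (h : v ∈ K) : u * v ∈ K := K.smul_mem u h

/-- Every element of `𝒰` is moved into `K` by all modes of large index. -/
theorem exists_bound (v : U) :
    ∃ N : ℕ, ∀ n : ℤ, (N : ℤ) < n → a n * v ∈ K ∧ b n * v ∈ K := by
  let G : Set U := {v | ∃ N : ℕ, ∀ n : ℤ, (N : ℤ) < n → a n * v ∈ K ∧ b n * v ∈ K}
  have hadd : ∀ u ∈ G, ∀ v ∈ G, u + v ∈ G := by
    rintro u ⟨N, hN⟩ v ⟨M, hM⟩
    refine ⟨N + M, fun n hn => ?_⟩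
    push_cast at hn
    have h1 := hN n (by omega)
    have h2 := hM n (by omega)
    rw [mul_add, mul_add]
    exact ⟨K.add_mem h1.1 h2.1, K.add_mem h1.2 h2.2⟩
  have hsmul : ∀ (c : ℂ), ∀ v ∈ G, c • v ∈ G := by
    rintro c v ⟨N, hN⟩
    refine ⟨N, fun n hn => ?_⟩
    have h1 := hN n hn
    rw [mul_smul_comm, mul_smul_comm, Algebra.smul_def, Algebra.smul_def]
    exact ⟨mul_mem_K _ h1.1, mul_mem_K _ h1.2⟩
  have ha : ∀ m : ℤ, ∀ v ∈ G, a m * v ∈ G := by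
    rintro m v ⟨N, hN⟩
    refine ⟨N + m.natAbs, fun n hn => ?_⟩
    rw [Nat.cast_add] at hn
    have h1 := hN n (by omega)
    have e1 : a n * (a m * v) = a m * (a n * v) := by
      rw [← mul_assoc, a_comm, mul_assoc]
    have e2 : b n * (a m * v) = a m * (b n * v) := by
      rw [← mul_assoc, ← mul_assoc, ab_comm m n, if_neg (by omega), add_zero]
    rw [e1, e2]
    exact ⟨mul_mem_K _ h1.1, mul_mem_K _ h1.2⟩
  have hb : ∀ m : ℤ, ∀ v ∈ G, b m * v ∈ G := by
    rintro m v ⟨N, hN⟩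
    refine ⟨N + m.natAbs, fun n hn => ?_⟩
    rw [Nat.cast_add] at hn
    have h1 := hN n (by omega)
    have e1 : b n * (b m * v) = b m * (b n * v) := by
      rw [← mul_assoc, b_comm, mul_assoc]
    have e2 : a n * (b m * v) = b m * (a n * v) := by
      rw [← mul_assoc, ← mul_assoc, ab_comm n m, if_neg (by omega), add_zero]
    rw [e1, e2]
    exact ⟨mul_mem_K _ h1.1, mul_mem_K _ h1.2⟩
  have key : ∀ x : FreeAlgebra ℂ Gen, ∀ v ∈ G, RingQuot.mkAlgHom ℂ HeisRel x * v ∈ G := by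
    intro x
    induction x using FreeAlgebra.induction with
    | grade0 r =>
      intro v hv
      rw [AlgHom.commutes, ← Algebra.smul_def]
      exact hsmul r v hv
    | grade1 g =>
      intro v hv
      cases g with
      | a n => exact ha n v hv
      | b n => exact hb n v hv
    | mul x y hx hy =>
      intro v hv
      rw [map_mul, mul_assoc]
      exact hx _ (hy v hv)
    | add x y hx hy =>
      intro v hv
      rw [map_add, add_mul]
      exact hadd _ (hx v hv) _ (hy v hv)
  obtain ⟨x, hx⟩ := RingQuot.mkAlgHom_surjective ℂ HeisRel v
  have := key x 1 ⟨0, fun n hn => by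
    rw [mul_one, mul_one]
    exact ⟨a_mem_K (by simpa using Int.add_one_le_of_lt hn), b_mem_K (by simpa using Int.add_one_le_of_lt hn)⟩⟩
  rw [mul_one, hx] at this
  exact this

/-- To check that commutation with `w` preserves `K` it suffices to look at the generators. -/
theorem comm_mem_K (w : U) (h : ∀ n : ℤ, 1 ≤ n → w * a n - a n * w ∈ K ∧ w * b n - b n * w ∈ K)
    (u : U) (hu : u ∈ K) : w * u - u * w ∈ K := by
  induction hu using Submodule.span_induction with
  | mem x hx =>
    obtain ⟨n, hn, rfl | rfl⟩ := hx
    · exact (h n hn).1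
    · exact (h n hn).2
  | zero => simp
  | add x y _ _ hx hy =>
    have : w * (x + y) - (x + y) * w = (w * x - x * w) + (w * y - y * w) := by noncomm_ring
    rw [this]
    exact K.add_mem hx hy
  | smul c x hx0 hx =>
    have : w * (c • x) - (c • x) * w = (w * c - c * w) * x + c * (w * x - x * w) := by
      rw [smul_eq_mul, sub_mul, mul_sub, mul_assoc, mul_assoc, mul_assoc]; abel
    rw [this]
    exact K.add_mem (mul_mem_K _ hx0) (mul_mem_K _ hx)

/-- Let `w i`, `i ∈ ι`, be elements of `𝒰` whose sum `x` converges in the completion (for each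
`v`, all but finitely many `w i * v` lie in `K`), each of which normalizes `K`. Then
`adj w` is the infinitesimal adjoint action `B ↦ x B - B x` of `x` on `𝒰 / K`. -/
def adj {ι : Type} (w : ι → U) (hfin : ∀ v, {i | w i * v ∉ K}.Finite)
    (hK : ∀ i, ∀ u ∈ K, w i * u - u * w i ∈ K) : Q →ₗ[ℂ] Q :=
  have fin : ∀ u : U, (Function.support fun i => mk (w i * u - u * w i)).Finite := fun u =>
    ((hfin u).union (hfin 1)).subset fun i hi => by
      by_contra hcon
      simp only [Set.mem_union, Set.mem_ofPred_eq, not_or, not_not, mul_one] at hcon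
      exact hi ((Submodule.Quotient.mk_eq_zero K).2 (K.sub_mem hcon.1 (mul_mem_K u hcon.2)))
  ((K.restrictScalars ℂ).liftQ
    { toFun := fun u => ∑ᶠ i, mk (w i * u - u * w i)
      map_add' := fun u v => by
        rw [← finsum_add_distrib (fin u) (fin v)]
        refine finsum_congr fun i => ?_
        rw [mul_add, add_mul, add_sub_add_comm]
        rfl
      map_smul' := fun c u => by
        rw [RingHom.id_apply, smul_finsum' c (fin u)]
        refine finsum_congr fun i => ?_
        rw [mul_smul_comm, smul_mul_assoc, ← smul_sub]
        rfl }
    (fun u hu => by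
      rw [LinearMap.mem_ker]
      change ∑ᶠ i, mk (w i * u - u * w i) = 0
      rw [← finsum_zero (α := ι) (M := Q)]
      exact finsum_congr fun i => (Submodule.Quotient.mk_eq_zero K).2 (hK i u hu))).comp
  (Submodule.Quotient.restrictScalarsEquiv ℂ K).symm.toLinearMap

/-- Normally ordered product `:a_i x:` for `x` a polynomial in the `b_n`. -/
def nord (i : ℤ) (x : U) : U := if i < 0 then a i * x else x * a i

/-- The terms of `H_{(0)} = (-2 a_{-1} b_0)_{(0)} = ∑_i -2 :a_i b_{-i}:`. -/
def hTerm (i : ℤ) : U := -2 * nord i (b (-i))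

/-- The terms of `F_{(0)} = (a_{-1} b_0^2 + 2 b_{-1})_{(0)} = ∑_{i,j} :a_i b_j b_{-i-j}:`
(the zero mode of `b_{-1}`, a derivative, is zero). -/
def fTerm (p : ℤ × ℤ) : U := nord p.1 (b p.2 * b (-p.1 - p.2))


theorem ab_swap {m n : ℤ} (h : m ≠ -n) : a m * b n = b n * a m := by
  rw [ab_comm, if_neg h, add_zero]

theorem hTerm_fin (v : U) : {i | hTerm i * v ∉ K}.Finite := by
  obtain ⟨N, hN⟩ := exists_bound v
  refine (Set.finite_Icc (-(N : ℤ)) N).subset fun i hi => ?_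
  by_contra hcon
  apply hi
  rw [Set.mem_Icc, not_and_or, not_le, not_le] at hcon
  rw [hTerm, mul_assoc]
  apply mul_mem_K
  rw [nord]
  split_ifs with h0
  · rw [mul_assoc]
    exact mul_mem_K _ (hN _ (by omega)).2
  · rw [mul_assoc]
    exact mul_mem_K _ (hN _ (by omega)).1

theorem fTerm_fin (v : U) : {p | fTerm p * v ∉ K}.Finite := by
  obtain ⟨N, hN⟩ := exists_bound v
  refine ((Set.finite_Icc (-(2 * N : ℤ)) N).prod (Set.finite_Icc (-(2 * N : ℤ)) N)).subset
    fun p hp => ?_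
  obtain ⟨i, j⟩ := p
  by_contra hcon
  apply hp
  rw [Set.mem_prod, Set.mem_Icc, Set.mem_Icc] at hcon
  simp only [fTerm]
  rw [nord]
  split_ifs with h0
  · rw [mul_assoc, mul_assoc]
    apply mul_mem_K
    by_cases hk : (N : ℤ) < -i - j
    · exact mul_mem_K _ (hN _ hk).2
    · rw [← mul_assoc, b_comm, mul_assoc]
      exact mul_mem_K _ (hN _ (by omega)).2
  · by_cases hi : (N : ℤ) < i
    · rw [mul_assoc]
      exact mul_mem_K _ (hN _ hi).1
    · by_cases hj : (N : ℤ) < j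
      · rw [b_comm, mul_assoc, mul_assoc, ← mul_assoc (b j), ← ab_swap (by omega), mul_assoc (a i)]
        exact mul_mem_K _ (mul_mem_K _ (hN _ hj).2)
      · rw [mul_assoc, mul_assoc, ← mul_assoc (b (-i - j)), ← ab_swap (by omega), mul_assoc (a i)]
        exact mul_mem_K _ (mul_mem_K _ (hN _ (by omega)).2)

theorem hTerm_comm (i : ℤ) : ∀ u ∈ K, hTerm i * u - u * hTerm i ∈ K := by
  apply comm_mem_K
  intro n hn
  have h1 := a_mem_K hn
  have h2 := b_mem_K hn
  have hs : ∀ x y : U, x * y - y * x ∈ K →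
      (-2 * x) * y - y * (-2 * x) ∈ K := fun x y h => by
    have e : (-2 * x) * y - y * (-2 * x) = -2 * (x * y - y * x) := by
      have h2 : y * (-2 : U) = -2 * y := ((Commute.ofNat_right y 2).neg_right).eq
      rw [← mul_assoc y, h2, mul_sub, mul_assoc, mul_assoc]
    rw [e]
    exact mul_mem_K _ h
  refine ⟨hs _ _ ?_, hs _ _ ?_⟩
  · apply K.sub_mem (mul_mem_K _ h1)
    rw [nord]
    split_ifs with h0
    · rw [← mul_assoc]
      exact mul_mem_K _ (b_mem_K (by omega))
    · by_cases hi : 1 ≤ i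
      · rw [← mul_assoc]
        exact mul_mem_K _ (a_mem_K hi)
      · rw [← mul_assoc, ab_swap (by omega), mul_assoc, a_comm, ← mul_assoc]
        exact mul_mem_K _ h1
  · apply K.sub_mem (mul_mem_K _ h2)
    rw [nord]
    split_ifs with h0
    · rw [← mul_assoc]
      exact mul_mem_K _ (b_mem_K (by omega))
    · by_cases hi : 1 ≤ i
      · rw [← mul_assoc]
        exact mul_mem_K _ (a_mem_K hi)
      · rw [← mul_assoc, b_comm, mul_assoc, ← ab_swap (by omega), ← mul_assoc]
        exact mul_mem_K _ h2

theorem fTerm_comm (p : ℤ × ℤ) : ∀ u ∈ K, fTerm p * u - u * fTerm p ∈ K := by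
  obtain ⟨i, j⟩ := p
  apply comm_mem_K
  intro n hn
  have h1 := a_mem_K hn
  have h2 := b_mem_K hn
  simp only [fTerm]
  refine ⟨K.sub_mem (mul_mem_K _ h1) ?_, K.sub_mem (mul_mem_K _ h2) ?_⟩
  · rw [nord]
    split_ifs with h0
    · rw [← mul_assoc, ← mul_assoc]
      by_cases hk : 1 ≤ -i - j
      · exact mul_mem_K _ (b_mem_K hk)
      · rw [mul_assoc, b_comm, ← mul_assoc]
        exact mul_mem_K _ (b_mem_K (by omega))
    · by_cases hi : 1 ≤ i
      · rw [← mul_assoc]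
        exact mul_mem_K _ (a_mem_K hi)
      · obtain rfl : i = 0 := by omega
        by_cases hj : 1 ≤ j
        · rw [b_comm, mul_assoc, ← ab_swap (by omega), ← mul_assoc, ← mul_assoc]
          exact mul_mem_K _ (b_mem_K hj)
        · by_cases hk : 1 ≤ -0 - j
          · rw [mul_assoc, ← ab_swap (by omega), ← mul_assoc, ← mul_assoc]
            exact mul_mem_K _ (b_mem_K hk)
          · obtain rfl : j = 0 := by omega
            rw [← mul_assoc, ← mul_assoc, ab_swap (by omega), mul_assoc (b 0),
              ab_swap (by omega), mul_assoc, mul_assoc, a_comm, ← mul_assoc, ← mul_assoc]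
            exact mul_mem_K _ h1
  · rw [nord]
    split_ifs with h0
    · rw [← mul_assoc, ← mul_assoc]
      by_cases hk : 1 ≤ -i - j
      · exact mul_mem_K _ (b_mem_K hk)
      · rw [mul_assoc, b_comm, ← mul_assoc]
        exact mul_mem_K _ (b_mem_K (by omega))
    · by_cases hi : 1 ≤ i
      · rw [← mul_assoc]
        exact mul_mem_K _ (a_mem_K hi)
      · obtain rfl : i = 0 := by omega
        rw [← mul_assoc, ← mul_assoc, b_comm n j, mul_assoc (b j), b_comm n, mul_assoc, mul_assoc,
          ← ab_swap (by omega), ← mul_assoc, ← mul_assoc]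
        exact mul_mem_K _ h2

/-- The infinitesimal adjoint action of `H_{(0)}`. -/
def adH : Q →ₗ[ℂ] Q := adj hTerm hTerm_fin hTerm_comm

/-- The infinitesimal adjoint action of `F_{(0)}`. -/
def adF : Q →ₗ[ℂ] Q := adj fTerm fTerm_fin fTerm_comm

/-! ### The module `M_{λ₀,μ₀}`, its weight spaces and the map `F̄` -/

/-- The index set of `𝒮_{λ₀,μ₀}`. -/
def inS (x : Ptn × Ptn) (s : Idx) : Prop :=
  (idxLT s ⟨x, 0, 0⟩ ∨ s = ⟨x, 0, 0⟩) ∧ wt s.pr = wt x ∧ ldiff s.pr + s.k ≤ ldiff x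

/-- `M_{λ₀,μ₀}`, the span of `𝒮_{λ₀,μ₀}` in the quotient. -/
def M (x : Ptn × Ptn) : Submodule ℂ Q := Submodule.span ℂ {q | ∃ s, inS x s ∧ q = mk (mono s)}

/-- `M_{λ₀,μ₀}(m)`, the subspace of `H_{(0)}`-weight `m`. -/
def Mwt (x : Ptn × Ptn) (m : ℤ) : Submodule ℂ Q := M x ⊓ Module.End.eigenspace adH (m : ℂ)

/-- The class modulo `K`, as a linear map. -/
def mkL : U →ₗ[ℂ] Q := K.mkQ.restrictScalars ℂ

/-- `N b_0` for a subspace `N` of the quotient: the classes of `u b_0` for `u` with class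
in `N`. -/
def mulB (N : Submodule ℂ Q) : Submodule ℂ Q :=
  ((N.comap mkL).map (LinearMap.mulRight ℂ (b 0))).map mkL

/-- The map `F̄`: the composite of the adjoint action of `F_{(0)}` on `M_{λ₀,μ₀}(2l₀)`, `l₀ = l(λ₀,μ₀)`, with
the passage to the quotient by `M_{λ₀,μ₀}(2l₀) b_0`. (That the image of `F_{(0)}` lies in
`M_{λ₀,μ₀}(2l₀ - 2)` is a separate claim.) -/
def Fbar (x : Ptn × Ptn) : Mwt x (2 * ldiff x) →ₗ[ℂ] Q ⧸ mulB (Mwt x (2 * ldiff x)) :=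
  (mulB (Mwt x (2 * ldiff x))).mkQ ∘ₗ adF ∘ₗ (Mwt x (2 * ldiff x)).subtype

/-- `A = a_{-λ₀} b_{-μ₀} +` terms strictly less than `a_{-λ₀} b_{-μ₀}`. -/
def HasLeadingTerm (x : Ptn × Ptn) (A : Q) : Prop :=
  A - mk (mono ⟨x, 0, 0⟩) ∈ Submodule.span ℂ {q | ∃ s, idxLT s ⟨x, 0, 0⟩ ∧ q = mk (mono s)}

/-! ### Holomorphic functions on `ℍ` -/

/-- The algebra of holomorphic functions on the upper half plane, inside all functions. -/
def holSubalgebra : Subalgebra ℂ (ℍ → ℂ) where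
  carrier := {f | MDiff f}
  mul_mem' hf hg := MDifferentiable.mul hf hg
  add_mem' hf hg := MDifferentiable.add hf hg
  algebraMap_mem' _ := mdifferentiable_const

/-- The algebra `𝒪(ℍ)` of holomorphic functions on the upper half plane. -/
def Hol : Type := holSubalgebra

instance : CommRing Hol := inferInstanceAs (CommRing holSubalgebra)

instance : Algebra ℂ Hol := inferInstanceAs (Algebra ℂ holSubalgebra)

/-- Holomorphic functions agree if they have the same values. -/
theorem Hol.ext {f g : Hol} (h : ∀ τ : ℍ, f.1 τ = g.1 τ) : f = g := Subtype.ext (funext h)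

/-- The derivative of a holomorphic function. -/
def dHol : Hol →ₗ[ℂ] Hol where
  toFun f := ⟨fun τ => deriv (f.1 ∘ UpperHalfPlane.ofComplex) τ, by
    have hf : MDiff f.1 := f.2
    change MDiff (fun τ : ℍ => deriv (f.1 ∘ UpperHalfPlane.ofComplex) τ)
    rw [UpperHalfPlane.mdifferentiable_iff] at hf ⊢
    refine (hf.deriv UpperHalfPlane.isOpen_upperHalfPlaneSet).congr ?_
    intro z hz
    simp [Function.comp_apply, UpperHalfPlane.ofComplex_apply_of_im_pos hz]⟩
  map_add' f g := by
    refine Hol.ext fun z => ?_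
    have hf := UpperHalfPlane.mdifferentiableAt_iff.mp ((f.2 : MDiff f.1) z)
    have hg := UpperHalfPlane.mdifferentiableAt_iff.mp ((g.2 : MDiff g.1) z)
    exact deriv_add hf hg
  map_smul' c f := by
    refine Hol.ext fun z => ?_
    have hf := UpperHalfPlane.mdifferentiableAt_iff.mp ((f.2 : MDiff f.1) z)
    exact deriv_const_smul c hf

theorem dHol_mul (f g : Hol) : dHol (f * g) = f * dHol g + dHol f * g := by
  refine Hol.ext fun z => ?_
  have hf := UpperHalfPlane.mdifferentiableAt_iff.mp ((f.2 : MDiff f.1) z)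
  have hg := UpperHalfPlane.mdifferentiableAt_iff.mp ((g.2 : MDiff g.1) z)
  have h := deriv_mul hf hg
  simp only [Function.comp_apply, UpperHalfPlane.ofComplex_apply] at h
  rw [add_comm]
  exact h

/-- The coordinate function `b` on `ℍ`. -/
def coordH : Hol := ⟨fun τ => (τ : ℂ), UpperHalfPlane.mdifferentiable_coe⟩

theorem dHol_coordH : dHol coordH = 1 := by
  refine Hol.ext fun z => ?_
  change deriv (fun w : ℂ => ((UpperHalfPlane.ofComplex w : ℍ) : ℂ)) z = 1
  have : (fun w : ℂ => ((UpperHalfPlane.ofComplex w : ℍ) : ℂ)) =ᶠ[nhds (z : ℂ)] id :=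
    UpperHalfPlane.eventuallyEq_coe_comp_ofComplex z.im_pos
  rw [this.deriv_eq, deriv_id]

/-- The function `(γ b + δ)⁻¹`, for `g = (α, β; γ, δ)`. -/
def jInv (g : SL(2, ℝ)) : Hol :=
  ⟨fun τ => ((g 1 0 : ℂ) * (τ : ℂ) + (g 1 1 : ℂ))⁻¹,
    UpperHalfPlane.mdifferentiable_inv_denom (g : GL (Fin 2) ℝ)⟩

/-- The algebra map `f ↦ f(g b)`. -/
def pull (g : SL(2, ℝ)) : Hol →ₐ[ℂ] Hol where
  toFun f := ⟨fun τ => f.1 (g • τ), by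
    have hf : MDiff f.1 := f.2
    exact hf.comp (UpperHalfPlane.mdifferentiable_smul (g := (g : GL (Fin 2) ℝ)) (by simp))⟩
  map_one' := rfl
  map_mul' _ _ := rfl
  map_zero' := rfl
  map_add' _ _ := rfl
  commutes' _ := rfl

/-! ### The space `𝒟^ch(ℍ)` and the action of `𝒰` -/

/-- `𝒟^ch(ℍ) = V ⊗_{ℂ[b_0]} 𝒪(ℍ)`, where `V = ℂ[b_0, b_{-1}, …, a_{-1}, a_{-2}, …]`: polynomials
in `a_{-n}` (the variable `Sum.inl n`) and `b_{-n}` (the variable `Sum.inr n`), `n ≥ 1`, with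
coefficients in `𝒪(ℍ)`. -/
abbrev Dch := MvPolynomial (ℕ+ ⊕ ℕ+) Hol

/-- Coefficientwise derivative. -/
def D0 : Dch →ₗ[ℂ] Dch :=
  ((MvPolynomial.basisMonomials (ℕ+ ⊕ ℕ+) Hol).repr.symm.toLinearMap.restrictScalars ℂ) ∘ₗ
    Finsupp.mapRange.linearMap dHol ∘ₗ
      ((MvPolynomial.basisMonomials (ℕ+ ⊕ ℕ+) Hol).repr.toLinearMap.restrictScalars ℂ)

/-- Multiplication by a polynomial. -/
def mulOp (p : Dch) : Module.End ℂ Dch := LinearMap.mulLeft ℂ p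

/-- Partial derivative with respect to a variable. -/
def pdOp (i : ℕ+ ⊕ ℕ+) : Module.End ℂ Dch :=
  (MvPolynomial.pderiv (R := Hol) i).toLinearMap.restrictScalars ℂ

/-- The action of `a_n` on `𝒟^ch(ℍ)`: `a_{-n}` is multiplication, `a_0 = d/db` on `𝒪(ℍ)`, and
`a_n = ∂/∂b_{-n}`, for `n ≥ 1`. -/
def aOp : ℤ → Module.End ℂ Dch
  | Int.ofNat 0 => D0
  | Int.ofNat (n + 1) => pdOp (Sum.inr n.succPNat)
  | Int.negSucc n => mulOp (MvPolynomial.X (Sum.inl n.succPNat))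

/-- The action of `b_n` on `𝒟^ch(ℍ)`: `b_{-n}` is multiplication, `b_0` is multiplication by the
coordinate, and `b_n = -∂/∂a_{-n}`, for `n ≥ 1`. -/
def bOp : ℤ → Module.End ℂ Dch
  | Int.ofNat 0 => mulOp (MvPolynomial.C coordH)
  | Int.ofNat (n + 1) => -pdOp (Sum.inl n.succPNat)
  | Int.negSucc n => mulOp (MvPolynomial.X (Sum.inr n.succPNat))

theorem coeff_D0 (s : ℕ+ ⊕ ℕ+ →₀ ℕ) (w : Dch) : (D0 w).coeff s = dHol (w.coeff s) := rfl

theorem D0_mul_C (f : Hol) (w : Dch) :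
    D0 (MvPolynomial.C f * w) = MvPolynomial.C f * D0 w + MvPolynomial.C (dHol f) * w := by
  ext1 s
  simp [coeff_D0, MvPolynomial.coeff_C_mul, dHol_mul]

theorem D0_mul_X (i : ℕ+ ⊕ ℕ+) (w : Dch) :
    D0 (MvPolynomial.X i * w) = MvPolynomial.X i * D0 w := by
  ext1 s
  rw [coeff_D0, MvPolynomial.coeff_X_mul', MvPolynomial.coeff_X_mul']
  split_ifs
  · rw [coeff_D0]
  · exact map_zero _

theorem D0_pd (i : ℕ+ ⊕ ℕ+) (w : Dch) : D0 (pdOp i w) = pdOp i (D0 w) := by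
  refine MvPolynomial.ext _ _ fun s => ?_
  have h : ∀ v : Dch, MvPolynomial.coeff s (pdOp i v) =
      (s i + 1) • MvPolynomial.coeff (s + Finsupp.single i 1) v := fun v => by
    refine (MvPolynomial.coeff_pderiv (R := Hol) v s).trans ?_
    rw [nsmul_eq_mul, mul_comm, Nat.cast_add, Nat.cast_one]
  rw [coeff_D0, h, h, coeff_D0, map_nsmul]

theorem pd_pd (i j : ℕ+ ⊕ ℕ+) (w : Dch) : pdOp i (pdOp j w) = pdOp j (pdOp i w) := by
  have h : ⁅MvPolynomial.pderiv (R := Hol) i, MvPolynomial.pderiv (R := Hol) j⁆ = 0 := by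
    refine MvPolynomial.derivation_ext fun k => ?_
    classical
    rw [Derivation.commutator_apply, MvPolynomial.pderiv_X, MvPolynomial.pderiv_X,
      Pi.single_apply, Pi.single_apply]
    split_ifs <;> simp
  have h2 := congrArg (fun d => d w) h
  simp only [Derivation.commutator_apply] at h2
  exact sub_eq_zero.1 h2

theorem pd_X (i j : ℕ+ ⊕ ℕ+) (w : Dch) :
    pdOp i (MvPolynomial.X j * w) =
      MvPolynomial.X j * pdOp i w + (if i = j then w else 0) := by
  classical
  change MvPolynomial.pderiv i _ = MvPolynomial.X j * MvPolynomial.pderiv i w + _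
  rw [MvPolynomial.pderiv_mul, MvPolynomial.pderiv_X, Pi.single_apply, add_comm]
  split_ifs with h1 h2 h2
  · rw [one_mul]
  · exact absurd h1.symm h2
  · exact absurd h2.symm h1
  · rw [zero_mul]

theorem pd_C (i : ℕ+ ⊕ ℕ+) (f : Hol) (w : Dch) :
    pdOp i (MvPolynomial.C f * w) = MvPolynomial.C f * pdOp i w := by
  simp [pdOp, MvPolynomial.C_mul']

theorem op_aa (m n : ℤ) : aOp m * aOp n = aOp n * aOp m := by
  apply LinearMap.ext
  intro w
  obtain (_ | m) | m := m <;> obtain (_ | n) | n := n <;>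
    simp [aOp, mulOp, D0_mul_X, D0_pd, pd_X, mul_left_comm]
  exact pd_pd _ _ _

theorem op_bb (m n : ℤ) : bOp m * bOp n = bOp n * bOp m := by
  apply LinearMap.ext
  intro w
  obtain (_ | m) | m := m <;> obtain (_ | n) | n := n <;>
    simp [bOp, mulOp, pd_C, pd_X, mul_left_comm]
  exact pd_pd _ _ _

theorem op_ab (m n : ℤ) :
    aOp m * bOp n = bOp n * aOp m + (if m = -n then 1 else 0) := by
  apply LinearMap.ext
  intro w
  rw [LinearMap.add_apply]
  have h0 : (if m = -n then (1 : Module.End ℂ Dch) else 0) w = if m = -n then w else 0 := by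
    split_ifs <;> simp
  rw [h0]
  obtain (_ | m) | m := m <;> obtain (_ | n) | n := n <;>
    simp [aOp, bOp, mulOp, pd_C, pd_X, D0_mul_X, D0_mul_C, D0_pd, mul_left_comm]
  · rw [dHol_coordH, map_one, one_mul]
  · intro h; omega
  · intro h; omega
  · intro h; omega
  · rw [pd_pd, if_neg (by omega), add_zero]
  · by_cases h : n = m
    · rw [if_pos h, if_pos (by omega)]; abel
    · rw [if_neg h, if_neg (by omega)]; abel
  · intro h; omega

/-- The images of the generators. -/
def genOp : Gen → Module.End ℂ Dch
  | Gen.a n => aOp n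
  | Gen.b n => bOp n

/-- The action of `𝒰` on `𝒟^ch(ℍ)`. -/
def act : U →ₐ[ℂ] Module.End ℂ Dch :=
  RingQuot.liftAlgHom ℂ ⟨FreeAlgebra.lift ℂ genOp, by
    intro x y h
    cases h with
    | aa m n => simpa [genOp] using op_aa m n
    | bb m n => simpa [genOp] using op_bb m n
    | ab m n =>
      simp only [map_mul, map_add, FreeAlgebra.lift_ι_apply, genOp, op_ab]
      split_ifs <;> simp⟩

/-- A function `f ∈ 𝒪(ℍ)` as an element of `𝒟^ch(ℍ)`. -/
def ofHol (f : Hol) : Dch := MvPolynomial.C f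

theorem act_a (n : ℤ) : act (a n) = aOp n := by
  simp [act, a, genOp]

theorem act_b (n : ℤ) : act (b n) = bOp n := by
  simp [act, b, genOp]

/-- `K` annihilates `𝒪(ℍ)`. -/
theorem act_K (f : Hol) (u : U) (hu : u ∈ K) : act u (ofHol f) = 0 := by
  induction hu using Submodule.span_induction with
  | mem x hx =>
    obtain ⟨n, hn, rfl | rfl⟩ := hx
    · obtain ⟨k, rfl⟩ : ∃ k : ℕ, n = Int.ofNat (k + 1) := ⟨(n - 1).toNat, by simp; omega⟩
      rw [act_a]
      simp [aOp, pdOp, ofHol]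
    · obtain ⟨k, rfl⟩ : ∃ k : ℕ, n = Int.ofNat (k + 1) := ⟨(n - 1).toNat, by simp; omega⟩
      rw [act_b]
      simp [bOp, pdOp, ofHol]
  | zero => simp
  | add x y _ _ hx hy => rw [map_add, LinearMap.add_apply, hx, hy, add_zero]
  | smul c x _ hx => rw [smul_eq_mul, map_mul, Module.End.mul_apply, hx, map_zero]

/-- The map `(u + K, f) ↦ u f` from `𝒰/K × 𝒪(ℍ)` to `𝒟^ch(ℍ)`. -/
def applyOp (A : Q) (f : Hol) : Dch :=
  ((K.restrictScalars ℂ).liftQ (LinearMap.applyₗ (ofHol f) ∘ₗ act.toLinearMap)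
    (fun u hu => LinearMap.mem_ker.2 (act_K f u hu)))
  ((Submodule.Quotient.restrictScalarsEquiv ℂ K).symm A)

/-! ### The action of `SL(2, ℝ)` on `𝒟^ch(ℍ)` -/

/-- The mode `(γ b + δ)_m` of the field of `γ b + δ`. -/
def cOp (g : SL(2, ℝ)) (m : ℤ) : Module.End ℂ Dch :=
  (g 1 0 : ℂ) • bOp m + (if m = 0 then (g 1 1 : ℂ) else 0) • 1

/-- The terms of the mode `n` of the normally ordered product `a_{-1} (γ b + δ)^2`: the pair
`p = (k, i)` gives `:a_k (γ b + δ)_i (γ b + δ)_{n-k-i}:`, with `a_k` on the left for `k < 0`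
and on the right for `k ≥ 0`. -/
def aTerm (g : SL(2, ℝ)) (n : ℤ) (p : ℤ × ℤ) : Module.End ℂ Dch :=
  if p.1 < 0 then aOp p.1 * (cOp g p.2 * cOp g (n - p.1 - p.2))
  else cOp g p.2 * cOp g (n - p.1 - p.2) * aOp p.1

/-- The mode `(π(g) a)_{-n}` for `n ≥ 1`, where `π(g) a = a_{-1} (γ b + δ)^2 + 2 γ^2 b_{-1}`.
On each vector only finitely many terms of the sum are nonzero. -/
def piA (g : SL(2, ℝ)) (n : ℕ+) (w : Dch) : Dch :=
  (∑ᶠ p : ℤ × ℤ, aTerm g (-(n : ℤ)) p w) +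
    (2 * (n : ℂ) * (g 1 0 : ℂ) ^ 2) • bOp (-(n : ℤ)) w

/-- The mode `(π(g) b)_{-n}` for `n ≥ 1`, where `π(g) b = (α b + β) / (γ b + δ)`, as an operator
on the vectors without any `a_{-m}`, on which all `b_m` with `m ≥ 1` vanish. It is multiplication
by the sum of `(-γ)^{l-1} (γ b + δ)^{-l-1} b_{-i_1} ⋯ b_{-i_l}` over all `l ≥ 1` and all
`i_1, …, i_l ≥ 1` with sum `n`. -/
def piB (g : SL(2, ℝ)) (n : ℕ+) : Dch :=
  ∑ c : Composition (n : ℕ),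
    MvPolynomial.C ((-(g 1 0 : ℂ)) ^ (c.length - 1) • jInv g ^ (c.length + 1)) *
      (c.blocks.map (fun i => MvPolynomial.X (Sum.inr i.toPNat'))).prod

/-- The exponent of the monomial `a_{-λ} b_{-μ}`. -/
def expo (x : Ptn × Ptn) : ℕ+ ⊕ ℕ+ →₀ ℕ :=
  Multiset.toFinsupp (x.1.map Sum.inl + x.2.map Sum.inr)

/-- The partition `λ` of the monomial `a_{-λ} b_{-μ}`. -/
def aPart (s : ℕ+ ⊕ ℕ+ →₀ ℕ) : Ptn := (Finsupp.toMultiset s).filterMap Sum.getLeft?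

/-- The partition `μ` of the monomial `a_{-λ} b_{-μ}`. -/
def bPart (s : ℕ+ ⊕ ℕ+ →₀ ℕ) : Ptn := (Finsupp.toMultiset s).filterMap Sum.getRight?

/-- The coefficient in `𝒪(ℍ)` of `a_{-λ} b_{-μ}`. -/
def coef (x : Ptn × Ptn) (v : Dch) : Hol := v.coeff (expo x)

/-- The action `π(g)` of `g ∈ SL(2, ℝ)` on `𝒟^ch(ℍ)`, the additive map with
`π(g) a_{-λ} b_{-μ} f(b) = (π(g)a)_{-λ_1} ⋯ (π(g)a)_{-λ_d} (π(g)b)_{-μ_1} ⋯ (π(g)b)_{-μ_e} f(g b)`. -/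
def piAct (g : SL(2, ℝ)) (v : Dch) : Dch :=
  ∑ s ∈ v.support, (parts (aPart s)).foldr (piA g)
    (((bPart s).map (piB g)).prod * MvPolynomial.C (pull g (v.coeff s)))

/-! ### Invariant vectors that are holomorphic at the cusps -/

/-- An element of `SL(2, ℤ)` as an element of `SL(2, ℝ)`. -/
def toR (g : SL(2, ℤ)) : SL(2, ℝ) := Matrix.SpecialLinearGroup.map (Int.castRingHom ℝ) g

/-- `f` has a Fourier expansion `∑ u(m) e^{2 π i m b / N}`, for some positive integer `N`,
without terms of negative index. -/
def HolAtInfty (f : Hol) : Prop :=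
  ∃ N : ℕ, 0 < N ∧ ∃ u : ℕ → ℂ, ∀ τ : ℍ,
    HasSum (fun m : ℕ => u m * Complex.exp (2 * Real.pi * Complex.I * m * (τ : ℂ) / N)) (f.1 τ)

/-- `V_{λ₀,μ₀}`: the combinations of `a_{-λ} b_{-μ} f(b)` with `(λ,μ) ≤ (λ₀,μ₀)` and
`|λ| + |μ| = |λ₀| + |μ₀|`. -/
def V (x : Ptn × Ptn) : Set Dch :=
  {v | ∀ y, coef y v ≠ 0 → (pairLT y x ∨ y = x) ∧ wt y = wt x}

/-- `(V_{λ₀,μ₀})^Γ_0`: the `Γ`-invariant elements of `V_{λ₀,μ₀}` holomorphic at all the cusps. -/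
def VInv (Γ : Subgroup SL(2, ℤ)) (x : Ptn × Ptn) : Set Dch :=
  {v | v ∈ V x ∧ (∀ g ∈ Γ, piAct (toR g) v = v) ∧
    ∀ ρ : SL(2, ℤ), ∀ y, HolAtInfty (coef y (piAct (toR ρ) v))}

/-- A modular form as a holomorphic function. -/
def ofModularForm {Γ : Subgroup (GL (Fin 2) ℝ)} {k : ℤ} (f : ModularForm Γ k) : Hol :=
  ⟨f, f.holo'⟩

end CDO

end

/-!
Let `g ∈ SL(2, ℝ)` have the lower row `(γ, δ)`, put `j = γ b + δ` and let `G = (a j ^ 2)_{(0)}` be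
the zero mode of `a j ^ 2 = γ ^ 2 a b ^ 2 + 2 γ δ a b + δ ^ 2 a`, acting on `𝒟^ch(ℍ)`. It is a
combination of `F_{(0)}`, `H_{(0)}` and `a_0`, hence is known on a vector `A f` as soon as these
three are. If `A` has weight `2 l₀` and lies in the kernel of
`F̄`, then `F_{(0)} . A = A' b_0` for some `A'`, and commuting with `a_0` shows that `A'` acts on
functions as `-2 l₀ A`. Hence `G (A f) = A (j ^ 2 f' - 2 l₀ γ j f)` (`Gop_zero_applyL`).

The claim to prove is the transformation law `π(g) (A f) = A (j ^ (2 l₀) f(g b))`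
(`piAct_applyOp`), which for `f` modular of weight `-2 l₀` says that `A f` is invariant.
Both sides are values, at `h = f(g b)`, of linear maps: `T h = π(g) (A f)` and
`A (j ^ (2 l₀) h)`. When `γ ≠ 0` the two are compared as follows.
* `G` commutes with the modes of `π(g) a` (`Gop_piAop_comm`) and `π(g) b` (`vfield_piB`), so
  `G (T h) = T (j ^ 2 h')`; by the formula above `h ↦ A (j ^ (2 l₀) h)` obeys the same rule.
* On the powers `h = j ^ m` the coefficients of both sides are of the form `p(m) j ^ (m + e)` for
  polynomials `p`, and the leading coefficients of these polynomials agree, because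
  `π(g) a = j ^ 2 a + ⋯` and `π(g) b = j ^ (-2) b + ⋯` (`tilL_sub_actL_mem`). For the difference,
  the rule for `G` becomes a recursion `(m + l₀ - d) p(m) = m p(m + 1)` for the coefficients of top
  degree difference `d`. It gives `p` more roots `0, -1, -2, …` than its degree, and the difference
  vanishes (`fam_eq_zero`).
* Both sides depend at each point of `ℍ` on finitely many derivatives of `h`, and near a point
  every `h` is a combination of powers of `j` up to high order (`eq_zero_of_finOrder`).

For `γ = 0` both sides agree by scaling.

An element of the kernel of `F̄` with leading term `a_{-λ₀} b_{-μ₀}` exists since modulo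
`M(2 l₀) b_0` and terms with smaller `l(λ, μ)` the operator `F_{(0)}` maps `a_{-λ} b_{-μ} a_0^k` to
`k (k + 1 + 2 l(λ, μ)) a_{-λ} b_{-μ} a_0^(k-1)`, where `k = l₀ - l(λ, μ)`; the factor
`l₀ + l(λ, μ) + 1` is not zero as `l₀ ≤ -1` (`exists_preimage`). The vectors `A f` are holomorphic
at the cusps because the coefficients of `π(ρ) (A f) = A (f ∣ ρ)` are combinations of derivatives
of `f ∣ ρ`, which stay periodic and bounded at `i∞` (`dHol_mem_Bdd`).
-/

noncomputable section

namespace CDO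

/-! ### Locally finite sums of operators -/

section LocallyFinite

variable {W : Type*} [AddCommGroup W] [Module ℂ W] {ι κ : Type*}

/-- A family of operators is locally finite if every vector is killed by all but finitely many
of them. -/
def LocFin (T : ι → Module.End ℂ W) : Prop := ∀ w, (Function.support fun i => T i w).Finite

open Classical in
/-- The sum of a locally finite family of operators (zero if the family is not locally finite). -/
def lsum (T : ι → Module.End ℂ W) : Module.End ℂ W :=
  if h : LocFin T then
    { toFun := fun w => ∑ᶠ i, T i w
      map_add' := fun v w => by
        rw [← finsum_add_distrib (h v) (h w)]
        exact finsum_congr fun i => map_add _ _ _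
      map_smul' := fun c w => by
        rw [RingHom.id_apply, smul_finsum' c (h w)]
        exact finsum_congr fun i => map_smul _ _ _ }
  else 0

theorem lsum_apply {T : ι → Module.End ℂ W} (h : LocFin T) (w : W) :
    lsum T w = ∑ᶠ i, T i w := by
  rw [lsum, dif_pos h]; rfl

theorem LocFin.add {T S : ι → Module.End ℂ W} (hT : LocFin T) (hS : LocFin S) :
    LocFin fun i => T i + S i := fun w =>
  ((hT w).union (hS w)).subset (Function.support_add _ _)

theorem LocFin.mul_left {T : ι → Module.End ℂ W} (X : Module.End ℂ W) (hT : LocFin T) :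
    LocFin fun i => X * T i := fun w =>
  (hT w).subset fun i hi h => hi (by simp [h])

theorem LocFin.mul_right {T : ι → Module.End ℂ W} (X : Module.End ℂ W) (hT : LocFin T) :
    LocFin fun i => T i * X := fun w => hT (X w)

theorem LocFin.smul {T : ι → Module.End ℂ W} (c : ℂ) (hT : LocFin T) :
    LocFin fun i => c • T i := fun w =>
  (hT w).subset fun i hi h => hi (by simp [h])

theorem LocFin.sub {T S : ι → Module.End ℂ W} (hT : LocFin T) (hS : LocFin S) :
    LocFin fun i => T i - S i := fun w =>
  ((hT w).union (hS w)).subset (Function.support_sub _ _)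

theorem LocFin.comm {T : ι → Module.End ℂ W} (hT : LocFin T) (X : Module.End ℂ W) :
    LocFin fun i => T i * X - X * T i := (hT.mul_right X).sub (hT.mul_left X)

theorem LocFin.comp {T : κ → Module.End ℂ W} (hT : LocFin T) {e : ι → κ}
    (he : Function.Injective e) : LocFin fun i => T (e i) := fun w =>
  ((hT w).preimage he.injOn)

theorem lsum_add {T S : ι → Module.End ℂ W} (hT : LocFin T) (hS : LocFin S) :
    (lsum fun i => T i + S i) = lsum T + lsum S := by
  ext w
  rw [LinearMap.add_apply, lsum_apply hT, lsum_apply hS, lsum_apply (hT.add hS),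
    ← finsum_add_distrib (hT w) (hS w)]
  rfl

theorem lsum_sub {T S : ι → Module.End ℂ W} (hT : LocFin T) (hS : LocFin S) :
    (lsum fun i => T i - S i) = lsum T - lsum S := by
  ext w
  rw [LinearMap.sub_apply, lsum_apply hT, lsum_apply hS, lsum_apply (hT.sub hS),
    ← finsum_sub_distrib (hT w) (hS w)]
  rfl

theorem lsum_mul_left {T : ι → Module.End ℂ W} (X : Module.End ℂ W) (hT : LocFin T) :
    (lsum fun i => X * T i) = X * lsum T := by
  ext w
  rw [Module.End.mul_apply, lsum_apply hT, lsum_apply (hT.mul_left X),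
    map_finsum X (hT w)]
  rfl

theorem lsum_mul_right {T : ι → Module.End ℂ W} (X : Module.End ℂ W) (hT : LocFin T) :
    (lsum fun i => T i * X) = lsum T * X := by
  ext w
  rw [Module.End.mul_apply, lsum_apply hT, lsum_apply (hT.mul_right X)]
  rfl

theorem lsum_smul {T : ι → Module.End ℂ W} (c : ℂ) (hT : LocFin T) :
    (lsum fun i => c • T i) = c • lsum T := by
  ext w
  rw [LinearMap.smul_apply, lsum_apply hT, lsum_apply (hT.smul c), smul_finsum' c (hT w)]
  rfl

theorem lsum_comm {T : ι → Module.End ℂ W} (hT : LocFin T) (X : Module.End ℂ W) :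
    lsum T * X - X * lsum T = lsum fun i => T i * X - X * T i := by
  rw [lsum_sub (hT.mul_right X) (hT.mul_left X), lsum_mul_right X hT, lsum_mul_left X hT]

theorem lsum_equiv (e : ι ≃ κ) {T : κ → Module.End ℂ W} (hT : LocFin T) :
    (lsum fun i => T (e i)) = lsum T := by
  ext w
  rw [lsum_apply hT, lsum_apply (hT.comp e.injective)]
  exact finsum_comp_equiv (f := fun k => T k w) e

theorem lsum_single (c : ι) [DecidableEq ι] (S : ι → Module.End ℂ W) :
    (lsum fun i => if i = c then S i else 0) = S c := by
  have h : LocFin fun i => if i = c then S i else 0 := fun w =>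
    (Set.finite_singleton c).subset fun i hi => by
      by_contra hc
      exact hi (by simp [show ¬ i = c from hc])
  ext w
  rw [lsum_apply h, finsum_eq_single _ c]
  · simp
  · intro i hi; simp [hi]

theorem LocFin.mem_ne {T : ι → Module.End ℂ W} (hT : LocFin T) (p : ι → Prop)
    [DecidablePred p] : LocFin fun i => if p i then T i else 0 := fun w =>
  (hT w).subset fun i hi h => hi (by
    simp only
    split_ifs
    · exact h
    · simp)

/-- A sum over pairs that is supported on a graph. -/
theorem lsum_graph {S : ℤ → Module.End ℂ W} (hS : LocFin S) (c : ℤ → ℤ) :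
    (lsum fun p : ℤ × ℤ => if p.2 = c p.1 then S p.1 else 0) = lsum S ∧
    LocFin (fun p : ℤ × ℤ => if p.2 = c p.1 then S p.1 else 0) := by
  have h : LocFin fun p : ℤ × ℤ => if p.2 = c p.1 then S p.1 else 0 := fun w =>
    ((hS w).image fun i => (i, c i)).subset fun p hp => by
      obtain ⟨i, j⟩ := p
      by_cases hj : j = c i
      · exact ⟨i, fun h => hp (by simp [hj, h]), by simp [hj]⟩
      · exact absurd (by simp [hj]) hp
  refine ⟨?_, h⟩
  ext w
  rw [lsum_apply h, lsum_apply hS]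
  have hinj : Function.Injective fun i : ℤ => (i, c i) := fun i j hij => (Prod.mk.inj hij).1
  rw [← finsum_mem_range (f := fun p : ℤ × ℤ => S p.1 w) hinj]
  refine finsum_congr fun p => ?_
  by_cases hp : p.2 = c p.1
  · have : p ∈ Set.range fun i : ℤ => (i, c i) := ⟨p.1, by simp [← hp]⟩
    simp [hp, this]
  · have : p ∉ Set.range fun i : ℤ => (i, c i) := by
      rintro ⟨i, rfl⟩
      exact hp rfl
    rw [if_neg hp, LinearMap.zero_apply]
    have : IsEmpty (p ∈ Set.range fun i : ℤ => (i, c i)) := ⟨this⟩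
    exact (finsum_of_isEmpty _).symm

theorem lsum_fiber {S : ℤ → Module.End ℂ W} (hS : LocFin S) (c : ℤ) :
    (lsum fun p : ℤ × ℤ => if p.1 = c then S p.2 else 0) = lsum S := by
  have h := lsum_graph hS fun _ => c
  rw [← h.1, ← lsum_equiv (Equiv.prodComm ℤ ℤ) h.2]
  rfl

theorem lsum_mem {T : ι → Module.End ℂ W} (hT : LocFin T) (V : Submodule ℂ W) {w : W}
    (h : ∀ i, T i w ∈ V) : lsum T w ∈ V := by
  rw [lsum_apply hT]
  exact finsum_induction (fun v => v ∈ V) V.zero_mem (fun _ _ => V.add_mem) h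

end LocallyFinite

/-! ### Modules over the Heisenberg algebra -/

section Heisenberg

variable {W : Type*} [AddCommGroup W] [Module ℂ W]

/-- The operators `α n`, `β n` make `W` a smooth module over the Heisenberg algebra `𝒰`: they
satisfy the relations of the `a_n`, `b_n`, and modes of large index kill any given vector. -/
structure Heis (α β : ℤ → Module.End ℂ W) : Prop where
  aa : ∀ m n, α m * α n = α n * α m
  bb : ∀ m n, β m * β n = β n * β m
  ab : ∀ m n, α m * β n = β n * α m + if m = -n then 1 else 0
  loc : ∀ w, ∃ N : ℕ, ∀ n : ℤ, (N : ℤ) < n → α n w = 0 ∧ β n w = 0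

variable (α β : ℤ → Module.End ℂ W) (γ δ : ℂ)

/-- The mode `j_m` of `j = γ b + δ`. -/
def jop (m : ℤ) : Module.End ℂ W := γ • β m + (if m = 0 then δ else 0) • 1

/-- The normally ordered product `:a_i S:` for an operator `S` that is a polynomial in the
`b_n`. -/
def nrm (i : ℤ) (S : Module.End ℂ W) : Module.End ℂ W := if i < 0 then α i * S else S * α i

/-- The mode `m` of `j ^ 2`. -/
def Sq (m : ℤ) : Module.End ℂ W := lsum fun i : ℤ => jop β γ δ i * jop β γ δ (m - i)

/-- The mode `m` of the normally ordered product `a j`. -/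
def Pop (m : ℤ) : Module.End ℂ W := lsum fun i : ℤ => nrm α i (jop β γ δ (m - i))

/-- The mode `n` of the normally ordered product `a j ^ 2`. -/
def Gop (n : ℤ) : Module.End ℂ W :=
  lsum fun p : ℤ × ℤ => nrm α p.1 (jop β γ δ p.2 * jop β γ δ (n - p.1 - p.2))

variable {α β γ δ}

theorem nrm_add (i : ℤ) (S T : Module.End ℂ W) : nrm α i (S + T) = nrm α i S + nrm α i T := by
  unfold nrm; split_ifs <;> simp [mul_add, add_mul]

theorem nrm_smul (i : ℤ) (c : ℂ) (S : Module.End ℂ W) : nrm α i (c • S) = c • nrm α i S := by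
  unfold nrm; split_ifs <;> simp

theorem nrm_zero (i : ℤ) : nrm α i (0 : Module.End ℂ W) = 0 := by
  unfold nrm; split_ifs <;> simp

theorem jop_of_ne {m : ℤ} (h : m ≠ 0) : jop β γ δ m = γ • β m := by simp [jop, h]

namespace Heis

variable (H : Heis α β)
include H

theorem jj (m n : ℤ) : jop β γ δ m * jop β γ δ n = jop β γ δ n * jop β γ δ m := by
  simp only [jop, add_mul, mul_add, smul_mul_assoc, mul_smul_comm, one_mul, mul_one, H.bb m n,
    smul_add, smul_smul]
  rw [mul_comm (if n = 0 then δ else 0)]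
  module

theorem jb (m n : ℤ) : jop β γ δ m * β n = β n * jop β γ δ m := by
  simp [jop, add_mul, mul_add, H.bb m n]

theorem aj (m n : ℤ) : α m * jop β γ δ n = jop β γ δ n * α m + if m = -n then γ • 1 else 0 := by
  simp only [jop, add_mul, mul_add, smul_mul_assoc, mul_smul_comm, one_mul, mul_one, H.ab m n,
    smul_add]
  split_ifs <;> module

theorem locj (w : W) : ∃ N : ℕ, ∀ n : ℤ, (N : ℤ) < n → α n w = 0 ∧ jop β γ δ n w = 0 := by
  obtain ⟨N, hN⟩ := H.loc w
  refine ⟨N, fun n hn => ⟨(hN n hn).1, ?_⟩⟩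
  rw [jop_of_ne (by omega), LinearMap.smul_apply, (hN n hn).2, smul_zero]

theorem aj_of_ne {m n : ℤ} (h : m ≠ -n) : α m * jop β γ δ n = jop β γ δ n * α m := by
  rw [H.aj, if_neg h, add_zero]

theorem locFin_Sq (m : ℤ) : LocFin fun i : ℤ => jop β γ δ i * jop β γ δ (m - i) := by
  intro w
  obtain ⟨N, hN⟩ := H.locj (γ := γ) (δ := δ) w
  refine (Set.finite_Icc (m - N) N).subset fun i hi => ?_
  by_contra hc
  apply hi
  rw [Set.mem_Icc, not_and_or, not_le, not_le] at hc
  obtain hc | hc := hc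
  · simp [(hN (m - i) (by omega)).2]
  · simp only
    rw [H.jj]
    simp [(hN i hc).2]

theorem Sq_eq_zero {w : W} {N : ℕ} (hN : ∀ n : ℤ, (N : ℤ) < n → jop β γ δ n w = 0) {m : ℤ}
    (hm : (2 * N : ℤ) < m) : Sq β γ δ m w = 0 := by
  rw [Sq, lsum_apply (H.locFin_Sq m)]
  refine finsum_eq_zero_of_forall_eq_zero fun i => ?_
  by_cases h : (N : ℤ) < m - i
  · simp [hN _ h]
  · rw [H.jj]
    simp [hN i (by omega)]

theorem locFin_Pop (m : ℤ) : LocFin fun i : ℤ => nrm α i (jop β γ δ (m - i)) := by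
  intro w
  obtain ⟨N, hN⟩ := H.locj (γ := γ) (δ := δ) w
  refine (Set.finite_Icc (min (m - N) 0) N).subset fun i hi => ?_
  by_contra hc
  apply hi
  rw [Set.mem_Icc, not_and_or, not_le, not_le] at hc
  simp only [nrm]
  split_ifs with h
  · simp [(hN (m - i) (by omega)).2]
  · simp [(hN i (by omega)).1]

theorem nrm_jj_eq_zero {w : W} {N : ℕ}
    (hN : ∀ n : ℤ, (N : ℤ) < n → α n w = 0 ∧ jop β γ δ n w = 0) {i k l : ℤ}
    (h : N < i ∨ N < k ∨ N < l) : nrm α i (jop β γ δ k * jop β γ δ l) w = 0 := by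
  have key : ∀ k l : ℤ, (N : ℤ) < l → nrm α i (jop β γ δ k * jop β γ δ l) w = 0 := by
    intro k l hl
    unfold nrm
    split_ifs with hi
    · simp [(hN l hl).2]
    · rw [mul_assoc, ← H.aj_of_ne (by omega)]
      simp [(hN l hl).2]
  obtain h | h | h := h
  · rw [nrm, if_neg (by omega)]
    simp [(hN i h).1]
  · rw [H.jj]
    exact key _ _ h
  · exact key _ _ h

theorem locFin_Gop (n : ℤ) : LocFin fun p : ℤ × ℤ =>
    nrm α p.1 (jop β γ δ p.2 * jop β γ δ (n - p.1 - p.2)) := by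
  intro w
  obtain ⟨N, hN⟩ := H.locj (γ := γ) (δ := δ) w
  refine ((Set.finite_Icc (n - 2 * N) N).prod (Set.finite_Icc (n - 2 * N) N)).subset
    fun p hp => ?_
  by_contra hc
  refine hp (H.nrm_jj_eq_zero hN ?_)
  rw [Set.mem_prod, Set.mem_Icc, Set.mem_Icc] at hc
  omega

/-! #### Commutators with the generators -/

theorem nrm_b {i : ℤ} {S : Module.End ℂ W} (m : ℤ) (hS : S * β m = β m * S) :
    nrm α i S * β m - β m * nrm α i S = if i = -m then S else 0 := by
  unfold nrm
  split_ifs with h1 h2 h2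
  · rw [mul_assoc, hS, ← mul_assoc, H.ab, if_pos h2, add_mul, one_mul, mul_assoc,
      add_sub_cancel_left]
  · rw [mul_assoc, hS, ← mul_assoc, H.ab, if_neg h2, add_zero, mul_assoc, sub_self]
  · rw [mul_assoc, H.ab, if_pos h2, mul_add, mul_one, ← mul_assoc, hS, mul_assoc,
      add_sub_cancel_left]
  · rw [mul_assoc, H.ab, if_neg h2, add_zero, ← mul_assoc, hS, mul_assoc, sub_self]

theorem nrm_a (i m : ℤ) (S : Module.End ℂ W) :
    nrm α i S * α m - α m * nrm α i S = nrm α i (S * α m - α m * S) := by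
  unfold nrm
  split_ifs
  · rw [mul_sub, mul_assoc, ← mul_assoc (α m), H.aa m i, mul_assoc (α i) (α m)]
  · rw [sub_mul, mul_assoc, H.aa i m, ← mul_assoc, mul_assoc (α m)]

theorem ja (m n : ℤ) : jop β γ δ n * α m - α m * jop β γ δ n =
    if n = -m then (-γ) • 1 else 0 := by
  rw [H.aj]
  by_cases h : m = -n
  · rw [if_pos h, if_pos (by omega)]; simp
  · rw [if_neg h, if_neg (by omega)]; simp

theorem Gop_b (n m : ℤ) : Gop α β γ δ n * β m - β m * Gop α β γ δ n = Sq β γ δ (n + m) := by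
  rw [Gop, lsum_comm (H.locFin_Gop n), Sq, ← lsum_fiber (H.locFin_Sq (n + m)) (-m)]
  congr 1
  funext p
  rw [H.nrm_b]
  · split_ifs with h
    · rw [h, show n - -m - p.2 = n + m - p.2 by ring]
    · rfl
  · rw [mul_assoc, H.jb, ← mul_assoc, H.jb, mul_assoc]

theorem Gop_a (n m : ℤ) :
    Gop α β γ δ n * α m - α m * Gop α β γ δ n = (-2 * γ) • Pop α β γ δ (n + m) := by
  rw [Gop, lsum_comm (H.locFin_Gop n)]
  have h1 := (H.locFin_Pop (γ := γ) (δ := δ) (n + m)).smul (-γ)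
  have g1 := lsum_graph h1 (fun _ => -m)
  have g2 := lsum_graph h1 (fun i => n - i + m)
  have : (fun p : ℤ × ℤ => nrm α p.1 (jop β γ δ p.2 * jop β γ δ (n - p.1 - p.2)) * α m -
      α m * nrm α p.1 (jop β γ δ p.2 * jop β γ δ (n - p.1 - p.2))) = fun p : ℤ × ℤ =>
      (if p.2 = -m then (-γ) • nrm α p.1 (jop β γ δ (n + m - p.1)) else 0) +
      (if p.2 = n - p.1 + m then (-γ) • nrm α p.1 (jop β γ δ (n + m - p.1)) else 0) := by
    funext p
    obtain ⟨i, k⟩ := p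
    simp only
    rw [H.nrm_a]
    have : jop β γ δ k * jop β γ δ (n - i - k) * α m - α m * (jop β γ δ k * jop β γ δ (n - i - k))
      = jop β γ δ k * (jop β γ δ (n - i - k) * α m - α m * jop β γ δ (n - i - k)) +
        (jop β γ δ k * α m - α m * jop β γ δ k) * jop β γ δ (n - i - k) := by noncomm_ring
    rw [this, H.ja, H.ja, nrm_add, add_comm]
    congr 1
    · split_ifs with h
      · rw [smul_mul_assoc, one_mul, nrm_smul, h, show n - i - -m = n + m - i by ring]
      · rw [zero_mul, nrm_zero]
    · by_cases h : k = n - i + m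
      · rw [if_pos h, if_pos (by omega), mul_smul_comm, mul_one, nrm_smul, h,
          show n - i + m = n + m - i by ring]
      · rw [if_neg h, if_neg (by omega), mul_zero, nrm_zero]
  rw [this, lsum_add g1.2 g2.2, g1.1, g2.1, lsum_smul _ (H.locFin_Pop (n + m)), Pop]
  module

theorem Pop_b (m l : ℤ) : Pop α β γ δ m * β l - β l * Pop α β γ δ m = jop β γ δ (m + l) := by
  rw [Pop, lsum_comm (H.locFin_Pop m)]
  have : (fun i : ℤ => nrm α i (jop β γ δ (m - i)) * β l - β l * nrm α i (jop β γ δ (m - i))) =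
      fun i : ℤ => if i = -l then jop β γ δ (m - i) else 0 :=
    funext fun i => H.nrm_b l (H.jb _ _)
  rw [this, lsum_single (-l) fun i => jop β γ δ (m - i), sub_neg_eq_add]

omit H in
theorem comm_jop {X : Module.End ℂ W} {i : ℤ} {Y : Module.End ℂ W}
    (h : X * β i - β i * X = Y) :
    X * jop β γ δ i - jop β γ δ i * X = γ • Y := by
  rw [← h, jop]
  simp only [mul_add, add_mul, mul_smul_comm, smul_mul_assoc, mul_one, one_mul, smul_sub]
  abel

theorem Gop_j (n i : ℤ) : Gop α β γ δ n * jop β γ δ i - jop β γ δ i * Gop α β γ δ n =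
    γ • Sq β γ δ (n + i) := comm_jop (H.Gop_b n i)

theorem Pop_j (m l : ℤ) : Pop α β γ δ m * jop β γ δ l - jop β γ δ l * Pop α β γ δ m =
    γ • jop β γ δ (m + l) := comm_jop (H.Pop_b m l)

theorem jSq (m n : ℤ) : jop β γ δ m * Sq β γ δ n = Sq β γ δ n * jop β γ δ m := by
  rw [Sq, ← lsum_mul_left _ (H.locFin_Sq n), ← lsum_mul_right _ (H.locFin_Sq n)]
  congr 1
  funext i
  rw [← mul_assoc, H.jj m i, mul_assoc, H.jj m, mul_assoc]

theorem Sq_b (m n : ℤ) : Sq β γ δ n * β m = β m * Sq β γ δ n := by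
  rw [Sq, ← lsum_mul_left _ (H.locFin_Sq n), ← lsum_mul_right _ (H.locFin_Sq n)]
  congr 1
  funext i
  rw [mul_assoc, H.jb, ← mul_assoc, H.jb, mul_assoc]

theorem locFin_jSq (M : ℤ) : LocFin fun i : ℤ => jop β γ δ i * Sq β γ δ (M - i) := by
  intro w
  obtain ⟨N, hN⟩ := H.locj (γ := γ) (δ := δ) w
  refine (Set.finite_Icc (M - 2 * N) N).subset fun i hi => ?_
  by_contra hc
  apply hi
  rw [Set.mem_Icc, not_and_or, not_le, not_le] at hc
  obtain hc | hc := hc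
  · simp [H.Sq_eq_zero (fun n hn => (hN n hn).2) (show (2 * N : ℤ) < M - i by omega)]
  · simp only
    rw [H.jSq]
    simp [(hN i hc).2]

/-- The commutator of the modes `n` of `a j ^ 2` and `m` of `j ^ 2` is `2 γ (j ^ 3)_{n + m}`. -/
theorem Gop_Sq (n m : ℤ) : Gop α β γ δ n * Sq β γ δ m - Sq β γ δ m * Gop α β γ δ n =
    (2 * γ) • lsum fun i : ℤ => jop β γ δ i * Sq β γ δ (n + m - i) := by
  have h0 := H.locFin_Sq (γ := γ) (δ := δ) m
  have hL := (H.locFin_jSq (γ := γ) (δ := δ) (n + m)).smul γ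
  have e1 : Gop α β γ δ n * Sq β γ δ m - Sq β γ δ m * Gop α β γ δ n =
      lsum fun i : ℤ => (γ • (jop β γ δ (m - i) * Sq β γ δ (n + m - (m - i)))) +
        γ • (jop β γ δ i * Sq β γ δ (n + m - i)) := by
    rw [Sq, ← neg_sub, lsum_comm h0, ← neg_one_smul ℂ, ← lsum_smul _ (h0.comm _)]
    congr 1
    funext i
    have e : (-1 : ℂ) • (jop β γ δ i * jop β γ δ (m - i) * Gop α β γ δ n -
        Gop α β γ δ n * (jop β γ δ i * jop β γ δ (m - i))) =
        (Gop α β γ δ n * jop β γ δ i - jop β γ δ i * Gop α β γ δ n) * jop β γ δ (m - i) +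
        jop β γ δ i * (Gop α β γ δ n * jop β γ δ (m - i) - jop β γ δ (m - i) * Gop α β γ δ n) := by
      rw [neg_one_smul]; noncomm_ring
    rw [e, H.Gop_j, H.Gop_j, smul_mul_assoc, ← H.jSq, mul_smul_comm,
      show n + m - (m - i) = n + i by ring, show n + (m - i) = n + m - i by ring]
  have hr : (lsum fun i : ℤ => γ • (jop β γ δ (m - i) * Sq β γ δ (n + m - (m - i)))) =
      lsum fun i : ℤ => γ • (jop β γ δ i * Sq β γ δ (n + m - i)) :=
    lsum_equiv (Equiv.subLeft m) hL
  have hL' : LocFin fun i : ℤ => γ • (jop β γ δ (m - i) * Sq β γ δ (n + m - (m - i))) :=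
    hL.comp (Equiv.subLeft m).injective
  rw [e1, lsum_add hL' hL, hr,
    lsum_smul _ (H.locFin_jSq (n + m))]
  module

end Heis

end Heisenberg

section Heisenberg

variable {W : Type*} [AddCommGroup W] [Module ℂ W] (α β : ℤ → Module.End ℂ W) (γ δ : ℂ)

/-! ### Commutators of the modes of `a j` and `a j ^ 2` -/

/-- The part of `:a_i (a j)_{n+i}: j_{l-i}` in the commutator of `Gop n` and `Pop l`, ordered
according to the sign of `i`. -/
def contr (n l i : ℤ) : Module.End ℂ W :=
  (-2 * γ) • if i < 0 then Pop α β γ δ (n + i) * jop β γ δ (l - i)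
    else jop β γ δ (l - i) * Pop α β γ δ (n + i)

/-- The charge operator `∑_{i ≠ 0} :a_i b_{-i}:`. On `a_{-λ} b_{-μ} f` it acts by
`p(μ) - p(λ)`. -/
def chg : Module.End ℂ W := lsum fun i : ℤ => if i = 0 then 0 else nrm α i (β (-i))

/-- The part of the zero mode of `a j ^ 2` in which both factors `j` have nonzero index. -/
def Rop : Module.End ℂ W := lsum fun p : ℤ × ℤ => if p.2 ≠ 0 ∧ p.1 + p.2 ≠ 0 then
  nrm α p.1 (jop β γ δ p.2 * jop β γ δ (0 - p.1 - p.2)) else 0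

variable {α β γ δ}

theorem lsum_const_Ico (n : ℤ) (hn : n ≤ 0) (S : Module.End ℂ W) :
    (lsum fun i : ℤ => if 0 ≤ i ∧ i < -n then S else 0) = (-n : ℂ) • S := by
  have hs : ∀ w, (Function.support fun i : ℤ => (if 0 ≤ i ∧ i < -n then S else 0) w) ⊆
      Finset.Ico (0 : ℤ) (-n) := fun w i hi => by
    rw [Finset.coe_Ico, Set.mem_Ico]
    by_contra hc
    exact hi (by simp [if_neg hc])
  ext w
  rw [lsum_apply fun w => (Finset.finite_toSet _).subset (hs w),
    finsum_eq_sum_of_support_subset _ (hs w), Finset.sum_congr rfl fun i hi => by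
      rw [if_pos (Finset.mem_Ico.1 hi)], Finset.sum_const, Int.card_Ico, sub_zero,
    LinearMap.smul_apply, ← Nat.cast_smul_eq_nsmul ℂ]
  congr 1
  have : ((-n).toNat : ℤ) = -n := Int.toNat_of_nonneg (by omega)
  exact_mod_cast this

namespace Heis

variable (H : Heis α β)
include H

theorem locFin_nrmSq (M : ℤ) : LocFin fun i : ℤ => γ • nrm α i (Sq β γ δ (M - i)) := by
  refine LocFin.smul _ fun w => ?_
  obtain ⟨N, hN⟩ := H.locj (γ := γ) (δ := δ) w
  refine (Set.finite_Icc (min (M - 2 * N) 0) N).subset fun i hi => ?_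
  by_contra hc
  apply hi
  rw [Set.mem_Icc, not_and_or, not_le, not_le] at hc
  simp only [nrm]
  split_ifs with h
  · simp [H.Sq_eq_zero (fun n hn => (hN n hn).2) (show (2 * N : ℤ) < M - i by omega)]
  · simp [(hN i (by omega)).1]

theorem Gop_nrm (n l i : ℤ) :
    Gop α β γ δ n * nrm α i (jop β γ δ (l - i)) - nrm α i (jop β γ δ (l - i)) * Gop α β γ δ n =
      γ • nrm α i (Sq β γ δ (n + l - i)) + contr α β γ δ n l i := by
  have h1 := H.Gop_a (γ := γ) (δ := δ) n i
  have h2 := H.Gop_j (γ := γ) (δ := δ) n (l - i)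
  rw [← add_sub_assoc] at h2
  unfold contr nrm
  split_ifs
  · rw [← smul_mul_assoc (-2 * γ), ← h1, ← mul_smul_comm γ, ← h2]; noncomm_ring
  · rw [← mul_smul_comm (-2 * γ), ← h1, ← smul_mul_assoc γ, ← h2]; noncomm_ring

theorem locFin_contr (n l : ℤ) : LocFin fun i : ℤ => contr α β γ δ n l i := by
  have h := (((H.locFin_Pop (γ := γ) (δ := δ) l).comm (Gop α β γ δ n)).smul (-1)).sub
    (H.locFin_nrmSq (γ := γ) (δ := δ) (n + l))
  convert h using 2 with i
  rw [eq_sub_iff_add_eq, add_comm, ← H.Gop_nrm, neg_one_smul, neg_sub]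

theorem Gop_Pop_aux (n l : ℤ) :
    Gop α β γ δ n * Pop α β γ δ l - Pop α β γ δ l * Gop α β γ δ n =
      (lsum fun i : ℤ => γ • nrm α i (Sq β γ δ (n + l - i))) +
        lsum fun i : ℤ => contr α β γ δ n l i := by
  have h := H.locFin_Pop (γ := γ) (δ := δ) l
  rw [← lsum_add (H.locFin_nrmSq (n + l)) (H.locFin_contr n l), ← neg_sub, Pop, lsum_comm h,
    ← neg_one_smul ℂ, ← lsum_smul _ (h.comm _)]
  congr 1
  funext i
  rw [← H.Gop_nrm, neg_one_smul, neg_sub]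

/-- The two commutators differ only in the normal ordering of finitely many products; the
anomaly is what the term `2 γ ^ 2 b_{-1}` of `π(g) a` compensates. -/
theorem Gop_Pop (n l : ℤ) (hn : n ≤ 0) :
    (Gop α β γ δ n * Pop α β γ δ l - Pop α β γ δ l * Gop α β γ δ n) -
      (Gop α β γ δ 0 * Pop α β γ δ (n + l) - Pop α β γ δ (n + l) * Gop α β γ δ 0) =
      (-2 * n * γ ^ 2) • jop β γ δ (n + l) := by
  have h1 := H.locFin_contr (γ := γ) (δ := δ) n l
  have h0 := H.locFin_contr (γ := γ) (δ := δ) 0 (n + l)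
  have e : (lsum fun i : ℤ => contr α β γ δ 0 (n + l) (i + n)) =
      lsum fun i : ℤ => contr α β γ δ 0 (n + l) i := lsum_equiv (Equiv.addRight n) h0
  have h0' : LocFin fun i : ℤ => contr α β γ δ 0 (n + l) (i + n) :=
    h0.comp (Equiv.addRight n).injective
  rw [H.Gop_Pop_aux, H.Gop_Pop_aux, zero_add, add_sub_add_left_eq_sub, ← e, ← lsum_sub h1 h0']
  have : (fun i : ℤ => contr α β γ δ n l i - contr α β γ δ 0 (n + l) (i + n)) = fun i : ℤ =>
      if 0 ≤ i ∧ i < -n then (2 * γ ^ 2) • jop β γ δ (n + l) else 0 := by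
    funext i
    have e1 : n + l - (i + n) = l - i := by ring
    unfold contr
    rw [e1, zero_add, add_comm i n]
    by_cases hi : i < 0
    · rw [if_pos hi, if_pos (by omega), if_neg (by omega), sub_self]
    · by_cases hi2 : n + i < 0
      · rw [if_neg hi, if_pos hi2, if_pos (by omega), ← smul_sub, ← neg_sub, H.Pop_j,
          show n + i + (l - i) = n + l by ring]
        module
      · rw [if_neg hi, if_neg hi2, if_neg (by omega), sub_self]
  rw [this, lsum_const_Ico n hn]
  module

/-! ### The zero mode of `a j ^ 2` and the charge -/

theorem locFin_chg : LocFin fun i : ℤ => if i = 0 then 0 else nrm α i (β (-i)) := by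
  intro w
  obtain ⟨N, hN⟩ := H.loc w
  refine (Set.finite_Icc (-(N : ℤ)) N).subset fun i hi => ?_
  by_contra hc
  apply hi
  rw [Set.mem_Icc, not_and_or, not_le, not_le] at hc
  simp only [nrm]
  split_ifs with h h
  · simp
  · simp [(hN (-i) (by omega)).2]
  · simp [(hN i (by omega)).1]

theorem chg_b (m : ℤ) : chg α β * β m - β m * chg α β = if m = 0 then 0 else β m := by
  rw [chg, lsum_comm H.locFin_chg]
  have : (fun i : ℤ => (if i = 0 then 0 else nrm α i (β (-i))) * β m -
      β m * (if i = 0 then 0 else nrm α i (β (-i)))) =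
      fun i : ℤ => if i = -m then (if m = 0 then 0 else β (-i)) else 0 := by
    funext i
    by_cases hi : i = 0
    · by_cases hm : m = 0 <;> simp [hi, hm]
    · rw [if_neg hi, H.nrm_b _ (H.bb _ _)]
      by_cases h : i = -m
      · rw [if_pos h, if_pos h, if_neg (by omega)]
      · rw [if_neg h, if_neg h]
  rw [this, lsum_single (-m) fun i => (if m = 0 then 0 else β (-i)), neg_neg]

theorem chg_a (m : ℤ) : chg α β * α m - α m * chg α β = if m = 0 then 0 else -α m := by
  rw [chg, lsum_comm H.locFin_chg]
  have : (fun i : ℤ => (if i = 0 then 0 else nrm α i (β (-i))) * α m -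
      α m * (if i = 0 then 0 else nrm α i (β (-i)))) =
      fun i : ℤ => if i = m then (if m = 0 then 0 else -α i) else 0 := by
    funext i
    by_cases hi : i = 0
    · by_cases hm : m = 0
      · simp [hi, hm]
      · simp [hi, Ne.symm hm]
    · rw [if_neg hi, H.nrm_a]
      have e : β (-i) * α m - α m * β (-i) = if i = m then -1 else 0 := by
        rw [H.ab]
        by_cases h : i = m
        · simp [h]
        · rw [if_neg h, if_neg (by omega)]; simp
      rw [e]
      by_cases h : i = m
      · rw [if_pos h, if_pos h, if_neg (by omega)]
        unfold nrm; split_ifs <;> simp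
      · rw [if_neg h, if_neg h, nrm_zero]
  rw [this, lsum_single m fun i => (if m = 0 then 0 else -α i)]

theorem locFin_Rop : LocFin fun p : ℤ × ℤ => if p.2 ≠ 0 ∧ p.1 + p.2 ≠ 0 then
    nrm α p.1 (jop β γ δ p.2 * jop β γ δ (0 - p.1 - p.2)) else 0 :=
  (H.locFin_Gop 0).mem_ne fun p => p.2 ≠ 0 ∧ p.1 + p.2 ≠ 0

theorem nrm_j0 {i : ℤ} (_ : i ≠ 0) (k : ℤ) :
    nrm α i (jop β γ δ 0 * β k) = jop β γ δ 0 * nrm α i (β k) := by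
  unfold nrm
  split_ifs
  · rw [← mul_assoc, H.aj_of_ne (by omega), mul_assoc]
  · rw [mul_assoc]

/-- The zero mode of `a j ^ 2`, sorted by the number of factors `j_0`. -/
theorem Gop_zero : Gop α β γ δ 0 =
    jop β γ δ 0 * jop β γ δ 0 * α 0 + (2 * γ) • (jop β γ δ 0 * chg α β) + Rop α β γ δ := by
  have hS : LocFin fun i : ℤ => γ • (jop β γ δ 0 * if i = 0 then 0 else nrm α i (β (-i))) :=
    (H.locFin_chg.mul_left _).smul γ
  have g1 := lsum_graph hS fun _ => 0
  have g2 := lsum_graph hS fun i => -i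
  have h0 : LocFin fun p : ℤ × ℤ => if p = (0, 0) then
      jop β γ δ 0 * jop β γ δ 0 * α 0 else 0 := fun w =>
    (Set.finite_singleton ((0, 0) : ℤ × ℤ)).subset fun i hi => by
      by_contra hc
      exact hi (by simp [show ¬ i = (0, 0) from hc])
  have e0 := lsum_single (W := W) ((0, 0) : ℤ × ℤ) fun _ => jop β γ δ 0 * jop β γ δ 0 * α 0
  have : (fun p : ℤ × ℤ => nrm α p.1 (jop β γ δ p.2 * jop β γ δ (0 - p.1 - p.2))) =
      fun p : ℤ × ℤ => (if p = (0, 0) then jop β γ δ 0 * jop β γ δ 0 * α 0 else 0) +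
        ((if p.2 = 0 then γ • (jop β γ δ 0 * if p.1 = 0 then 0 else nrm α p.1 (β (-p.1)))
          else 0) +
        ((if p.2 = -p.1 then γ • (jop β γ δ 0 * if p.1 = 0 then 0 else nrm α p.1 (β (-p.1)))
          else 0) +
        if p.2 ≠ 0 ∧ p.1 + p.2 ≠ 0 then
          nrm α p.1 (jop β γ δ p.2 * jop β γ δ (0 - p.1 - p.2)) else 0)) := by
    funext p
    obtain ⟨i, k⟩ := p
    simp only
    by_cases hi : i = 0
    · subst hi
      by_cases hk : k = 0
      · subst hk
        simp [nrm]
      · simp [hk]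
    · by_cases hk : k = 0
      · subst hk
        have e1 : jop β γ δ (0 - i - 0) = γ • β (-i) := by
          rw [jop_of_ne (by omega), zero_sub, sub_zero]
        rw [e1, mul_smul_comm, nrm_smul, H.nrm_j0 hi]
        simp [hi]
      · by_cases hk2 : k = -i
        · subst hk2
          have e1 : jop β γ δ (-i) = γ • β (-i) := jop_of_ne (by omega)
          rw [H.jj, show 0 - i - -i = 0 by ring, e1, mul_smul_comm, nrm_smul, H.nrm_j0 hi]
          simp [hi]
        · have : i + k ≠ 0 := by omega
          simp [hi, hk, hk2, this]
  rw [Gop, this, lsum_add h0 (g1.2.add (g2.2.add H.locFin_Rop)), e0,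
    lsum_add g1.2 (g2.2.add H.locFin_Rop), lsum_add g2.2 H.locFin_Rop, g1.1, g2.1,
    lsum_smul _ (H.locFin_chg.mul_left _), lsum_mul_left _ H.locFin_chg]
  change _ + (γ • (_ * chg α β) + (γ • (_ * chg α β) + Rop α β γ δ)) = _
  module

theorem Pop_zero : Pop α β γ δ 0 = jop β γ δ 0 * α 0 + γ • chg α β := by
  have e0 := lsum_single (W := W) (0 : ℤ) fun _ => jop β γ δ 0 * α 0
  have h0 : LocFin fun p : ℤ => if p = 0 then jop β γ δ 0 * α 0 else 0 := fun w =>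
    (Set.finite_singleton (0 : ℤ)).subset fun i hi => by
      by_contra hc
      exact hi (by simp [show ¬ i = 0 from hc])
  have : (fun i : ℤ => nrm α i (jop β γ δ (0 - i))) = fun i : ℤ =>
      (if i = 0 then jop β γ δ 0 * α 0 else 0) +
        γ • if i = 0 then 0 else nrm α i (β (-i)) := by
    funext i
    by_cases hi : i = 0
    · subst hi; simp [nrm]
    · rw [if_neg hi, if_neg hi, zero_add, jop_of_ne (by omega), nrm_smul, zero_sub]
  rw [Pop, this, lsum_add h0 (H.locFin_chg.smul γ), e0, lsum_smul _ H.locFin_chg]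
  rfl

theorem Rop_smul : Rop α β γ δ = γ ^ 2 • Rop α β 1 0 := by
  rw [Rop, Rop, ← lsum_smul _ H.locFin_Rop]
  congr 1
  funext p
  split_ifs with h
  · rw [jop_of_ne h.1, jop_of_ne (show 0 - p.1 - p.2 ≠ 0 by omega), jop_of_ne h.1,
      jop_of_ne (show 0 - p.1 - p.2 ≠ 0 by omega), one_smul, one_smul, smul_mul_smul_comm,
      nrm_smul, sq]
  · simp

/-- The zero mode of `a (γ b + δ) ^ 2` in terms of those of `a b ^ 2`, `a b` and `a`. -/
theorem Gop_zero_expand : Gop α β γ δ 0 =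
    γ ^ 2 • Gop α β 1 0 0 + (2 * γ * δ) • Pop α β 1 0 0 + δ ^ 2 • α 0 := by
  have e : jop β γ δ 0 = γ • β 0 + δ • 1 := by simp [jop]
  have e1 : jop β 1 0 0 = β 0 := by simp [jop]
  rw [H.Gop_zero, H.Gop_zero, H.Pop_zero, H.Rop_smul, e, e1]
  simp only [add_mul, mul_add, smul_mul_assoc, mul_smul_comm, one_mul, mul_one, smul_add,
    smul_smul]
  module

theorem Gop_zero_vac {v : W} (h : ∀ n : ℤ, 1 ≤ n → α n v = 0 ∧ β n v = 0) :
    chg α β v = 0 ∧ Rop α β γ δ v = 0 := by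
  have hj : ∀ n : ℤ, ((0 : ℕ) : ℤ) < n → α n v = 0 ∧ jop β γ δ n v = 0 := fun n hn => by
    have := h n (by simpa using Int.add_one_le_of_lt hn)
    refine ⟨this.1, ?_⟩
    rw [jop_of_ne (by simp at hn; omega), LinearMap.smul_apply, this.2, smul_zero]
  constructor
  · rw [chg, lsum_apply H.locFin_chg]
    refine finsum_eq_zero_of_forall_eq_zero fun i => ?_
    unfold nrm
    split_ifs with h0 h1
    · simp
    · simp [(h (-i) (by omega)).2]
    · simp [(h i (by omega)).1]
  · rw [Rop, lsum_apply H.locFin_Rop]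
    refine finsum_eq_zero_of_forall_eq_zero fun p => ?_
    split_ifs with h0
    · exact H.nrm_jj_eq_zero hj (by simp only [Nat.cast_zero]; omega)
    · simp

end Heis

end Heisenberg

/-! ### The Heisenberg module `𝒟^ch(ℍ)` -/

theorem aOp_pos (n : ℕ+) : aOp (n : ℤ) = pdOp (Sum.inr n) := by
  obtain ⟨m, rfl⟩ : ∃ m : ℕ, n = m.succPNat := ⟨n.natPred, by simp⟩
  rfl

theorem bOp_pos (n : ℕ+) : bOp (n : ℤ) = -pdOp (Sum.inl n) := by
  obtain ⟨m, rfl⟩ : ∃ m : ℕ, n = m.succPNat := ⟨n.natPred, by simp⟩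
  rfl

theorem aOp_neg (n : ℕ+) : aOp (-(n : ℤ)) = mulOp (MvPolynomial.X (Sum.inl n)) := by
  obtain ⟨m, rfl⟩ : ∃ m : ℕ, n = m.succPNat := ⟨n.natPred, by simp⟩
  rfl

theorem bOp_neg (n : ℕ+) : bOp (-(n : ℤ)) = mulOp (MvPolynomial.X (Sum.inr n)) := by
  obtain ⟨m, rfl⟩ : ∃ m : ℕ, n = m.succPNat := ⟨n.natPred, by simp⟩
  rfl

theorem aOp_zero : aOp 0 = D0 := rfl

theorem bOp_zero : bOp 0 = mulOp (MvPolynomial.C coordH) := rfl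

/-- Case distinction on the sign of an integer, in the form suited to the modes. -/
theorem int_cases (n : ℤ) : (∃ m : ℕ+, n = m) ∨ n = 0 ∨ ∃ m : ℕ+, n = -(m : ℤ) := by
  obtain h | h | h := lt_trichotomy n 0
  · refine Or.inr (Or.inr ⟨⟨(-n).toNat, by omega⟩, ?_⟩)
    simp only [PNat.mk_coe]; omega
  · exact Or.inr (Or.inl h)
  · refine Or.inl ⟨⟨n.toNat, by omega⟩, ?_⟩
    simp only [PNat.mk_coe]; omega

theorem pdOp_eq_zero {i : ℕ+ ⊕ ℕ+} {w : Dch} (h : i ∉ w.vars) : pdOp i w = 0 :=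
  MvPolynomial.pderiv_eq_zero_of_notMem_vars h

/-- The index `n` of the variable `a_{-n}` or `b_{-n}`. -/
def varIdx : ℕ+ ⊕ ℕ+ → ℕ := Sum.elim (fun n => n) (fun n => n)

theorem heisD : Heis aOp bOp where
  aa := op_aa
  bb := op_bb
  ab := op_ab
  loc w := by
    refine ⟨w.vars.sup varIdx, fun n hn => ?_⟩
    have key : ∀ i ∈ w.vars, (varIdx i : ℤ) < n := fun i hi =>
      lt_of_le_of_lt (by exact_mod_cast Finset.le_sup (f := varIdx) hi) hn
    obtain ⟨m, rfl⟩ | h | ⟨m, hm⟩ := int_cases n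
    · rw [aOp_pos, bOp_pos, LinearMap.neg_apply, neg_eq_zero]
      exact ⟨pdOp_eq_zero fun h => (key _ h).ne rfl, pdOp_eq_zero fun h => (key _ h).ne rfl⟩
    · omega
    · have := m.pos; omega

/-- The mode `-n` of `π(g) a`, as a linear operator, for the lower row `(γ, δ)` of `g`. -/
def piAop (γ δ : ℂ) (n : ℕ+) : Module.End ℂ Dch :=
  Gop aOp bOp γ δ (-(n : ℤ)) + (2 * (n : ℂ) * γ ^ 2) • bOp (-(n : ℤ))

theorem piA_eq (g : SL(2, ℝ)) (n : ℕ+) : piA g n = piAop (g 1 0 : ℂ) (g 1 1 : ℂ) n := by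
  funext w
  rw [piA, piAop, LinearMap.add_apply, Gop, lsum_apply (heisD.locFin_Gop _)]
  rfl

/-! ### The zero mode of `a j ^ 2` commutes with the modes of `π(g) a` -/

theorem coeff_pdOp (i : ℕ+ ⊕ ℕ+) (w : Dch) (s : ℕ+ ⊕ ℕ+ →₀ ℕ) :
    (pdOp i w).coeff s = (s i + 1) • w.coeff (s + Finsupp.single i 1) := by
  refine (MvPolynomial.coeff_pderiv (R := Hol) w s).trans ?_
  rw [nsmul_eq_mul, mul_comm, Nat.cast_add, Nat.cast_one]

/-- An operator that commutes with all annihilators and never produces a constant term is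
zero. -/
theorem eq_zero_of_comm_pd (Z : Module.End ℂ Dch) (h : ∀ i, Z * pdOp i = pdOp i * Z)
    (h0 : ∀ w, (Z w).coeff 0 = 0) : Z = 0 := by
  refine LinearMap.ext fun w => MvPolynomial.ext _ _ fun s => ?_
  rw [LinearMap.zero_apply, MvPolynomial.coeff_zero]
  induction hn : s.degree using Nat.strong_induction_on generalizing s w with
  | _ n ih =>
    by_cases hs : s = 0
    · rw [hs]; exact h0 w
    · obtain ⟨i, hi⟩ := Finsupp.ne_iff.1 hs
      have hle : Finsupp.single i 1 ≤ s := by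
        rw [Finsupp.single_le_iff]; exact Nat.one_le_iff_ne_zero.2 hi
      have e : s - Finsupp.single i 1 + Finsupp.single i 1 = s := tsub_add_cancel_of_le hle
      have hd : (s - Finsupp.single i 1).degree + 1 = s.degree := by
        rw [← e, map_add, Finsupp.degree_single, add_tsub_cancel_right]
      have h1 := ih _ (by omega) (pdOp i w) (s - Finsupp.single i 1) rfl
      have h2 : Z (pdOp i w) = pdOp i (Z w) := LinearMap.congr_fun (h i) w
      rw [h2, coeff_pdOp, e, ← Nat.cast_smul_eq_nsmul ℂ] at h1
      exact (smul_eq_zero.1 h1).resolve_left (Nat.cast_ne_zero.2 (Nat.succ_ne_zero _))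

theorem coeff_zero_X_mul (i : ℕ+ ⊕ ℕ+) (w : Dch) :
    (mulOp (MvPolynomial.X i) w).coeff 0 = 0 := by
  change (MvPolynomial.X i * w).coeff 0 = 0
  rw [MvPolynomial.coeff_X_mul']; simp

theorem coeff_zero_neg {n : ℤ} (hn : n < 0) (w : Dch) :
    (aOp n w).coeff 0 = 0 ∧ (bOp n w).coeff 0 = 0 := by
  obtain ⟨m, rfl⟩ | h | ⟨m, rfl⟩ := int_cases n
  · have := m.pos; omega
  · omega
  · rw [aOp_neg, bOp_neg]
    exact ⟨coeff_zero_X_mul _ _, coeff_zero_X_mul _ _⟩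

theorem coeff_zero_jop_neg {γ δ : ℂ} {n : ℤ} (hn : n < 0) (w : Dch) :
    (jop bOp γ δ n w).coeff 0 = 0 := by
  rw [jop_of_ne (by omega), LinearMap.smul_apply, MvPolynomial.coeff_smul,
    (coeff_zero_neg hn w).2, smul_zero]

theorem coeff_finsum {ι : Type*} {f : ι → Dch} (hf : (Function.support f).Finite)
    (s : ℕ+ ⊕ ℕ+ →₀ ℕ) : (∑ᶠ i, f i).coeff s = ∑ᶠ i, (f i).coeff s :=
  map_finsum (MvPolynomial.lcoeff Hol s) hf

theorem coeff_zero_nrm {γ δ : ℂ} {i k l : ℤ} (h : i < 0 ∨ k < 0 ∨ l < 0) (w : Dch) :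
    (nrm aOp i (jop bOp γ δ k * jop bOp γ δ l) w).coeff 0 = 0 := by
  unfold nrm
  split_ifs with hi
  · exact (coeff_zero_neg hi _).1
  · obtain h | h | h := h
    · exact absurd h hi
    · rw [mul_assoc, Module.End.mul_apply]
      exact coeff_zero_jop_neg h _
    · rw [heisD.jj, mul_assoc, Module.End.mul_apply]
      exact coeff_zero_jop_neg h _

theorem coeff_zero_Gop_neg {γ δ : ℂ} {n : ℤ} (hn : n < 0) (w : Dch) :
    (Gop aOp bOp γ δ n w).coeff 0 = 0 := by
  rw [Gop, lsum_apply (heisD.locFin_Gop n), coeff_finsum (heisD.locFin_Gop n w)]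
  exact finsum_eq_zero_of_forall_eq_zero fun p => coeff_zero_nrm (by omega) w

/-- The function `γ b + δ` on `ℍ`. -/
def jHol (γ δ : ℂ) : Hol := γ • coordH + δ • 1

theorem jop_zero (γ δ : ℂ) : jop bOp γ δ 0 = mulOp (MvPolynomial.C (jHol γ δ)) := by
  refine LinearMap.ext fun w => ?_
  rw [jop, if_pos rfl, bOp_zero, LinearMap.add_apply, LinearMap.smul_apply, LinearMap.smul_apply,
    Module.End.one_apply]
  change γ • (MvPolynomial.C coordH * w) + δ • w = MvPolynomial.C (jHol γ δ) * w
  rw [jHol, map_add, add_mul, MvPolynomial.C_mul', MvPolynomial.C_mul', MvPolynomial.C_mul',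
    smul_assoc, smul_assoc, one_smul]

theorem coeff_zero_Gop_zero {γ δ : ℂ} (w : Dch) :
    (Gop aOp bOp γ δ 0 w).coeff 0 = jHol γ δ ^ 2 * dHol (w.coeff 0) := by
  rw [Gop, lsum_apply (heisD.locFin_Gop 0), coeff_finsum (heisD.locFin_Gop 0 w),
    finsum_eq_single _ ((0, 0) : ℤ × ℤ)]
  · simp only [nrm, lt_self_iff_false, if_false, sub_self, jop_zero]
    change (MvPolynomial.C _ * (MvPolynomial.C _ * D0 w)).coeff 0 = _
    rw [MvPolynomial.coeff_C_mul, MvPolynomial.coeff_C_mul, coeff_D0, sq, mul_assoc]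
  · rintro ⟨i, k⟩ h
    rw [Ne, Prod.mk.injEq] at h
    exact coeff_zero_nrm (by simp only; omega) w

theorem comm_jacobi {R : Type*} [Ring R] (x y c : R)
    (h : (x * c - c * x) * y - y * (x * c - c * x) +
      (x * (y * c - c * y) - (y * c - c * y) * x) = 0) :
    (x * y - y * x) * c = c * (x * y - y * x) := by
  rw [← sub_eq_zero, ← h]
  noncomm_ring

theorem Gop_piAop_comm (γ δ : ℂ) (n : ℕ+) :
    Gop aOp bOp γ δ 0 * piAop γ δ n = piAop γ δ n * Gop aOp bOp γ δ 0 := by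
  have H := heisD
  set X := Gop aOp bOp γ δ 0 with hX
  set Y := piAop γ δ n with hY
  have hn := n.pos
  -- Jacobi identity
  have jac : ∀ c Xc Yc : Module.End ℂ Dch, X * c - c * X = Xc → Y * c - c * Y = Yc →
      Xc * Y - Y * Xc + (X * Yc - Yc * X) = 0 → (X * Y - Y * X) * c = c * (X * Y - Y * X) := by
    rintro c _ _ rfl rfl h
    exact comm_jacobi X Y c h
  have hb : ∀ l, (X * Y - Y * X) * bOp l = bOp l * (X * Y - Y * X) := by
    intro l
    have hYb : Y * bOp l - bOp l * Y = Sq bOp γ δ (-n + l) := by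
      rw [← H.Gop_b, hY, piAop, add_mul, mul_add, smul_mul_assoc, mul_smul_comm, H.bb l]
      abel
    refine jac _ _ _ (H.Gop_b 0 l) hYb ?_
    rw [hY, piAop, mul_add, add_mul, smul_mul_assoc, mul_smul_comm, H.Sq_b, zero_add]
    have h1 := H.Gop_Sq (γ := γ) (δ := δ) 0 (-n + l)
    have h2 := H.Gop_Sq (γ := γ) (δ := δ) (-n) l
    rw [zero_add, ← h2] at h1
    rw [h1]
    abel
  have ha : ∀ l, (X * Y - Y * X) * aOp l = aOp l * (X * Y - Y * X) := by
    intro l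
    have hYa : Y * aOp l - aOp l * Y = (-2 * γ) • Pop aOp bOp γ δ (-n + l) +
        (if l = n then -(2 * (n : ℂ) * γ ^ 2) else 0) • 1 := by
      rw [← H.Gop_a, hY, piAop, add_mul, mul_add, smul_mul_assoc, mul_smul_comm, H.ab l, neg_neg]
      split_ifs <;> module
    refine jac _ _ _ (H.Gop_a 0 l) hYa ?_
    have h1 := H.Gop_Pop (γ := γ) (δ := δ) (-n) l (by omega)
    have h2 := H.Pop_b (γ := γ) (δ := δ) l (-n)
    rw [add_comm l] at h2
    rw [← hX, ← h2, ← sub_eq_zero] at h1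
    have h3 := congrArg (fun T => (2 * γ) • T) h1
    simp only [smul_zero] at h3
    rw [← h3, hY, piAop, zero_add]
    simp only [mul_add, add_mul, smul_mul_assoc, mul_smul_comm, mul_one, one_mul, smul_add,
      smul_sub, smul_smul]
    push_cast
    module
  have hZ : X * Y - Y * X = 0 := by
    refine eq_zero_of_comm_pd _ ?_ ?_
    · rintro (m | m)
      · refine LinearMap.ext fun w => ?_
        have e : ∀ w, bOp (m : ℤ) w = -pdOp (Sum.inl m) w := fun w => by rw [bOp_pos]; rfl
        have h := LinearMap.congr_fun (hb m) w
        rw [Module.End.mul_apply, Module.End.mul_apply, e, e, map_neg, neg_inj] at h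
        exact h
      · have := ha m
        rwa [aOp_pos] at this
    · intro w
      have hY0 : ∀ w, (Y w).coeff 0 = 0 := fun w => by
        rw [hY, piAop, LinearMap.add_apply, LinearMap.smul_apply, MvPolynomial.coeff_add,
          MvPolynomial.coeff_smul, coeff_zero_Gop_neg (by omega),
          (coeff_zero_neg (by omega) w).2, smul_zero, add_zero]
      rw [LinearMap.sub_apply, MvPolynomial.coeff_sub, Module.End.mul_apply, Module.End.mul_apply,
        hY0, hX, coeff_zero_Gop_zero, hY0, map_zero, mul_zero, sub_zero]
  exact sub_eq_zero.1 hZ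

/-! ### The modes of `π(g) b` -/

theorem sum_composition {A : Type*} [AddCommMonoid A] (F : List ℕ → A) {n : ℕ} (hn : 0 < n) :
    ∑ c : Composition n, F c.blocks =
      ∑ k ∈ Finset.range n, ∑ c : Composition (n - (k + 1)), F ((k + 1) :: c.blocks) := by
  rw [Finset.sum_sigma']
  symm
  refine Finset.sum_bij (fun x hx => ⟨(x.1 + 1) :: x.2.blocks, ?_, ?_⟩) ?_ ?_ ?_ ?_
  · intro i hi
    rcases List.mem_cons.1 hi with rfl | hi
    · exact Nat.succ_pos _
    · exact x.2.blocks_pos hi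
  · have := Finset.mem_range.1 (Finset.mem_sigma.1 hx).1
    rw [List.sum_cons, x.2.blocks_sum]
    omega
  · intro _ _; exact Finset.mem_univ _
  · rintro ⟨k, c⟩ _ ⟨k', c'⟩ _ h
    have h1 := congrArg Composition.blocks h
    simp only [List.cons.injEq, add_left_inj] at h1
    obtain ⟨rfl, h2⟩ := h1
    rw [Composition.ext h2]
  · intro c _
    obtain ⟨l, hpos, hsum⟩ := c
    cases l with
    | nil => simp at hsum; omega
    | cons k l =>
      have hk := hpos (List.mem_cons_self (a := k) (l := l))
      rw [List.sum_cons] at hsum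
      refine ⟨⟨k - 1, ⟨l, fun hi => hpos (List.mem_cons_of_mem _ hi), by omega⟩⟩,
        Finset.mem_sigma.2 ⟨Finset.mem_range.2 (show k - 1 < n by omega), Finset.mem_univ _⟩, ?_⟩
      apply Composition.ext
      simp only [List.cons.injEq, and_true]
      omega
  · intro _ _; rfl

/-- A complex number as a constant of `𝒟^ch(ℍ)`. -/
def cst (c : ℂ) : Dch := MvPolynomial.C (algebraMap ℂ Hol c)

theorem smul_eq_cst (c : ℂ) (w : Dch) : c • w = cst c * w := by
  rw [cst, MvPolynomial.C_mul', algebraMap_smul]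

/-- The generating series `∑ j_{-n} z ^ n` of the nonpositive modes of `j = γ b + δ`. -/
def jSer (γ δ : ℂ) : PowerSeries Dch := PowerSeries.mk fun n =>
  if 0 < n then cst γ * MvPolynomial.X (Sum.inr n.toPNat') else MvPolynomial.C (jHol γ δ)

/-- The generating series of the modes `-n` of `(α b + β) / (γ b + δ)`, with the constant term
shifted by `α / γ` so that the product with `jSer` is constant. -/
def bSer (g : SL(2, ℝ)) : PowerSeries Dch := PowerSeries.mk fun n =>
  if 0 < n then piB g n.toPNat' else cst (-(g 1 0 : ℂ)⁻¹) * MvPolynomial.C (jInv g)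

theorem row_ne_zero (g : SL(2, ℝ)) (τ : ℍ) : (g 1 0 : ℂ) * (τ : ℂ) + (g 1 1 : ℂ) ≠ 0 := by
  have := UpperHalfPlane.denom_ne_zero (g : GL (Fin 2) ℝ) τ
  simpa [UpperHalfPlane.denom] using this

theorem jHol_apply (γ δ : ℂ) (τ : ℍ) : (jHol γ δ).1 τ = γ * (τ : ℂ) + δ := by
  change γ * (τ : ℂ) + δ * 1 = _
  rw [mul_one]

theorem jHol_mul_jInv (g : SL(2, ℝ)) : jHol (g 1 0 : ℂ) (g 1 1 : ℂ) * jInv g = 1 := by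
  refine Hol.ext fun τ => ?_
  change (jHol (g 1 0 : ℂ) (g 1 1 : ℂ)).1 τ * ((g 1 0 : ℂ) * (τ : ℂ) + (g 1 1 : ℂ))⁻¹ = 1
  rw [jHol_apply, mul_inv_cancel₀ (row_ne_zero g τ)]

/-- The summand of `piB` that belongs to the composition with the given blocks. -/
def piBTerm (g : SL(2, ℝ)) (l : List ℕ) : Dch :=
  (-cst (g 1 0 : ℂ)) ^ (l.length - 1) * MvPolynomial.C (jInv g) ^ (l.length + 1) *
      (l.map (fun i => MvPolynomial.X (Sum.inr i.toPNat'))).prod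

theorem piB_eq (g : SL(2, ℝ)) (n : ℕ+) :
    piB g n = ∑ c : Composition (n : ℕ), piBTerm g c.blocks := by
  refine Finset.sum_congr rfl fun c _ => ?_
  rw [piBTerm, ← map_pow, Algebra.smul_def, map_mul, map_pow, map_neg, map_pow, map_neg]
  rfl

theorem piBTerm_cons (g : SL(2, ℝ)) (k : ℕ) (l : List ℕ) (hl : l ≠ []) :
    piBTerm g (k :: l) =
      -MvPolynomial.C (jInv g) * (cst (g 1 0 : ℂ) * MvPolynomial.X (Sum.inr k.toPNat')) *
        piBTerm g l := by
  obtain ⟨m, hm⟩ : ∃ m, l.length = m + 1 :=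
    ⟨l.length - 1, by have := List.length_pos_iff.2 hl; omega⟩
  rw [piBTerm, piBTerm, List.length_cons, hm, Nat.add_sub_cancel, Nat.add_sub_cancel,
    List.map_cons, List.prod_cons]
  ring

theorem cst_mul (c d : ℂ) : cst c * cst d = cst (c * d) := by
  rw [cst, cst, cst, map_mul, map_mul]

theorem cst_neg (c : ℂ) : cst (-c) = -cst c := by rw [cst, cst, map_neg, map_neg]

theorem toPNat'_coe_of_pos {n : ℕ} (h : 0 < n) : (n.toPNat' : ℕ) = n := by
  rw [Nat.toPNat'_coe, if_pos h]

theorem cst_one : cst 1 = 1 := by rw [cst, map_one, map_one]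

theorem jSer_coeff_pos (γ δ : ℂ) (n : ℕ) (h : 0 < n) : (jSer γ δ).coeff n =
    cst γ * MvPolynomial.X (Sum.inr n.toPNat') := by
  rw [jSer, PowerSeries.coeff_mk, if_pos h]

theorem jSer_coeff_zero (γ δ : ℂ) : (jSer γ δ).coeff 0 = MvPolynomial.C (jHol γ δ) := by
  rw [jSer, PowerSeries.coeff_mk, if_neg (lt_irrefl 0)]

theorem bSer_coeff_pos (g : SL(2, ℝ)) (n : ℕ) (h : 0 < n) :
    (bSer g).coeff n = piB g n.toPNat' := by
  rw [bSer, PowerSeries.coeff_mk, if_pos h]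

theorem bSer_coeff_zero (g : SL(2, ℝ)) : (bSer g).coeff 0 =
    cst (-(g 1 0 : ℂ)⁻¹) * MvPolynomial.C (jInv g) := by
  rw [bSer, PowerSeries.coeff_mk, if_neg (lt_irrefl 0)]

theorem bSer_rec_aux (g : SL(2, ℝ)) (hg : (g 1 0 : ℂ) ≠ 0) (k m : ℕ) :
    ∑ c : Composition m, piBTerm g ((k + 1) :: c.blocks) =
      -MvPolynomial.C (jInv g) * ((jSer (g 1 0 : ℂ) (g 1 1 : ℂ)).coeff (k + 1) *
        (bSer g).coeff m) := by
  rw [jSer_coeff_pos _ _ _ k.succ_pos]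
  obtain rfl | hm := Nat.eq_zero_or_pos m
  · have h1 : cst (g 1 0 : ℂ) * cst (-(g 1 0 : ℂ)⁻¹) = -1 := by
      rw [cst_mul, mul_neg, mul_inv_cancel₀ hg, cst_neg, cst_one]
    have e : ∀ c : Composition 0, c.blocks = [] := fun c => by
      rw [List.eq_nil_iff_forall_not_mem]
      intro i hi
      have := Composition.blocks_pos _ hi
      have := List.single_le_sum (fun _ _ => Nat.zero_le _) _ hi
      rw [Composition.blocks_sum] at this
      omega
    rw [bSer_coeff_zero, Finset.sum_congr rfl fun c _ => by rw [e c], Finset.sum_const,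
      Finset.card_univ, composition_card, zero_tsub, pow_zero, one_smul, piBTerm,
      List.map_singleton, List.prod_singleton, List.length_singleton]
    linear_combination (MvPolynomial.C (jInv g) ^ 2 *
      MvPolynomial.X (Sum.inr (k + 1).toPNat')) * h1
  · rw [bSer_coeff_pos _ _ hm, piB_eq, toPNat'_coe_of_pos hm, ← mul_assoc, Finset.mul_sum]
    refine Finset.sum_congr rfl fun c _ => ?_
    rw [piBTerm_cons]
    intro h
    have := c.blocks_sum
    rw [h] at this
    simp at this
    omega

/-- The series of `j` and of `-γ⁻¹ j⁻¹` are inverse up to the constant `-γ⁻¹`. -/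
theorem jSer_mul_bSer (g : SL(2, ℝ)) (hg : (g 1 0 : ℂ) ≠ 0) :
    jSer (g 1 0 : ℂ) (g 1 1 : ℂ) * bSer g = PowerSeries.C (cst (-(g 1 0 : ℂ)⁻¹)) := by
  have hj : (MvPolynomial.C (jHol (g 1 0 : ℂ) (g 1 1 : ℂ)) * MvPolynomial.C (jInv g) : Dch) = 1 := by
    rw [← map_mul, jHol_mul_jInv, map_one]
  ext1 n
  rw [PowerSeries.coeff_mul, PowerSeries.coeff_C]
  cases n with
  | zero =>
    rw [Finset.Nat.antidiagonal_zero, Finset.sum_singleton, if_pos rfl]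
    simp only
    rw [jSer_coeff_zero, bSer_coeff_zero]
    linear_combination cst (-(g 1 0 : ℂ)⁻¹) * hj
  | succ n =>
    rw [if_neg (Nat.succ_ne_zero n), Finset.Nat.sum_antidiagonal_succ, jSer_coeff_zero,
      bSer_coeff_pos _ _ n.succ_pos, piB_eq, toPNat'_coe_of_pos n.succ_pos,
      sum_composition _ n.succ_pos,
      Finset.Nat.sum_antidiagonal_eq_sum_range_succ_mk, Nat.succ_eq_add_one,
      Finset.sum_congr rfl fun k _ => bSer_rec_aux g hg k (n + 1 - (k + 1)), ← Finset.mul_sum,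
      ← mul_assoc, mul_neg, hj, neg_one_mul]
    simp only [Nat.add_sub_add_right]
    exact neg_add_cancel _

/-! ### The derivation induced by the zero mode on vectors without `a_{-n}` -/

theorem D0_C (f : Hol) : D0 (MvPolynomial.C f) = MvPolynomial.C (dHol f) := by
  refine MvPolynomial.ext _ _ fun s => ?_
  rw [coeff_D0, MvPolynomial.coeff_C, MvPolynomial.coeff_C]
  split_ifs
  · rfl
  · exact map_zero _

theorem D0_X (i : ℕ+ ⊕ ℕ+) : D0 (MvPolynomial.X i) = 0 := by
  have h1 : dHol 1 = 0 := by simpa using dHol_mul 1 1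
  have h := D0_mul_X i (MvPolynomial.C 1)
  rwa [D0_C, h1, map_zero, mul_zero, map_one, mul_one] at h

theorem D0_mul (p q : Dch) : D0 (p * q) = p * D0 q + D0 p * q := by
  induction p using MvPolynomial.induction_on with
  | C f => rw [D0_mul_C, D0_C]
  | add p p' h h' => rw [add_mul, map_add, map_add, h, h']; ring
  | mul_X p i h =>
    rw [mul_comm p, mul_assoc, D0_mul_X, h, D0_mul_X]; ring

/-- The derivation of `𝒟^ch(ℍ)` that gives the action of the zero mode of `a j ^ 2` on vectors
without any `a_{-n}`: it maps `b_{-n}` to `(j ^ 2)_{-n}` and `f(b)` to `j ^ 2 f'(b)`. -/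
def vfield (γ δ : ℂ) (w : Dch) : Dch :=
  MvPolynomial.C (jHol γ δ) ^ 2 * D0 w + MvPolynomial.mkDerivation Hol
    (Sum.elim (fun _ => 0) fun n : ℕ+ => (jSer γ δ ^ 2).coeff n) w

theorem vfield_add (γ δ : ℂ) (p q : Dch) : vfield γ δ (p + q) = vfield γ δ p + vfield γ δ q := by
  simp only [vfield, map_add]; ring

theorem vfield_mul (γ δ : ℂ) (p q : Dch) :
    vfield γ δ (p * q) = p * vfield γ δ q + vfield γ δ p * q := by
  simp only [vfield, D0_mul, Derivation.leibniz, smul_eq_mul]; ring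

theorem vfield_C (γ δ : ℂ) (f : Hol) :
    vfield γ δ (MvPolynomial.C f) = MvPolynomial.C (jHol γ δ ^ 2 * dHol f) := by
  rw [vfield, D0_C, MvPolynomial.derivation_C, add_zero, map_mul, map_pow]

theorem vfield_X (γ δ : ℂ) (n : ℕ+) :
    vfield γ δ (MvPolynomial.X (Sum.inr n)) = (jSer γ δ ^ 2).coeff n := by
  rw [vfield, D0_X, mul_zero, zero_add, MvPolynomial.mkDerivation_X, Sum.elim_inr]

theorem vfield_zero (γ δ : ℂ) : vfield γ δ 0 = 0 := by simp [vfield]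

theorem vfield_sum {ι : Type*} (γ δ : ℂ) (s : Finset ι) (f : ι → Dch) :
    vfield γ δ (∑ i ∈ s, f i) = ∑ i ∈ s, vfield γ δ (f i) :=
  map_sum (AddMonoidHom.mk' (vfield γ δ) (vfield_add γ δ)) f s

theorem vfield_cst (γ δ c : ℂ) : vfield γ δ (cst c) = 0 := by
  have h : dHol (algebraMap ℂ Hol c) = 0 := by
    have h1 : dHol 1 = 0 := by simpa using dHol_mul 1 1
    rw [Algebra.algebraMap_eq_smul_one, map_smul, h1, smul_zero]
  rw [cst, vfield_C, h, mul_zero, map_zero]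

theorem dHol_jHol (γ δ : ℂ) : dHol (jHol γ δ) = algebraMap ℂ Hol γ := by
  have h1 : dHol 1 = 0 := by simpa using dHol_mul 1 1
  rw [jHol, map_add, map_smul, map_smul, dHol_coordH, h1, smul_zero, add_zero,
    Algebra.algebraMap_eq_smul_one]

/-- The derivation acts on the series of `j` by `j ↦ γ j ^ 2`. -/
theorem vfield_jSer (γ δ : ℂ) (n : ℕ) :
    vfield γ δ ((jSer γ δ).coeff n) = cst γ * (jSer γ δ ^ 2).coeff n := by
  obtain rfl | hn := Nat.eq_zero_or_pos n
  · rw [jSer_coeff_zero, vfield_C, dHol_jHol, map_mul, mul_comm, map_pow, sq (jSer γ δ),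
      PowerSeries.coeff_mul, Finset.Nat.antidiagonal_zero, Finset.sum_singleton, jSer_coeff_zero, sq]
    rfl
  · rw [jSer_coeff_pos _ _ _ hn, vfield_mul, vfield_cst, zero_mul, add_zero, vfield_X,
      toPNat'_coe_of_pos hn]

theorem vfield_piB (g : SL(2, ℝ)) (hg : (g 1 0 : ℂ) ≠ 0) (n : ℕ+) :
    vfield (g 1 0 : ℂ) (g 1 1 : ℂ) (piB g n) = 0 := by
  set γ := (g 1 0 : ℂ)
  set δ := (g 1 1 : ℂ)
  -- the derivation, applied coefficientwise to power series
  let D : PowerSeries Dch → PowerSeries Dch := fun P =>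
    PowerSeries.mk fun n => vfield γ δ (P.coeff n)
  have hD : ∀ P R, D (P * R) = P * D R + D P * R := fun P R => by
    ext1 n
    simp only [D, map_add, PowerSeries.coeff_mul, PowerSeries.coeff_mk, vfield_sum, vfield_mul,
      Finset.sum_add_distrib]
  have hJ : D (jSer γ δ) = PowerSeries.C (cst γ) * jSer γ δ ^ 2 := by
    ext1 n
    simp only [D, PowerSeries.coeff_mk, vfield_jSer, PowerSeries.coeff_C_mul]
  have h1 := jSer_mul_bSer g hg
  have h2 : D (jSer γ δ * bSer g) = 0 := by
    rw [h1]
    ext1 n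
    simp only [D, PowerSeries.coeff_mk, PowerSeries.coeff_C, map_zero]
    split_ifs
    · exact vfield_cst _ _ _
    · exact vfield_zero _ _
  rw [hD, hJ, sq, mul_assoc, mul_assoc, h1] at h2
  have hu : IsUnit (jSer γ δ) := by
    rw [PowerSeries.isUnit_iff_constantCoeff, ← PowerSeries.coeff_zero_eq_constantCoeff_apply,
      jSer_coeff_zero]
    refine IsUnit.of_mul_eq_one (MvPolynomial.C (jInv g)) ?_
    rw [← map_mul, jHol_mul_jInv, map_one]
  have h3 : D (bSer g) = 1 := by
    have hc : (PowerSeries.C (cst γ) * PowerSeries.C (cst (-γ⁻¹)) : PowerSeries Dch) = -1 := by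
      rw [← map_mul, cst_mul, mul_neg, mul_inv_cancel₀ hg, cst_neg, cst_one, map_neg, map_one]
    refine hu.mul_left_cancel ?_
    linear_combination h2 - jSer γ δ * hc
  have h4 := congrArg (fun P => P.coeff (n : ℕ)) h3
  simp only [D, PowerSeries.coeff_mk, PowerSeries.coeff_one, n.ne_zero, if_false] at h4
  rwa [bSer_coeff_pos _ _ n.pos, PNat.coe_toPNat'] at h4

/-- The subalgebra of the vectors without any `a_{-n}`. -/
def noA : Subalgebra Hol Dch :=
  (MvPolynomial.rename (R := Hol) (Sum.inr : ℕ+ → ℕ+ ⊕ ℕ+)).range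

theorem C_mem_noA (f : Hol) : MvPolynomial.C f ∈ noA := noA.algebraMap_mem f

theorem X_mem_noA (n : ℕ+) : MvPolynomial.X (Sum.inr n) ∈ noA :=
  ⟨MvPolynomial.X n, MvPolynomial.rename_X _ _⟩

theorem noA_induction {P : Dch → Prop} (hC : ∀ f, P (MvPolynomial.C f))
    (hadd : ∀ p q, P p → P q → P (p + q))
    (hX : ∀ n p, p ∈ noA → P p → P (MvPolynomial.X (Sum.inr n) * p)) {v : Dch} (hv : v ∈ noA) :
    P v := by
  obtain ⟨p, rfl⟩ := hv
  change P (MvPolynomial.rename (Sum.inr : ℕ+ → ℕ+ ⊕ ℕ+) p)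
  induction p using MvPolynomial.induction_on with
  | C f => rw [MvPolynomial.rename_C]; exact hC f
  | add p q hp hq => rw [map_add]; exact hadd _ _ hp hq
  | mul_X p n hp =>
    rw [map_mul, MvPolynomial.rename_X, mul_comm]
    exact hX n _ ⟨p, rfl⟩ hp

theorem pd_noA {v : Dch} (hv : v ∈ noA) (n : ℕ+) : pdOp (Sum.inl n) v = 0 := by
  refine noA_induction (P := fun v => pdOp (Sum.inl n) v = 0) (fun f => MvPolynomial.pderiv_C)
    (fun p q hp hq => ?_) (fun m p _ hp => ?_) hv
  · rw [map_add, hp, hq, add_zero]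
  · rw [pd_X, hp, mul_zero, if_neg (by simp), add_zero]

theorem jop_noA (γ δ : ℂ) {v : Dch} (hv : v ∈ noA) {n : ℤ} (hn : 0 < n) :
    jop bOp γ δ n v = 0 := by
  obtain ⟨m, rfl⟩ | h | ⟨m, rfl⟩ := int_cases n
  · rw [jop_of_ne (by omega), LinearMap.smul_apply, bOp_pos, LinearMap.neg_apply, pd_noA hv,
      neg_zero, smul_zero]
  · omega
  · have := m.pos; omega

theorem jop_neg (γ δ : ℂ) (n : ℕ) (v : Dch) :
    jop bOp γ δ (-(n : ℤ)) v = (jSer γ δ).coeff n * v := by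
  obtain rfl | hn := Nat.eq_zero_or_pos n
  · rw [Nat.cast_zero, neg_zero, jop_zero, jSer_coeff_zero]; rfl
  · have e : (n : ℤ) = (n.toPNat' : ℕ) := by rw [toPNat'_coe_of_pos hn]
    rw [jop_of_ne (by omega), e, LinearMap.smul_apply, bOp_neg, jSer_coeff_pos _ _ _ hn, mul_assoc,
      smul_eq_cst]
    rfl

theorem Sq_noA (γ δ : ℂ) {v : Dch} (hv : v ∈ noA) (n : ℕ) :
    Sq bOp γ δ (-(n : ℤ)) v = (jSer γ δ ^ 2).coeff n * v := by
  have hinj : Set.InjOn (fun k : ℕ => -(k : ℤ)) (Finset.range (n + 1)) := fun a _ b _ h => by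
    simpa using h
  rw [Sq, lsum_apply (heisD.locFin_Sq _), finsum_eq_sum_of_support_subset
    (s := (Finset.range (n + 1)).image fun k : ℕ => -(k : ℤ)), Finset.sum_image hinj, sq,
    PowerSeries.coeff_mul, Finset.Nat.sum_antidiagonal_eq_sum_range_succ_mk, Finset.sum_mul]
  · refine Finset.sum_congr rfl fun k hk => ?_
    have hk : k ≤ n := Nat.lt_succ_iff.1 (Finset.mem_range.1 hk)
    rw [show -(n : ℤ) - -(k : ℤ) = -((n - k : ℕ) : ℤ) by omega, Module.End.mul_apply, jop_neg,
      jop_neg, mul_assoc]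
  · intro i hi
    rw [Finset.coe_image, Set.mem_image]
    by_contra hc
    have hc : 0 < i ∨ 0 < -(n : ℤ) - i := by
      by_contra h
      exact hc ⟨(-i).toNat, by simp; omega, by omega⟩
    refine hi ?_
    obtain hc | hc := hc
    · simp only
      rw [heisD.jj, Module.End.mul_apply, jop_noA γ δ hv hc, map_zero]
    · simp only
      rw [Module.End.mul_apply, jop_noA γ δ hv hc, map_zero]

theorem ofHol_vac (f : Hol) (n : ℤ) (hn : 1 ≤ n) : aOp n (ofHol f) = 0 ∧ bOp n (ofHol f) = 0 := by
  have ha := act_K f (a n) (a_mem_K hn)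
  have hb := act_K f (b n) (b_mem_K hn)
  rw [act_a] at ha
  rw [act_b] at hb
  exact ⟨ha, hb⟩

theorem Gop_zero_ofHol (γ δ : ℂ) (f : Hol) :
    Gop aOp bOp γ δ 0 (ofHol f) = ofHol (jHol γ δ ^ 2 * dHol f) := by
  have h := heisD.Gop_zero_vac (γ := γ) (δ := δ) (ofHol_vac f)
  rw [heisD.Gop_zero, LinearMap.add_apply, LinearMap.add_apply, h.2, LinearMap.smul_apply,
    Module.End.mul_apply (jop _ _ _ _) (chg _ _), h.1, map_zero, smul_zero, add_zero, add_zero, jop_zero, aOp_zero, ofHol,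
    Module.End.mul_apply, D0_C, ofHol, sq, map_mul, map_mul, mul_assoc]
  rfl

theorem Gop_zero_noA (γ δ : ℂ) {v : Dch} (hv : v ∈ noA) :
    Gop aOp bOp γ δ 0 v = vfield γ δ v := by
  refine noA_induction (P := fun v => Gop aOp bOp γ δ 0 v = vfield γ δ v) (fun f => ?_)
    (fun p q hp hq => ?_) (fun n p hp h => ?_) hv
  · rw [vfield_C]; exact Gop_zero_ofHol γ δ f
  · rw [map_add, hp, hq, vfield_add]
  · have h1 := LinearMap.congr_fun (heisD.Gop_b (γ := γ) (δ := δ) 0 (-(n : ℤ))) p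
    rw [zero_add, LinearMap.sub_apply, Module.End.mul_apply, Module.End.mul_apply, h,
      sub_eq_iff_eq_add, bOp_neg, Sq_noA γ δ hp] at h1
    rw [vfield_mul, vfield_X, add_comm]
    exact h1

theorem piB_mem_noA (g : SL(2, ℝ)) (n : ℕ+) : piB g n ∈ noA := by
  refine noA.sum_mem fun c _ => noA.mul_mem (C_mem_noA _) (noA.list_prod_mem fun x hx => ?_)
  obtain ⟨i, _, rfl⟩ := List.mem_map.1 hx
  exact X_mem_noA _

/-! ### The action `π(g)` on the elements `a_{-λ} b_{-μ} f` -/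

/-- The inclusion of `𝒪(ℍ)` into `𝒟^ch(ℍ)` as a linear map. -/
def ofHolL : Hol →ₗ[ℂ] Dch where
  toFun := ofHol
  map_add' f g := map_add _ f g
  map_smul' c f := by
    rw [RingHom.id_apply, smul_eq_cst, ofHol, ofHol, Algebra.smul_def, map_mul]; rfl

/-- The map `φ ↦ (π(g)a)_{-λ} (π(g)b)_{-μ} φ`. -/
def liftL (g : SL(2, ℝ)) (x : Ptn × Ptn) : Hol →ₗ[ℂ] Dch :=
  (((parts x.1).map (piAop (g 1 0 : ℂ) (g 1 1 : ℂ))).prod * mulOp (x.2.map (piB g)).prod) ∘ₗ ofHolL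

theorem foldr_piA (g : SL(2, ℝ)) (l : List ℕ+) (w : Dch) :
    l.foldr (piA g) w = (l.map (piAop (g 1 0 : ℂ) (g 1 1 : ℂ))).prod w := by
  induction l with
  | nil => rfl
  | cons n l ih => rw [List.foldr_cons, ih, List.map_cons, List.prod_cons, piA_eq]; rfl

theorem liftL_apply (g : SL(2, ℝ)) (x : Ptn × Ptn) (φ : Hol) :
    liftL g x φ =
      (parts x.1).foldr (piA g) ((x.2.map (piB g)).prod * MvPolynomial.C φ) := by
  rw [foldr_piA]; rfl

/-- The zero mode of `a j ^ 2` commutes with the modes of `π(g) a` and `π(g) b`. -/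
theorem Gop_zero_liftL (g : SL(2, ℝ)) (hg : (g 1 0 : ℂ) ≠ 0) (x : Ptn × Ptn) (φ : Hol) :
    Gop aOp bOp (g 1 0 : ℂ) (g 1 1 : ℂ) 0 (liftL g x φ) =
      liftL g x (jHol (g 1 0 : ℂ) (g 1 1 : ℂ) ^ 2 * dHol φ) := by
  have hB : ∀ s : Multiset ℕ+, (s.map (piB g)).prod ∈ noA ∧
      vfield (g 1 0 : ℂ) (g 1 1 : ℂ) (s.map (piB g)).prod = 0 := by
    intro s
    induction s using Multiset.induction_on with
    | empty =>
      rw [Multiset.map_zero, Multiset.prod_zero]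
      exact ⟨noA.one_mem, by rw [← cst_one, vfield_cst]⟩
    | cons n s ih =>
      rw [Multiset.map_cons, Multiset.prod_cons]
      exact ⟨noA.mul_mem (piB_mem_noA g n) ih.1, by
        rw [vfield_mul, ih.2, vfield_piB g hg, mul_zero, zero_mul, add_zero]⟩
  have hA : ∀ l : List ℕ+, Gop aOp bOp (g 1 0 : ℂ) (g 1 1 : ℂ) 0 *
      (l.map (piAop (g 1 0 : ℂ) (g 1 1 : ℂ))).prod =
      (l.map (piAop (g 1 0 : ℂ) (g 1 1 : ℂ))).prod * Gop aOp bOp (g 1 0 : ℂ) (g 1 1 : ℂ) 0 := by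
    intro l
    induction l with
    | nil => rw [List.map_nil, List.prod_nil, mul_one, one_mul]
    | cons n l ih =>
      rw [List.map_cons, List.prod_cons, ← mul_assoc, Gop_piAop_comm, mul_assoc, ih, mul_assoc]
  have h1 := LinearMap.congr_fun (hA (parts x.1))
    ((x.2.map (piB g)).prod * MvPolynomial.C φ)
  rw [Module.End.mul_apply, Module.End.mul_apply,
    Gop_zero_noA _ _ (noA.mul_mem (hB x.2).1 (C_mem_noA φ)), vfield_mul, (hB x.2).2, zero_mul,
    add_zero, vfield_C] at h1
  exact h1

theorem expo_aPart_bPart (x : Ptn × Ptn) : aPart (expo x) = x.1 ∧ bPart (expo x) = x.2 := by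
  rw [aPart, bPart, expo, Multiset.toFinsupp_toMultiset, Multiset.filterMap_add,
    Multiset.filterMap_add, Multiset.filterMap_map, Multiset.filterMap_map,
    Multiset.filterMap_map, Multiset.filterMap_map]
  have h0 : ∀ s : Ptn, Multiset.filterMap (fun _ => (none : Option ℕ+)) s = 0 := fun s =>
    Multiset.eq_zero_of_forall_notMem fun n hn => by simp at hn
  constructor <;> simp [Function.comp_def, Multiset.filterMap_some, h0]

theorem expo_injective : Function.Injective expo := fun x y h => by
  have hx := expo_aPart_bPart x
  have hy := expo_aPart_bPart y
  rw [h] at hx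
  exact Prod.ext (hx.1.symm.trans hy.1) (hx.2.symm.trans hy.2)

theorem piAct_eq_sum (g : SL(2, ℝ)) (v : Dch) {T : Finset (ℕ+ ⊕ ℕ+ →₀ ℕ)} (hT : v.support ⊆ T) :
    piAct g v = ∑ s ∈ T, liftL g (aPart s, bPart s) (pull g (v.coeff s)) := by
  rw [piAct, Finset.sum_congr rfl fun s _ => (liftL_apply g (aPart s, bPart s) _).symm]
  refine Finset.sum_subset hT fun s _ hs => ?_
  rw [MvPolynomial.notMem_support_iff.1 hs, map_zero, map_zero]

theorem piAct_add (g : SL(2, ℝ)) (v w : Dch) : piAct g (v + w) = piAct g v + piAct g w := by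
  classical
  rw [piAct_eq_sum g (v + w) MvPolynomial.support_add,
    piAct_eq_sum g v Finset.subset_union_left, piAct_eq_sum g w Finset.subset_union_right,
    ← Finset.sum_add_distrib]
  refine Finset.sum_congr rfl fun s _ => ?_
  rw [MvPolynomial.coeff_add, map_add, map_add]

theorem piAct_smul (g : SL(2, ℝ)) (c : ℂ) (v : Dch) : piAct g (c • v) = c • piAct g v := by
  rw [piAct_eq_sum g (c • v) MvPolynomial.support_smul, piAct_eq_sum g v subset_rfl,
    Finset.smul_sum]
  refine Finset.sum_congr rfl fun s _ => ?_
  rw [MvPolynomial.coeff_smul, map_smul, map_smul]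

theorem piAct_monomial (g : SL(2, ℝ)) (x : Ptn × Ptn) (f : Hol) :
    piAct g (MvPolynomial.monomial (expo x) f) = liftL g x (pull g f) := by
  rw [piAct_eq_sum g _ MvPolynomial.support_monomial_subset, Finset.sum_singleton,
    MvPolynomial.coeff_monomial, if_pos rfl, (expo_aPart_bPart x).1, (expo_aPart_bPart x).2]

/-! ### Gradings of `𝒟^ch(ℍ)` by the difference of the numbers of parts -/

/-- The difference of the degrees in the `a_{-n}` and in the `b_{-n}`. -/
def dg : (ℕ+ ⊕ ℕ+ →₀ ℕ) →+ ℤ := Finsupp.weight (Sum.elim (fun _ => (1 : ℤ)) fun _ => -1)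

theorem dg_inl (n : ℕ+) : dg (Finsupp.single (Sum.inl n) 1) = 1 := by
  simp [dg, Finsupp.weight_apply]

theorem dg_inr (n : ℕ+) : dg (Finsupp.single (Sum.inr n) 1) = -1 := by
  simp [dg, Finsupp.weight_apply]

theorem expo_cons_fst (n : ℕ+) (l m : Ptn) :
    expo (n ::ₘ l, m) = expo (l, m) + Finsupp.single (Sum.inl n) 1 := by
  simp only [expo, Multiset.map_cons, Multiset.cons_add]
  rw [← Multiset.singleton_add, map_add, Multiset.toFinsupp_singleton, add_comm]

theorem expo_cons_snd (n : ℕ+) (l m : Ptn) :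
    expo (l, n ::ₘ m) = expo (l, m) + Finsupp.single (Sum.inr n) 1 := by
  simp only [expo, Multiset.map_cons, Multiset.add_cons]
  rw [← Multiset.singleton_add, map_add, Multiset.toFinsupp_singleton, add_comm]

theorem expo_zero : expo (0, 0) = 0 := by simp [expo]

theorem dg_expo (x : Ptn × Ptn) : dg (expo x) = ldiff x := by
  obtain ⟨l, m⟩ := x
  induction l using Multiset.induction_on with
  | empty =>
    induction m using Multiset.induction_on with
    | empty => rw [expo_zero, map_zero]; rfl
    | cons n m ih =>
      rw [expo_cons_snd, map_add, ih, dg_inr]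
      simp only [ldiff, Multiset.card_cons]; push_cast; ring
  | cons n l ih =>
    rw [expo_cons_fst, map_add, ih, dg_inl]
    simp only [ldiff, Multiset.card_cons]; push_cast; ring

/-- The vectors that involve only monomials of degree difference at most `d`. -/
def Dle (d : ℤ) : Submodule ℂ Dch where
  carrier := {w | ∀ t, d < dg t → w.coeff t = 0}
  add_mem' hv hw t ht := by rw [MvPolynomial.coeff_add, hv t ht, hw t ht, add_zero]
  zero_mem' t _ := MvPolynomial.coeff_zero t
  smul_mem' c w hw t ht := by rw [MvPolynomial.coeff_smul, hw t ht, smul_zero]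

theorem coeff_X_mul_cases (i : ℕ+ ⊕ ℕ+) (w : Dch) (s : ℕ+ ⊕ ℕ+ →₀ ℕ) :
    (MvPolynomial.X i * w).coeff s = 0 ∨ ∃ t, s = t + Finsupp.single i 1 ∧
      ∀ w : Dch, (MvPolynomial.X i * w).coeff s = w.coeff t := by
  classical
  by_cases h : i ∈ s.support
  · refine Or.inr ⟨s - Finsupp.single i 1, ?_, fun w => ?_⟩
    · rw [tsub_add_cancel_of_le]
      rw [Finsupp.single_le_iff]
      exact Nat.one_le_iff_ne_zero.2 (Finsupp.mem_support_iff.1 h)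
    · rw [MvPolynomial.coeff_X_mul', if_pos h]
  · left
    rw [MvPolynomial.coeff_X_mul', if_neg h]

theorem Dle_X {d : ℤ} {w : Dch} (hw : w ∈ Dle d) (i : ℕ+ ⊕ ℕ+) :
    MvPolynomial.X i * w ∈ Dle (d + dg (Finsupp.single i 1)) := by
  intro t ht
  obtain h | ⟨s, rfl, h⟩ := coeff_X_mul_cases i w t
  · exact h
  · rw [h]
    rw [map_add] at ht
    exact hw s (by omega)

theorem Dle_pd {d : ℤ} {w : Dch} (hw : w ∈ Dle d) (i : ℕ+ ⊕ ℕ+) :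
    pdOp i w ∈ Dle (d - dg (Finsupp.single i 1)) := by
  intro t ht
  rw [coeff_pdOp, hw, smul_zero]
  rw [map_add]
  omega

theorem Dle_aOp {d : ℤ} {w : Dch} (hw : w ∈ Dle d) {n : ℤ} (hn : n ≠ 0) :
    aOp n w ∈ Dle (d + 1) := by
  obtain ⟨m, rfl⟩ | h | ⟨m, rfl⟩ := int_cases n
  · rw [aOp_pos]
    have := Dle_pd hw (Sum.inr m)
    rwa [dg_inr, sub_neg_eq_add] at this
  · exact absurd h hn
  · rw [aOp_neg]
    have := Dle_X hw (Sum.inl m)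
    rwa [dg_inl] at this

theorem Dle_D0 {d : ℤ} {w : Dch} (hw : w ∈ Dle d) : aOp 0 w ∈ Dle d := fun t ht => by
  rw [aOp_zero, coeff_D0, hw t ht, map_zero]

theorem Dle_bOp {d : ℤ} {w : Dch} (hw : w ∈ Dle d) {n : ℤ} (hn : n ≠ 0) :
    bOp n w ∈ Dle (d - 1) := by
  obtain ⟨m, rfl⟩ | h | ⟨m, rfl⟩ := int_cases n
  · rw [bOp_pos, LinearMap.neg_apply]
    have := Dle_pd hw (Sum.inl m)
    rw [dg_inl] at this
    exact neg_mem this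
  · exact absurd h hn
  · rw [bOp_neg]
    have := Dle_X hw (Sum.inr m)
    rwa [dg_inr, ← sub_eq_add_neg] at this

theorem Dle_jop (γ δ : ℂ) {d : ℤ} {w : Dch} (hw : w ∈ Dle d) {n : ℤ} (hn : n ≠ 0) :
    jop bOp γ δ n w ∈ Dle (d - 1) := by
  rw [jop_of_ne hn]
  exact (Dle _).smul_mem _ (Dle_bOp hw hn)

theorem Dle_mono {d d' : ℤ} (h : d ≤ d') : Dle d ≤ Dle d' := fun _ hw t ht =>
  hw t (by omega)

theorem Dle_aOp' {d : ℤ} {w : Dch} (hw : w ∈ Dle d) (n : ℤ) : aOp n w ∈ Dle (d + 1) := by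
  by_cases hn : n = 0
  · rw [hn]; exact Dle_mono (by omega) (Dle_D0 hw)
  · exact Dle_aOp hw hn

theorem Dle_Rop (γ δ : ℂ) {d : ℤ} {w : Dch} (hw : w ∈ Dle d) :
    Rop aOp bOp γ δ w ∈ Dle (d - 1) := by
  refine lsum_mem heisD.locFin_Rop _ fun p => ?_
  split_ifs with h
  · have h2 : 0 - p.1 - p.2 ≠ 0 := by omega
    unfold nrm
    split_ifs
    · have := Dle_aOp' (Dle_jop γ δ (Dle_jop γ δ hw h2) h.1) p.1
      exact Dle_mono (by omega) this
    · have := Dle_jop γ δ (Dle_jop γ δ (Dle_aOp' hw p.1) h2) h.1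
      exact Dle_mono (by omega) this
  · exact zero_mem _

theorem chg_X {c : ℂ} {w : Dch} (h : chg aOp bOp w = c • w) (i : ℕ+ ⊕ ℕ+) :
    chg aOp bOp (MvPolynomial.X i * w) =
      (c - (dg (Finsupp.single i 1) : ℂ)) • (MvPolynomial.X i * w) := by
  obtain n | n := i
  · have h1 := LinearMap.congr_fun (heisD.chg_a (-(n : ℤ))) w
    rw [if_neg (by simp), LinearMap.sub_apply, Module.End.mul_apply, Module.End.mul_apply, h,
      map_smul, LinearMap.neg_apply, aOp_neg, sub_eq_iff_eq_add] at h1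
    rw [dg_inl]
    refine h1.trans ?_
    rw [Int.cast_one, sub_smul, one_smul, sub_eq_add_neg, add_comm]
    rfl
  · have h1 := LinearMap.congr_fun (heisD.chg_b (-(n : ℤ))) w
    rw [if_neg (by simp), LinearMap.sub_apply, Module.End.mul_apply, Module.End.mul_apply, h,
      map_smul, bOp_neg, sub_eq_iff_eq_add] at h1
    rw [dg_inr]
    refine h1.trans ?_
    rw [Int.cast_neg, Int.cast_one, sub_neg_eq_add, add_smul, one_smul, add_comm]
    rfl

theorem chg_monomial (s : ℕ+ ⊕ ℕ+ →₀ ℕ) (f : Hol) :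
    chg aOp bOp (MvPolynomial.monomial s f) = (-(dg s : ℂ)) • MvPolynomial.monomial s f := by
  obtain ⟨m, rfl⟩ : ∃ m, s = Multiset.toFinsupp m := ⟨Finsupp.toMultiset s, by simp⟩
  induction m using Multiset.induction_on with
  | empty =>
    rw [map_zero, map_zero, Int.cast_zero, neg_zero, zero_smul]
    exact (heisD.Gop_zero_vac (γ := 0) (δ := 0) (ofHol_vac f)).1
  | cons i m ih =>
    have e : (MvPolynomial.monomial (Multiset.toFinsupp (i ::ₘ m)) f : Dch) =
        MvPolynomial.X i * MvPolynomial.monomial (Multiset.toFinsupp m) f := by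
      rw [← Multiset.singleton_add, map_add, Multiset.toFinsupp_singleton, MvPolynomial.X,
        MvPolynomial.monomial_mul, one_mul]
    rw [e, chg_X ih, ← Multiset.singleton_add, map_add, map_add, Multiset.toFinsupp_singleton]
    congr 1
    push_cast
    ring

theorem coeff_chg (w : Dch) (s : ℕ+ ⊕ ℕ+ →₀ ℕ) :
    (chg aOp bOp w).coeff s = (-(dg s : ℂ)) • w.coeff s := by
  induction w using MvPolynomial.induction_on' with
  | monomial t f =>
    rw [chg_monomial, MvPolynomial.coeff_smul, MvPolynomial.coeff_monomial]
    split_ifs with h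
    · rw [h]
    · rw [smul_zero, smul_zero]
  | add p q hp hq =>
    rw [map_add, MvPolynomial.coeff_add, hp, hq, MvPolynomial.coeff_add, smul_add]

/-- On the part of top degree difference the zero mode of `a j ^ 2` acts by a first order
differential operator on the coefficients. -/
theorem coeff_Gop_zero_top (γ δ : ℂ) {w : Dch} {s : ℕ+ ⊕ ℕ+ →₀ ℕ} (hw : w ∈ Dle (dg s)) :
    (Gop aOp bOp γ δ 0 w).coeff s = jHol γ δ ^ 2 * dHol (w.coeff s) -
      (2 * γ * (dg s : ℂ)) • (jHol γ δ * w.coeff s) := by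
  rw [heisD.Gop_zero, LinearMap.add_apply, LinearMap.add_apply, MvPolynomial.coeff_add,
    MvPolynomial.coeff_add, Dle_Rop γ δ hw s (by omega), add_zero, LinearMap.smul_apply,
    MvPolynomial.coeff_smul, jop_zero, aOp_zero, Module.End.mul_apply, Module.End.mul_apply,
    Module.End.mul_apply]
  change (MvPolynomial.C _ * (MvPolynomial.C _ * _)).coeff s +
    _ • (MvPolynomial.C _ * _).coeff s = _
  rw [MvPolynomial.coeff_C_mul, MvPolynomial.coeff_C_mul, MvPolynomial.coeff_C_mul, coeff_chg,
    coeff_D0, mul_smul_comm, smul_smul, sub_eq_add_neg, ← neg_smul]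
  congr 1
  · ring
  · congr 1
    ring

/-! ### Families of vectors depending polynomially on an exponent -/

section Families

/-- `j = γ b + δ` as a unit of `𝒪(ℍ)`. -/
def jU (g : SL(2, ℝ)) : Holˣ where
  val := jHol (g 1 0 : ℂ) (g 1 1 : ℂ)
  inv := jInv g
  val_inv := jHol_mul_jInv g
  inv_val := by rw [mul_comm, jHol_mul_jInv]

/-- The powers of `j = γ b + δ`. -/
def jz (g : SL(2, ℝ)) (n : ℤ) : Hol := ((jU g ^ n : Holˣ) : Hol)

theorem jz_add (g : SL(2, ℝ)) (m n : ℤ) : jz g (m + n) = jz g m * jz g n := by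
  rw [jz, zpow_add, Units.val_mul]; rfl

theorem jz_one (g : SL(2, ℝ)) : jz g 1 = jHol (g 1 0 : ℂ) (g 1 1 : ℂ) := by
  rw [jz, zpow_one]; rfl

theorem jz_neg_one (g : SL(2, ℝ)) : jz g (-1) = jInv g := by
  rw [jz, zpow_neg_one]; rfl

theorem jz_zero (g : SL(2, ℝ)) : jz g 0 = 1 := by
  rw [jz, zpow_zero, Units.val_one]

theorem jz_two (g : SL(2, ℝ)) : jz g 2 = jHol (g 1 0 : ℂ) (g 1 1 : ℂ) ^ 2 := by
  rw [← one_add_one_eq_two, jz_add, jz_one, sq]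

theorem jz_ne_zero (g : SL(2, ℝ)) (n : ℤ) : jz g n ≠ 0 := by
  have : Nontrivial Hol := ⟨0, 1, fun h => by
    have := congrArg (fun f : Hol => f.1 UpperHalfPlane.I) h
    exact zero_ne_one this⟩
  exact (jU g ^ n).ne_zero

theorem smul_jz_eq_zero {g : SL(2, ℝ)} {n : ℤ} {c : ℂ} (h : c • jz g n = 0) : c = 0 :=
  (smul_eq_zero.1 h).resolve_right (jz_ne_zero g n)

theorem dHol_jz (g : SL(2, ℝ)) (n : ℤ) :
    dHol (jz g n) = ((n : ℂ) * (g 1 0 : ℂ)) • jz g (n - 1) := by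
  have hd : dHol (jz g 1) = (g 1 0 : ℂ) • 1 := by
    rw [jz_one, dHol_jHol, Algebra.algebraMap_eq_smul_one]
  have hj : ∀ n, jz g (n + 1 - 1) = jz g (n - 1) * jz g 1 := fun n => by
    rw [← jz_add]; congr 1; ring
  induction n using Int.induction_on with
  | zero =>
    have h1 : dHol 1 = 0 := by simpa using dHol_mul 1 1
    rw [jz_zero, h1, Int.cast_zero, zero_mul, zero_smul]
  | succ n ih =>
    rw [jz_add, dHol_mul, ih, hd, hj, smul_mul_assoc, ← hj, mul_smul_comm, mul_one,
      add_sub_cancel_right]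
    push_cast
    module
  | pred n ih =>
    have e : jz g (-(n : ℤ)) = jz g (-(n : ℤ) - 1) * jz g 1 := by
      rw [← jz_add, sub_add_cancel]
    have h1 := ih
    rw [e, dHol_mul, hd] at h1
    have h2 : dHol (jz g (-(n : ℤ) - 1)) * jz g 1 =
        (((-(n : ℤ) - 1 : ℤ) : ℂ) * (g 1 0 : ℂ)) • jz g (-(n : ℤ) - 1) := by
      rw [← sub_eq_iff_eq_add'.2 h1.symm, mul_smul_comm, mul_one]
      push_cast
      module
    have h3 := congrArg (fun f => f * jz g (-1)) h2
    simp only [mul_assoc, smul_mul_assoc, ← jz_add] at h3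
    rwa [show (1 : ℤ) + -1 = 0 by norm_num, jz_zero, mul_one, ← sub_eq_add_neg] at h3

/-- Families `w : ℤ → 𝒟^ch(ℍ)` that involve finitely many variables and whose coefficient of a
monomial of degree difference `d` is `p(m) j ^ (m + e + d)`, for a polynomial `p` of degree at most
`c - d`. The number `c` bounds the order of differentiation plus the degree difference. -/
def Fam (g : SL(2, ℝ)) (c e : ℤ) : Submodule ℂ (ℤ → Dch) where
  carrier := {w | (∃ N : ℕ, ∀ m, ∀ n : ℤ, (N : ℤ) < n → aOp n (w m) = 0 ∧ bOp n (w m) = 0) ∧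
    ∀ s, ∃ p : Polynomial ℂ, (∀ i : ℕ, c < i + dg s → p.coeff i = 0) ∧
      ∀ m, (w m).coeff s = p.eval (m : ℂ) • jz g (m + e + dg s)}
  add_mem' := by
    rintro v w ⟨⟨N, hN⟩, hv⟩ ⟨⟨N', hN'⟩, hw⟩
    refine ⟨⟨N + N', fun m n hn => ?_⟩, fun s => ?_⟩
    · have h1 := hN m n (by push_cast at hn; omega)
      have h2 := hN' m n (by push_cast at hn; omega)
      rw [Pi.add_apply, map_add, map_add, h1.1, h1.2, h2.1, h2.2]
      exact ⟨add_zero 0, add_zero 0⟩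
    · obtain ⟨p, hp, hp'⟩ := hv s
      obtain ⟨q, hq, hq'⟩ := hw s
      refine ⟨p + q, fun i hi => ?_, fun m => ?_⟩
      · rw [Polynomial.coeff_add, hp i hi, hq i hi, add_zero]
      · rw [Pi.add_apply, MvPolynomial.coeff_add, hp', hq', Polynomial.eval_add, add_smul]
  zero_mem' := by
    refine ⟨⟨0, fun m n _ => ?_⟩, fun s => ⟨0, fun i _ => Polynomial.coeff_zero i, fun m => ?_⟩⟩
    · rw [Pi.zero_apply, map_zero, map_zero]; exact ⟨rfl, rfl⟩
    · rw [Pi.zero_apply, MvPolynomial.coeff_zero, Polynomial.eval_zero, zero_smul]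
  smul_mem' := by
    rintro k w ⟨⟨N, hN⟩, hw⟩
    refine ⟨⟨N, fun m n hn => ?_⟩, fun s => ?_⟩
    · have h1 := hN m n hn
      rw [Pi.smul_apply, map_smul, map_smul, h1.1, h1.2]
      exact ⟨smul_zero k, smul_zero k⟩
    · obtain ⟨p, hp, hp'⟩ := hw s
      refine ⟨Polynomial.C k * p, fun i hi => ?_, fun m => ?_⟩
      · rw [Polynomial.coeff_C_mul, hp i hi, mul_zero]
      · rw [Pi.smul_apply, MvPolynomial.coeff_smul, hp', Polynomial.eval_mul, Polynomial.eval_C,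
          mul_smul]

variable {g : SL(2, ℝ)} {c e : ℤ} {w : ℤ → Dch}

theorem Fam_mono {c' : ℤ} (h : c ≤ c') : Fam g c e ≤ Fam g c' e := fun _ hw =>
  ⟨hw.1, fun s => (hw.2 s).imp fun _ hp => ⟨fun i hi => hp.1 i (by omega), hp.2⟩⟩

/-- The uniform bound on the variables is preserved by all modes. -/
theorem fam_bound {X : Module.End ℂ Dch} (k : ℤ)
    (ha : ∀ n : ℤ, k.natAbs < n → aOp n * X = X * aOp n)
    (hb : ∀ n : ℤ, k.natAbs < n → bOp n * X = X * bOp n)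
    (hw : ∃ N : ℕ, ∀ m, ∀ n : ℤ, (N : ℤ) < n → aOp n (w m) = 0 ∧ bOp n (w m) = 0) :
    ∃ N : ℕ, ∀ m, ∀ n : ℤ, (N : ℤ) < n → aOp n (X (w m)) = 0 ∧ bOp n (X (w m)) = 0 := by
  obtain ⟨N, hN⟩ := hw
  refine ⟨N + k.natAbs, fun m n hn => ?_⟩
  rw [Nat.cast_add] at hn
  have h1 := hN m n (by omega)
  rw [← Module.End.mul_apply, ← Module.End.mul_apply, ha n (by omega), hb n (by omega),
    Module.End.mul_apply, Module.End.mul_apply, h1.1, h1.2, map_zero]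
  exact ⟨rfl, rfl⟩

theorem aOp_comm_bound (k n : ℤ) (h : k.natAbs < n) :
    aOp n * aOp k = aOp k * aOp n ∧ bOp n * aOp k = aOp k * bOp n := by
  refine ⟨op_aa _ _, ?_⟩
  rw [op_ab, if_neg (by omega), add_zero]

theorem bOp_comm_bound (k n : ℤ) (h : k.natAbs < n) :
    aOp n * bOp k = bOp k * aOp n ∧ bOp n * bOp k = bOp k * bOp n := by
  refine ⟨?_, op_bb _ _⟩
  rw [op_ab, if_neg (by omega), add_zero]

/-- The coefficient condition defining `Fam`. -/
theorem coeff_cond_X {i : ℕ+ ⊕ ℕ+} {d : ℤ} (hd : dg (Finsupp.single i 1) = d)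
    (hw : w ∈ Fam g c e) (s : ℕ+ ⊕ ℕ+ →₀ ℕ) :
    ∃ p : Polynomial ℂ, (∀ k : ℕ, c + d < k + dg s → p.coeff k = 0) ∧
      ∀ m : ℤ, (MvPolynomial.X i * w m).coeff s = p.eval (m : ℂ) • jz g (m + (e - d) + dg s) := by
  by_cases h0 : ∀ w : Dch, (MvPolynomial.X i * w).coeff s = 0
  · exact ⟨0, fun k _ => Polynomial.coeff_zero k, fun m => by
      rw [h0, Polynomial.eval_zero, zero_smul]⟩
  · obtain ⟨w0, hw0⟩ := not_forall.1 h0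
    obtain ⟨t, rfl, ht⟩ := (coeff_X_mul_cases i w0 s).resolve_left hw0
    obtain ⟨p, hp, hp'⟩ := hw.2 t
    rw [map_add, hd]
    refine ⟨p, fun k hk => hp k (by omega), fun m => ?_⟩
    rw [ht, hp']
    congr 2
    ring

theorem coeff_cond_pd {i : ℕ+ ⊕ ℕ+} {d : ℤ} (hd : dg (Finsupp.single i 1) = d)
    (hw : w ∈ Fam g c e) (s : ℕ+ ⊕ ℕ+ →₀ ℕ) :
    ∃ p : Polynomial ℂ, (∀ k : ℕ, c - d < k + dg s → p.coeff k = 0) ∧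
      ∀ m : ℤ, (pdOp i (w m)).coeff s = p.eval (m : ℂ) • jz g (m + (e + d) + dg s) := by
  obtain ⟨p, hp, hp'⟩ := hw.2 (s + Finsupp.single i 1)
  rw [map_add, hd] at hp hp'
  refine ⟨Polynomial.C ((s i + 1 : ℕ) : ℂ) * p, fun k hk => ?_, fun m => ?_⟩
  · rw [Polynomial.coeff_C_mul, hp k (by omega), mul_zero]
  · rw [coeff_pdOp, hp', Polynomial.eval_mul, Polynomial.eval_C, mul_smul,
      Nat.cast_smul_eq_nsmul ℂ]
    congr 3
    ring

theorem fam_D0 (hw : w ∈ Fam g c e) : (fun m => aOp 0 (w m)) ∈ Fam g (c + 1) (e - 1) := by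
  refine ⟨fam_bound 0 (fun n h => (aOp_comm_bound 0 n h).1)
    (fun n h => (aOp_comm_bound 0 n h).2) hw.1, fun s => ?_⟩
  obtain ⟨p, hp, hp'⟩ := hw.2 s
  refine ⟨Polynomial.C (g 1 0 : ℂ) * (p * (Polynomial.X + Polynomial.C ((e + dg s : ℤ) : ℂ))),
    fun i hi => ?_, fun m => ?_⟩
  · rw [Polynomial.coeff_C_mul, mul_add, Polynomial.coeff_add, Polynomial.coeff_mul_C,
      hp i (by omega)]
    cases i with
    | zero => rw [Polynomial.coeff_mul_X_zero]; ring
    | succ i =>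
      rw [Polynomial.coeff_mul_X, hp i (by push_cast at hi; omega)]; ring
  · rw [aOp_zero, coeff_D0, hp', map_smul, dHol_jz, smul_smul]
    simp only [Polynomial.eval_mul, Polynomial.eval_C, Polynomial.eval_add, Polynomial.eval_X]
    rw [show m + e + dg s - 1 = m + (e - 1) + dg s by ring]
    congr 1
    push_cast
    ring

theorem fam_aOp (hw : w ∈ Fam g c e) (n : ℤ) :
    (fun m => aOp n (w m)) ∈ Fam g (c + 1) (e - 1) := by
  refine ⟨fam_bound n (fun k h => (aOp_comm_bound n k h).1)
    (fun k h => (aOp_comm_bound n k h).2) hw.1, ?_⟩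
  obtain ⟨k, rfl⟩ | h | ⟨k, rfl⟩ := int_cases n
  · rw [aOp_pos]
    have := coeff_cond_pd (dg_inr k) hw
    rwa [sub_neg_eq_add, ← sub_eq_add_neg] at this
  · rw [h]
    exact (fam_D0 hw).2
  · rw [aOp_neg]
    exact coeff_cond_X (dg_inl k) hw

theorem fam_bOp (hw : w ∈ Fam g c e) {n : ℤ} (hn : n ≠ 0) :
    (fun m => bOp n (w m)) ∈ Fam g (c - 1) (e + 1) := by
  refine ⟨fam_bound n (fun k h => (bOp_comm_bound n k h).1)
    (fun k h => (bOp_comm_bound n k h).2) hw.1, ?_⟩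
  obtain ⟨k, rfl⟩ | h | ⟨k, rfl⟩ := int_cases n
  · rw [bOp_pos]
    have h := coeff_cond_pd (dg_inl k) hw
    intro s
    obtain ⟨p, hp, hp'⟩ := h s
    refine ⟨-p, fun i hi => ?_, fun m => ?_⟩
    · rw [Polynomial.coeff_neg, hp i hi, neg_zero]
    · change (-pdOp (Sum.inl k) (w m)).coeff s = _
      rw [MvPolynomial.coeff_neg, hp', Polynomial.eval_neg, neg_smul]
  · exact absurd h hn
  · rw [bOp_neg]
    have := coeff_cond_X (dg_inr k) hw
    rwa [sub_neg_eq_add, ← sub_eq_add_neg] at this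

theorem mulOp_apply (p w : Dch) : mulOp p w = p * w := rfl

theorem C_comm_bound (f : Hol) (n : ℤ) (h : (0 : ℤ).natAbs < n) :
    aOp n * mulOp (MvPolynomial.C f) = mulOp (MvPolynomial.C f) * aOp n ∧
    bOp n * mulOp (MvPolynomial.C f) = mulOp (MvPolynomial.C f) * bOp n := by
  obtain ⟨k, rfl⟩ | hk | ⟨k, rfl⟩ := int_cases n
  · constructor
    · refine LinearMap.ext fun w => ?_
      rw [aOp_pos, Module.End.mul_apply, Module.End.mul_apply, mulOp_apply, mulOp_apply, pd_C]
    · refine LinearMap.ext fun w => ?_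
      rw [bOp_pos, Module.End.mul_apply, Module.End.mul_apply, mulOp_apply, mulOp_apply,
        LinearMap.neg_apply, LinearMap.neg_apply, pd_C, mul_neg]
  · exact absurd hk (ne_of_gt (by simpa using h))
  · have := k.pos; omega

theorem fam_jz (hw : w ∈ Fam g c e) (k : ℤ) :
    (fun m => MvPolynomial.C (jz g k) * w m) ∈ Fam g c (e + k) := by
  refine ⟨fam_bound (X := mulOp (MvPolynomial.C (jz g k))) 0
    (fun n h => (C_comm_bound _ n h).1) (fun n h => (C_comm_bound _ n h).2) hw.1, fun s => ?_⟩
  obtain ⟨p, hp, hp'⟩ := hw.2 s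
  refine ⟨p, hp, fun m => ?_⟩
  rw [MvPolynomial.coeff_C_mul, hp', mul_smul_comm, ← jz_add]
  congr 2
  ring

theorem fam_jop_of_ne (hw : w ∈ Fam g c e) {n : ℤ} (hn : n ≠ 0) :
    (fun m => jop bOp (g 1 0 : ℂ) (g 1 1 : ℂ) n (w m)) ∈ Fam g (c - 1) (e + 1) := by
  rw [jop_of_ne hn]
  exact (Fam g _ _).smul_mem _ (fam_bOp hw hn)

theorem fam_jop (hw : w ∈ Fam g c e) (n : ℤ) :
    (fun m => jop bOp (g 1 0 : ℂ) (g 1 1 : ℂ) n (w m)) ∈ Fam g c (e + 1) := by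
  by_cases hn : n = 0
  · rw [hn, jop_zero, ← jz_one]
    exact fam_jz hw 1
  · exact Fam_mono (by omega) (fam_jop_of_ne hw hn)

theorem fam_jop_jop (hw : w ∈ Fam g c e) {k l : ℤ} (h : k ≠ 0 ∨ l ≠ 0) :
    (fun m => (jop bOp (g 1 0 : ℂ) (g 1 1 : ℂ) k * jop bOp (g 1 0 : ℂ) (g 1 1 : ℂ) l) (w m)) ∈
      Fam g (c - 1) (e + 2) := by
  have e2 : e + 2 = e + 1 + 1 := by ring
  rw [e2]
  simp only [Module.End.mul_apply]
  obtain h | h := h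
  · exact fam_jop_of_ne (fam_jop hw l) h
  · exact fam_jop (fam_jop_of_ne hw h) k

theorem fam_nrm (hw : w ∈ Fam g c e) (i : ℤ) {k l : ℤ} (h : k ≠ 0 ∨ l ≠ 0) :
    (fun m => nrm aOp i
      (jop bOp (g 1 0 : ℂ) (g 1 1 : ℂ) k * jop bOp (g 1 0 : ℂ) (g 1 1 : ℂ) l) (w m)) ∈
      Fam g c (e + 1) := by
  unfold nrm
  split_ifs
  · have := fam_aOp (fam_jop_jop hw h) i
    rwa [sub_add_cancel, show e + 2 - 1 = e + 1 by ring] at this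
  · have := fam_jop_jop (fam_aOp hw i) h
    rwa [add_sub_cancel_right, show e - 1 + 2 = e + 1 by ring] at this

/-- The leading part of `(π(g) a)_{-n}` is `j ^ 2 a_{-n}`. -/
theorem fam_piAop (hw : w ∈ Fam g c e) (n : ℕ+) :
    (fun m => piAop (g 1 0 : ℂ) (g 1 1 : ℂ) n (w m) -
      MvPolynomial.X (Sum.inl n) * (MvPolynomial.C (jz g 2) * w m)) ∈ Fam g c (e + 1) := by
  obtain ⟨N, hN⟩ := hw.1
  have hn := n.pos
  set S : Finset (ℤ × ℤ) := Finset.Icc (-(n : ℤ) - 2 * N) N ×ˢ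
    insert 0 (Finset.Icc (-(n : ℤ) - 2 * N) N) with hS
  have hsum : ∀ m, Gop aOp bOp (g 1 0 : ℂ) (g 1 1 : ℂ) (-(n : ℤ)) (w m) = ∑ p ∈ S,
      nrm aOp p.1 (jop bOp (g 1 0 : ℂ) (g 1 1 : ℂ) p.2 *
        jop bOp (g 1 0 : ℂ) (g 1 1 : ℂ) (-(n : ℤ) - p.1 - p.2)) (w m) := by
    intro m
    rw [Gop, lsum_apply (heisD.locFin_Gop _)]
    refine finsum_eq_sum_of_support_subset _ fun p hp => ?_
    by_contra hc
    refine hp (heisD.nrm_jj_eq_zero (N := N) (fun k hk => ⟨(hN m k hk).1, ?_⟩) ?_)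
    · rw [jop_of_ne (by omega), LinearMap.smul_apply, (hN m k hk).2, smul_zero]
    · rw [hS, Finset.mem_coe, Finset.mem_product, Finset.mem_insert, Finset.mem_Icc,
        Finset.mem_Icc] at hc
      omega
  have hmem : ((-(n : ℤ), 0) : ℤ × ℤ) ∈ S := by
    rw [hS, Finset.mem_product, Finset.mem_insert, Finset.mem_Icc]
    exact ⟨⟨by simp only; omega, by simp only; omega⟩, Or.inl rfl⟩
  have h0 : ∀ m, nrm aOp (-(n : ℤ)) (jop bOp (g 1 0 : ℂ) (g 1 1 : ℂ) 0 *
      jop bOp (g 1 0 : ℂ) (g 1 1 : ℂ) (-(n : ℤ) - -(n : ℤ) - 0)) (w m) =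
      MvPolynomial.X (Sum.inl n) * (MvPolynomial.C (jz g 2) * w m) := by
    intro m
    rw [nrm, if_pos (by omega), sub_self, sub_zero, jop_zero, aOp_neg, jz_two, sq, map_mul,
      mul_assoc (MvPolynomial.C _)]
    rfl
  have key : (∑ p ∈ S.erase (-(n : ℤ), 0), fun m =>
      nrm aOp p.1 (jop bOp (g 1 0 : ℂ) (g 1 1 : ℂ) p.2 *
        jop bOp (g 1 0 : ℂ) (g 1 1 : ℂ) (-(n : ℤ) - p.1 - p.2)) (w m)) ∈ Fam g c (e + 1) := by
    refine Submodule.sum_mem _ fun p hp => fam_nrm hw _ ?_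
    rw [Finset.mem_erase, Ne, Prod.ext_iff] at hp
    simp only at hp
    omega
  have hb := (Fam g c (e + 1)).smul_mem (2 * (n : ℂ) * (g 1 0 : ℂ) ^ 2)
    (Fam_mono (by omega) (fam_bOp hw (n := -(n : ℤ)) (by omega)))
  convert add_mem key hb using 1
  funext m
  rw [piAop, LinearMap.add_apply, hsum, ← Finset.add_sum_erase _ _ hmem, h0, Pi.add_apply,
    Finset.sum_apply, Pi.smul_apply, LinearMap.smul_apply]
  abel

theorem fam_blocks (hw : w ∈ Fam g c e) (l : List ℕ) :
    (fun m => (l.map (fun i => (MvPolynomial.X (Sum.inr i.toPNat') : Dch))).prod * w m) ∈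
      Fam g (c - l.length) (e + l.length) := by
  induction l with
  | nil => simpa using hw
  | cons i l ih =>
    have h := fam_bOp ih (n := -(i.toPNat' : ℤ)) (by have := i.toPNat'.pos; omega)
    rw [bOp_neg] at h
    have e1 : c - ((i :: l).length : ℤ) = c - l.length - 1 := by
      rw [List.length_cons]; push_cast; ring
    have e2 : e + ((i :: l).length : ℤ) = e + l.length + 1 := by
      rw [List.length_cons]; push_cast; ring
    rw [e1, e2]
    refine cast (congrArg (· ∈ Fam g _ _) (funext fun m => ?_)) h
    rw [List.map_cons, List.prod_cons, mul_assoc]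
    rfl

theorem C_jInv_pow (k : ℕ) :
    MvPolynomial.C (jInv g) ^ k = (MvPolynomial.C (jz g (-k)) : Dch) := by
  rw [← map_pow, jz, zpow_neg, zpow_natCast, ← inv_pow, Units.val_pow_eq_pow_val]
  rfl

theorem fam_piBTerm (hw : w ∈ Fam g c e) (l : List ℕ) :
    (fun m => piBTerm g l * w m) ∈ Fam g (c - l.length) (e - 1) := by
  have h := (Fam g _ _).smul_mem ((-(g 1 0 : ℂ)) ^ (l.length - 1))
    (fam_jz (fam_blocks hw l) (-((l.length + 1 : ℕ) : ℤ)))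
  have e1 : e + l.length + -((l.length + 1 : ℕ) : ℤ) = e - 1 := by push_cast; ring
  rw [e1] at h
  refine cast (congrArg (· ∈ Fam g _ _) (funext fun m => ?_)) h
  rw [Pi.smul_apply, piBTerm, smul_eq_cst, C_jInv_pow, ← cst_neg, mul_assoc, mul_assoc, cst, cst,
    map_pow, map_pow]

/-- The leading part of `(π(g) b)_{-n}` is `j ^ (-2) b_{-n}`. -/
theorem fam_piB (hw : w ∈ Fam g c e) (n : ℕ+) :
    (fun m => piB g n * w m -
      MvPolynomial.X (Sum.inr n) * (MvPolynomial.C (jz g (-2)) * w m)) ∈ Fam g (c - 2) (e - 1) := by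
  classical
  have hsum : (∑ b ∈ Finset.univ.erase (Composition.single (n : ℕ) n.pos), fun m =>
      piBTerm g b.blocks * w m) ∈ Fam g (c - 2) (e - 1) := by
    refine Submodule.sum_mem _ fun b hb => Fam_mono ?_ (fam_piBTerm hw b.blocks)
    have h1 := (Finset.mem_erase.1 hb).1
    rw [Ne, Composition.eq_single_iff_length n.pos] at h1
    have h2 := b.length_pos_of_pos n.pos
    rw [Composition.length] at h1 h2
    omega
  refine cast (congrArg (· ∈ Fam g _ _) (funext fun m => ?_)) hsum
  have h1 : piBTerm g (Composition.single (n : ℕ) n.pos).blocks =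
      MvPolynomial.X (Sum.inr n) * MvPolynomial.C (jz g (-2)) := by
    have := C_jInv_pow (g := g) 2
    push_cast at this
    rw [piBTerm, Composition.single_blocks, List.length_singleton, List.map_singleton,
      List.prod_singleton, PNat.coe_toPNat', ← this]
    ring
  rw [piB_eq, ← Finset.add_sum_erase _ _ (Finset.mem_univ (Composition.single (n : ℕ) n.pos)),
    Finset.sum_apply, ← Finset.sum_mul, add_mul, h1, mul_assoc, add_sub_cancel_left]

end Families

/-! ### Leading parts -/

section Leading

variable {g : SL(2, ℝ)} {c e : ℤ} {w v : ℤ → Dch}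

/-- The families `w` and `v` have the same leading part in `Fam g c e`. -/
def Near (g : SL(2, ℝ)) (c e : ℤ) (w v : ℤ → Dch) : Prop :=
  v ∈ Fam g c e ∧ w - v ∈ Fam g (c - 1) e

theorem Near.left_mem (h : Near g c e w v) : w ∈ Fam g c e := by
  have := add_mem (Fam_mono (show c - 1 ≤ c by omega) h.2) h.1
  rwa [sub_add_cancel] at this

theorem fam_lead_a (hv : v ∈ Fam g c e) (n : ℕ+) :
    (fun m => MvPolynomial.X (Sum.inl n) * (MvPolynomial.C (jz g 2) * v m)) ∈
      Fam g (c + 1) (e + 1) := by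
  have h := fam_aOp (fam_jz hv 2) (-(n : ℤ))
  rw [aOp_neg, show e + 2 - 1 = e + 1 by ring] at h
  exact h

theorem fam_lead_b (hv : v ∈ Fam g c e) (n : ℕ+) :
    (fun m => MvPolynomial.X (Sum.inr n) * (MvPolynomial.C (jz g (-2)) * v m)) ∈
      Fam g (c - 1) (e - 1) := by
  have h := fam_bOp (fam_jz hv (-2)) (n := -(n : ℤ)) (by have := n.pos; omega)
  rw [bOp_neg, show e + -2 + 1 = e - 1 by ring] at h
  exact h

theorem Near.piAop (h : Near g c e w v) (n : ℕ+) :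
    Near g (c + 1) (e + 1) (fun m => CDO.piAop (g 1 0 : ℂ) (g 1 1 : ℂ) n (w m))
      (fun m => MvPolynomial.X (Sum.inl n) * (MvPolynomial.C (jz g 2) * v m)) := by
  refine ⟨fam_lead_a h.1 n, ?_⟩
  have h1 := fam_piAop h.left_mem n
  have h2 := fam_lead_a h.2 n
  rw [sub_add_cancel] at h2
  rw [add_sub_cancel_right]
  refine cast (congrArg (· ∈ Fam g _ _) (funext fun m => ?_)) (add_mem h1 h2)
  simp only [Pi.add_apply, Pi.sub_apply]
  ring

theorem Near.piB (h : Near g c e w v) (n : ℕ+) :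
    Near g (c - 1) (e - 1) (fun m => CDO.piB g n * w m)
      (fun m => MvPolynomial.X (Sum.inr n) * (MvPolynomial.C (jz g (-2)) * v m)) := by
  refine ⟨fam_lead_b h.1 n, ?_⟩
  have h1 := fam_piB h.left_mem n
  have h2 := fam_lead_b h.2 n
  rw [sub_sub, one_add_one_eq_two] at h2
  rw [sub_sub, one_add_one_eq_two]
  refine cast (congrArg (· ∈ Fam g _ _) (funext fun m => ?_)) (add_mem h1 h2)
  simp only [Pi.add_apply, Pi.sub_apply]
  ring

theorem X_mul_C_mul_monomial (i : ℕ+ ⊕ ℕ+) (f h : Hol) (s : ℕ+ ⊕ ℕ+ →₀ ℕ) :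
    (MvPolynomial.X i * (MvPolynomial.C f * MvPolynomial.monomial s h) : Dch) =
      MvPolynomial.monomial (s + Finsupp.single i 1) (f * h) := by
  rw [MvPolynomial.C_mul_monomial, MvPolynomial.X, MvPolynomial.monomial_mul, one_mul, add_comm]

/-- A family with a single monomial. -/
def monoFam (g : SL(2, ℝ)) (e : ℤ) (x : Ptn × Ptn) (p : Polynomial ℂ) (m : ℤ) : Dch :=
  MvPolynomial.monomial (expo x) (p.eval (m : ℂ) • jz g (m + e + ldiff x))

theorem vars_monomial_bound (s : ℕ+ ⊕ ℕ+ →₀ ℕ) : ∃ N : ℕ, ∀ f : Hol, ∀ n : ℤ, (N : ℤ) < n →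
    aOp n (MvPolynomial.monomial s f) = 0 ∧ bOp n (MvPolynomial.monomial s f) = 0 := by
  obtain ⟨N, hN⟩ := heisD.loc (MvPolynomial.monomial s 1)
  refine ⟨N, fun f n hn => ?_⟩
  have h := hN n hn
  have h0 : ((0 : ℤ).natAbs : ℤ) < n := by simp; omega
  have e : (MvPolynomial.monomial s f : Dch) =
      mulOp (MvPolynomial.C f) (MvPolynomial.monomial s 1) := by
    rw [mulOp_apply, MvPolynomial.C_mul_monomial, mul_one]
  rw [e, ← Module.End.mul_apply, ← Module.End.mul_apply, (C_comm_bound f n h0).1,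
    (C_comm_bound f n h0).2, Module.End.mul_apply, Module.End.mul_apply, h.1, h.2, map_zero]
  exact ⟨rfl, rfl⟩

theorem monoFam_mem (e : ℤ) (x : Ptn × Ptn) (p : Polynomial ℂ)
    (hp : ∀ i : ℕ, c < i + ldiff x → p.coeff i = 0) : monoFam g e x p ∈ Fam g c e := by
  classical
  obtain ⟨N, hN⟩ := vars_monomial_bound (expo x)
  refine ⟨⟨N, fun m n hn => hN _ n hn⟩, fun s => ?_⟩
  by_cases hs : expo x = s
  · refine ⟨p, fun i hi => hp i ?_, fun m => ?_⟩
    · rwa [← hs, dg_expo] at hi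
    · rw [monoFam, MvPolynomial.coeff_monomial, if_pos hs, ← hs, dg_expo]
  · refine ⟨0, fun i _ => Polynomial.coeff_zero i, fun m => ?_⟩
    rw [monoFam, MvPolynomial.coeff_monomial, if_neg hs, Polynomial.eval_zero, zero_smul]

/-- The leading part of `π(g)a_{-λ} π(g)b_{-μ} φ`. -/
theorem near_lift (p : Polynomial ℂ) (k : ℤ) (hp : ∀ i : ℕ, k < i → p.coeff i = 0)
    (x : Ptn × Ptn) :
    Near g (ldiff x + k) (ldiff x + k) (fun m => liftL g x (p.eval (m : ℂ) • jz g (m + k)))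
      (monoFam g (ldiff x + k) x p) := by
  have hB : ∀ s : Ptn, Near g (ldiff (0, s) + k) (ldiff (0, s) + k)
      (fun m => (s.map (CDO.piB g)).prod * MvPolynomial.C (p.eval (m : ℂ) • jz g (m + k)))
      (monoFam g (ldiff (0, s) + k) (0, s) p) := by
    intro s
    induction s using Multiset.induction_on with
    | empty =>
      have e0 : ldiff (0, 0) = 0 := rfl
      have e1 : (fun m : ℤ => ((0 : Ptn).map (CDO.piB g)).prod *
          MvPolynomial.C (p.eval (m : ℂ) • jz g (m + k))) = monoFam g (ldiff (0, 0) + k) (0, 0) p := by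
        funext m
        rw [Multiset.map_zero, Multiset.prod_zero, one_mul, monoFam, expo_zero, e0, zero_add,
          add_zero]
        rfl
      rw [e1]
      refine ⟨monoFam_mem _ _ _ fun i hi => hp i (by omega), ?_⟩
      rw [sub_self]
      exact zero_mem _
    | cons n s ih =>
      have e0 : ldiff (0, n ::ₘ s) = ldiff (0, s) - 1 := by
        simp only [ldiff, Multiset.card_cons]; push_cast; ring
      have h := ih.piB n
      have e1 : ldiff (0, s) + k - 1 = ldiff (0, n ::ₘ s) + k := by rw [e0]; ring
      rw [e1] at h
      refine cast (congrArg₂ (Near g _ _) (funext fun m => ?_) (funext fun m => ?_)) h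
      · rw [Multiset.map_cons, Multiset.prod_cons, mul_assoc]
      · rw [monoFam, monoFam, X_mul_C_mul_monomial, expo_cons_snd, mul_smul_comm, ← jz_add, e0]
        congr 3
        ring
  have hA : ∀ l : List ℕ+, Near g (ldiff (l, x.2) + k) (ldiff (l, x.2) + k)
      (fun m => (l.map (CDO.piAop (g 1 0 : ℂ) (g 1 1 : ℂ))).prod
        ((x.2.map (CDO.piB g)).prod * MvPolynomial.C (p.eval (m : ℂ) • jz g (m + k))))
      (monoFam g (ldiff (l, x.2) + k) (l, x.2) p) := by
    intro l
    induction l with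
    | nil =>
      rw [Multiset.coe_nil]
      exact hB x.2
    | cons n l ih =>
      have e0 : ldiff ((n :: l : List ℕ+), x.2) = ldiff (l, x.2) + 1 := by
        simp only [ldiff, Multiset.coe_card, List.length_cons]; push_cast; ring
      have h := ih.piAop n
      have e1 : ldiff (l, x.2) + k + 1 = ldiff ((n :: l : List ℕ+), x.2) + k := by rw [e0]; ring
      rw [e1] at h
      refine cast (congrArg₂ (Near g _ _) (funext fun m => ?_) (funext fun m => ?_)) h
      · rw [List.map_cons, List.prod_cons, Module.End.mul_apply]
      · rw [monoFam, monoFam, X_mul_C_mul_monomial, ← Multiset.cons_coe, expo_cons_fst,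
          Multiset.cons_coe, mul_smul_comm, ← jz_add, e0]
        congr 3
        ring
  have h := hA (parts x.1)
  have e : ((parts x.1 : List ℕ+) : Ptn) = x.1 := Multiset.sort_eq _ _
  rw [e] at h
  exact h

/-! ### The two operators attached to a basis element -/

/-- The derivation `j ^ 2 d/db` of `𝒪(ℍ)`. -/
def theta (γ δ : ℂ) : Hol →ₗ[ℂ] Hol := LinearMap.mulLeft ℂ (jHol γ δ ^ 2) ∘ₗ dHol

theorem theta_apply (γ δ : ℂ) (f : Hol) : theta γ δ f = jHol γ δ ^ 2 * dHol f := rfl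

theorem theta_jz (n : ℤ) : theta (g 1 0 : ℂ) (g 1 1 : ℂ) (jz g n) =
    ((n : ℂ) * (g 1 0 : ℂ)) • jz g (n + 1) := by
  rw [theta_apply, dHol_jz, mul_smul_comm, ← jz_two, ← jz_add]
  congr 2
  ring

theorem theta_pow_jz (k : ℕ) (m : ℤ) : (theta (g 1 0 : ℂ) (g 1 1 : ℂ) ^ k) (jz g m) =
    ((Polynomial.C (g 1 0 : ℂ) ^ k * ∏ i ∈ Finset.range k,
      (Polynomial.X + Polynomial.C (i : ℂ))).eval (m : ℂ)) • jz g (m + k) := by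
  induction k with
  | zero => simp
  | succ k ih =>
    rw [pow_succ', Module.End.mul_apply, ih, map_smul, theta_jz, smul_smul, pow_succ,
      Finset.prod_range_succ]
    simp only [Polynomial.eval_mul, Polynomial.eval_pow, Polynomial.eval_C, Polynomial.eval_add,
      Polynomial.eval_X]
    rw [show m + ((k + 1 : ℕ) : ℤ) = m + k + 1 by push_cast; ring]
    congr 1
    push_cast
    ring

theorem dHol_pow_jz (k : ℕ) (m n : ℤ) : (dHol ^ k) (jz g (m + n)) =
    ((Polynomial.C (g 1 0 : ℂ) ^ k * ∏ i ∈ Finset.range k,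
      (Polynomial.X + Polynomial.C ((n : ℂ) - i))).eval (m : ℂ)) • jz g (m + n - k) := by
  induction k with
  | zero => simp
  | succ k ih =>
    rw [pow_succ', Module.End.mul_apply, ih, map_smul, dHol_jz, smul_smul, pow_succ,
      Finset.prod_range_succ]
    simp only [Polynomial.eval_mul, Polynomial.eval_pow, Polynomial.eval_C, Polynomial.eval_add,
      Polynomial.eval_X]
    rw [show m + n - ((k + 1 : ℕ) : ℤ) = m + n - k - 1 by push_cast; ring]
    congr 1
    push_cast
    ring

theorem coeff_prod_sub (k : ℕ) (r s : ℕ → ℂ) (q : ℂ) (i : ℕ) (hi : k ≤ i) :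
    (Polynomial.C q ^ k * (∏ i ∈ Finset.range k, (Polynomial.X + Polynomial.C (r i))) -
      Polynomial.C q ^ k * ∏ i ∈ Finset.range k, (Polynomial.X + Polynomial.C (s i))).coeff i
      = 0 := by
  have hm : ∀ r : ℕ → ℂ, (∏ i ∈ Finset.range k, (Polynomial.X + Polynomial.C (r i))).coeff i =
      if i = k then 1 else 0 := by
    intro r
    have h1 : (∏ i ∈ Finset.range k, (Polynomial.X + Polynomial.C (r i))).Monic :=
      Polynomial.monic_prod_of_monic _ _ fun i _ => Polynomial.monic_X_add_C _
    have h2 : (∏ i ∈ Finset.range k, (Polynomial.X + Polynomial.C (r i))).natDegree = k := by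
      rw [Polynomial.natDegree_prod_of_monic _ _ fun i _ => Polynomial.monic_X_add_C _]
      simp
    split_ifs with h
    · rw [h]
      have := h1.coeff_natDegree
      rwa [h2] at this
    · exact Polynomial.coeff_eq_zero_of_natDegree_lt (by omega)
  rw [← mul_sub, ← map_pow, Polynomial.coeff_C_mul, Polynomial.coeff_sub, hm, hm, sub_self,
    mul_zero]

/-- The operator `f ↦ a_{-λ} b_{-μ} a_0^k f`. -/
def actL (x : Ptn × Ptn) (k : ℕ) : Hol →ₗ[ℂ] Dch :=
  (MvPolynomial.monomial (expo x) : Hol →ₗ[Hol] Dch).restrictScalars ℂ ∘ₗ dHol ^ k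

/-- The operator `h ↦ π(g)(a_{-λ} b_{-μ} a_0^k f)`, where `h = f(g b)`. -/
def tilL (g : SL(2, ℝ)) (x : Ptn × Ptn) (k : ℕ) : Hol →ₗ[ℂ] Dch :=
  liftL g x ∘ₗ theta (g 1 0 : ℂ) (g 1 1 : ℂ) ^ k

/-- On the powers of `j`, the transformed basis element and the basis element itself differ only in
lower order terms. -/
theorem tilL_sub_actL_mem (x : Ptn × Ptn) (k : ℕ) {l : ℤ} (hl : ldiff x + k = l) :
    (fun m : ℤ => tilL g x k (jz g m) - actL x k (jz g (m + 2 * l))) ∈ Fam g (l - 1) l := by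
  set p := Polynomial.C (g 1 0 : ℂ) ^ k * ∏ i ∈ Finset.range k,
      (Polynomial.X + Polynomial.C (i : ℂ)) with hp
  set q := Polynomial.C (g 1 0 : ℂ) ^ k * ∏ i ∈ Finset.range k,
      (Polynomial.X + Polynomial.C (((2 * l : ℤ) : ℂ) - i)) with hq
  have hpk : ∀ i : ℕ, (k : ℤ) < i → p.coeff i = 0 := by
    intro i hi
    refine Polynomial.coeff_eq_zero_of_natDegree_lt (lt_of_le_of_lt ?_ (by exact_mod_cast hi))
    refine (Polynomial.natDegree_mul_le).trans ?_
    rw [← map_pow, Polynomial.natDegree_C, zero_add]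
    refine (Polynomial.natDegree_prod_le _ _).trans ?_
    rw [Finset.sum_congr rfl fun i _ => Polynomial.natDegree_X_add_C _, Finset.sum_const,
      Finset.card_range, smul_eq_mul, mul_one]
  have h1 := (near_lift (g := g) p k hpk x).2
  have h2 : monoFam g l x (p - q) ∈ Fam g (l - 1) l := by
    refine monoFam_mem _ _ _ fun i hi => ?_
    exact coeff_prod_sub k (fun i => i) (fun i => ((2 * l : ℤ) : ℂ) - i) _ i (by omega)
  rw [hl] at h1
  refine cast (congrArg (· ∈ Fam g _ _) (funext fun m => ?_)) (add_mem h1 h2)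
  have e1 : m + 2 * l - k = m + l + ldiff x := by rw [← hl]; ring
  have e2 : actL x k (jz g (m + 2 * l)) =
      MvPolynomial.monomial (expo x) ((dHol ^ k) (jz g (m + 2 * l))) := rfl
  have e3 : tilL g x k (jz g m) =
      liftL g x ((theta (g 1 0 : ℂ) (g 1 1 : ℂ) ^ k) (jz g m)) := rfl
  rw [e2, e3, theta_pow_jz, dHol_pow_jz, e1, Pi.add_apply, Pi.sub_apply, monoFam, monoFam,
    Polynomial.eval_sub, sub_smul, map_sub]
  simp only [← hp, ← hq]
  abel

/-- A family in `Fam g (l - 1) l` with the same behaviour under the zero mode of `a j ^ 2` as the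
powers of `j` vanishes. -/
theorem fam_eq_zero (hg : (g 1 0 : ℂ) ≠ 0) {l : ℤ} (hw : w ∈ Fam g (l - 1) l)
    (h : ∀ m : ℤ, Gop aOp bOp (g 1 0 : ℂ) (g 1 1 : ℂ) 0 (w m) =
      ((m : ℂ) * (g 1 0 : ℂ)) • w (m + 1)) : w = 0 := by
  choose p hp hp' using hw.2
  have hz : ∀ s, p s = 0 := by
    by_contra hc
    obtain ⟨s1, hs1⟩ := not_forall.1 hc
    obtain ⟨d, ⟨s, rfl, hs⟩, hmax⟩ := Int.exists_greatest_of_bdd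
      (P := fun d => ∃ s, dg s = d ∧ p s ≠ 0) ⟨l - 1, by
        rintro d ⟨s, rfl, hs⟩
        by_contra hd
        refine hs (Polynomial.ext fun i => ?_)
        rw [hp s i (by omega), Polynomial.coeff_zero]⟩ ⟨_, s1, rfl, hs1⟩
    have htop : ∀ m, w m ∈ Dle (dg s) := by
      intro m t ht
      have : p t = 0 := by
        by_contra hpt
        exact absurd (hmax _ ⟨t, rfl, hpt⟩) (not_le.2 ht)
      rw [hp', this, Polynomial.eval_zero, zero_smul]
    -- the recursion satisfied by the polynomial of a monomial of top degree difference
    have hrec : ∀ m : ℤ, (p s).eval (m : ℂ) * ((m : ℂ) + (l - dg s : ℤ)) =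
        m * (p s).eval ((m + 1 : ℤ) : ℂ) := by
      intro m
      have h1 := congrArg (MvPolynomial.coeff s) (h m)
      rw [coeff_Gop_zero_top _ _ (htop m), MvPolynomial.coeff_smul, hp', hp', map_smul, dHol_jz,
        mul_smul_comm, mul_smul_comm, mul_smul_comm, ← jz_two, ← jz_one, ← jz_add, ← jz_add,
        smul_smul, smul_smul, smul_smul,
        show 2 + (m + l + dg s - 1) = m + 1 + l + dg s by ring,
        show 1 + (m + l + dg s) = m + 1 + l + dg s by ring, ← sub_smul, ← sub_eq_zero,
        ← sub_smul] at h1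
      have h2 := smul_jz_eq_zero h1
      refine mul_left_cancel₀ hg ?_
      push_cast at h2 ⊢
      linear_combination h2
    -- the `l - d` roots `0, -1, -2, …` are one more than the degree of `p s` admits
    have hroot : ∀ i : ℕ, (i : ℤ) < l - dg s → (p s).eval ((-(i : ℤ) : ℤ) : ℂ) = 0 := by
      intro i hi
      induction i with
      | zero =>
        have h1 := hrec 0
        simp only [Int.cast_zero, zero_mul, zero_add] at h1
        have h2 := (mul_eq_zero.1 h1).resolve_right (Int.cast_ne_zero.2 (by push_cast at hi; omega))
        simpa using h2
      | succ i ih =>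
        have h1 := hrec (-((i + 1 : ℕ) : ℤ))
        have e : -((i + 1 : ℕ) : ℤ) + 1 = -(i : ℤ) := by push_cast; ring
        rw [e, ih (by push_cast at hi; omega), mul_zero, ← Int.cast_add] at h1
        exact (mul_eq_zero.1 h1).resolve_right (Int.cast_ne_zero.2 (by push_cast at hi ⊢; omega))
    refine hs ?_
    obtain ⟨n, hn⟩ : ∃ n : ℕ, (n : ℤ) = l - dg s ∨ (n = 0 ∧ l - dg s ≤ 0) := by
      by_cases h0 : 0 ≤ l - dg s
      · exact ⟨(l - dg s).toNat, Or.inl (Int.toNat_of_nonneg h0)⟩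
      · exact ⟨0, Or.inr ⟨rfl, by omega⟩⟩
    refine Polynomial.eq_zero_of_natDegree_lt_card_of_eval_eq_zero (p s)
      (f := fun i : Fin n => ((-(i : ℤ) : ℤ) : ℂ)) (fun i j hij => ?_) (fun i => ?_) ?_
    · have := Int.cast_injective hij
      exact Fin.ext (by omega)
    · have := i.isLt
      exact hroot i (by omega)
    · rw [Fintype.card_fin]
      by_contra hcon
      have := Polynomial.leadingCoeff_ne_zero.2 hs
      exact this (hp s _ (by omega))
  funext m
  refine MvPolynomial.ext _ _ fun s => ?_
  rw [hp', hz, Polynomial.eval_zero, zero_smul]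
  rfl

end Leading

/-! ### Operators of finite order are determined by their values on the powers of `j` -/

/-- The function `b - τ`. -/
def tH (τ : ℍ) : Hol := coordH - algebraMap ℂ Hol (τ : ℂ)

theorem dHol_tH (τ : ℍ) : dHol (tH τ) = 1 := by
  have h1 : dHol 1 = 0 := by simpa using dHol_mul 1 1
  rw [tH, map_sub, dHol_coordH, Algebra.algebraMap_eq_smul_one, map_smul, h1, smul_zero, sub_zero]

theorem exists_eq_add_tH_mul (τ : ℍ) (h : Hol) :
    ∃ (c : ℂ) (h' : Hol), h = algebraMap ℂ Hol c + tH τ * h' := by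
  have hh : MDiff h.1 := h.2
  rw [UpperHalfPlane.mdifferentiable_iff] at hh
  have hn : {z : ℂ | 0 < z.im} ∈ nhds (τ : ℂ) :=
    UpperHalfPlane.isOpen_upperHalfPlaneSet.mem_nhds τ.im_pos
  have hd := (Complex.differentiableOn_dslope hn).2 hh
  refine ⟨h.1 τ, ⟨fun z => dslope (h.1 ∘ UpperHalfPlane.ofComplex) (τ : ℂ) z, ?_⟩,
    Hol.ext fun z => ?_⟩
  · change MDiff (fun z : ℍ => dslope (h.1 ∘ UpperHalfPlane.ofComplex) (τ : ℂ) z)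
    rw [UpperHalfPlane.mdifferentiable_iff]
    refine hd.congr fun z hz => ?_
    rw [Function.comp_apply, UpperHalfPlane.ofComplex_apply_of_im_pos hz]
  · have e := sub_smul_dslope (h.1 ∘ UpperHalfPlane.ofComplex) (τ : ℂ) (z : ℂ)
    rw [Function.comp_apply, Function.comp_apply, UpperHalfPlane.ofComplex_apply,
      UpperHalfPlane.ofComplex_apply, smul_eq_mul] at e
    change h.1 z = h.1 τ + ((z : ℂ) - (τ : ℂ)) * _
    rw [e]; ring

theorem exists_eq_add_tH_pow_mul {g : SL(2, ℝ)} (hg : (g 1 0 : ℂ) ≠ 0) (τ : ℍ) (h : Hol) (N : ℕ) :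
    ∃ s ∈ Submodule.span ℂ (Set.range (jz g)), ∃ h', h = s + tH τ ^ N * h' := by
  set S := Submodule.span ℂ (Set.range (jz g))
  have ht : ∀ s ∈ S, tH τ * s ∈ S := by
    have e : tH τ = (g 1 0 : ℂ)⁻¹ • jz g 1 -
        ((g 1 0 : ℂ)⁻¹ * ((g 1 0 : ℂ) * τ + (g 1 1 : ℂ))) • jz g 0 := by
      rw [jz_one, jz_zero, jHol, tH, Algebra.algebraMap_eq_smul_one, smul_add, smul_smul, smul_smul,
        mul_add, ← mul_assoc, inv_mul_cancel₀ hg, one_smul, one_mul, add_smul]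
      abel
    intro s hs
    induction hs using Submodule.span_induction with
    | mem x hx =>
      obtain ⟨n, rfl⟩ := hx
      rw [e, sub_mul, smul_mul_assoc, smul_mul_assoc, ← jz_add, ← jz_add]
      exact sub_mem (S.smul_mem _ (Submodule.subset_span ⟨_, rfl⟩))
        (S.smul_mem _ (Submodule.subset_span ⟨_, rfl⟩))
    | zero => rw [mul_zero]; exact zero_mem _
    | add x y _ _ hx hy => rw [mul_add]; exact add_mem hx hy
    | smul c x _ hx => rw [mul_smul_comm]; exact S.smul_mem _ hx
  have ht' : ∀ N : ℕ, tH τ ^ N ∈ S := by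
    intro N
    induction N with
    | zero => rw [pow_zero, ← jz_zero g]; exact Submodule.subset_span ⟨_, rfl⟩
    | succ N ih => rw [pow_succ']; exact ht _ ih
  induction N with
  | zero => exact ⟨0, zero_mem _, h, by rw [pow_zero, one_mul, zero_add]⟩
  | succ N ih =>
    obtain ⟨s, hs, h1, rfl⟩ := ih
    obtain ⟨c, h2, rfl⟩ := exists_eq_add_tH_mul τ h1
    refine ⟨s + c • tH τ ^ N, add_mem hs (S.smul_mem _ (ht' N)), h2, ?_⟩
    rw [Algebra.algebraMap_eq_smul_one, mul_add, mul_smul_comm, mul_one, pow_succ]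
    ring

/-- The vectors all of whose coefficients vanish to order `M` at `τ`. -/
def vanish (τ : ℍ) (M : ℕ) : Submodule ℂ Dch where
  carrier := {w | ∀ s, tH τ ^ M ∣ w.coeff s}
  add_mem' hv hw s := by rw [MvPolynomial.coeff_add]; exact dvd_add (hv s) (hw s)
  zero_mem' s := by rw [MvPolynomial.coeff_zero]; exact dvd_zero _
  smul_mem' c w hw s := by
    rw [MvPolynomial.coeff_smul, ← one_mul (MvPolynomial.coeff s w), ← smul_mul_assoc]
    exact (hw s).mul_left _

theorem vanish_succ_le (τ : ℍ) (M : ℕ) : vanish τ (M + 1) ≤ vanish τ M := fun _ hw s =>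
  (pow_dvd_pow _ M.le_succ).trans (hw s)

theorem dvd_dHol {τ : ℍ} {M : ℕ} {f : Hol} (h : tH τ ^ (M + 1) ∣ f) : tH τ ^ M ∣ dHol f := by
  have hp : ∀ M : ℕ, tH τ ^ M ∣ dHol (tH τ ^ (M + 1)) := by
    intro M
    induction M with
    | zero => rw [pow_zero]; exact one_dvd _
    | succ M ih =>
      rw [pow_succ (tH τ) (M + 1), dHol_mul, dHol_tH, mul_one, pow_succ]
      exact dvd_add dvd_rfl (mul_dvd_mul_right ih _)
  obtain ⟨q, rfl⟩ := h
  rw [dHol_mul]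
  exact dvd_add (((pow_dvd_pow _ M.le_succ)).mul_right _) ((hp M).mul_right _)

theorem mul_vanish {τ : ℍ} {M : ℕ} (p : Dch) {w : Dch} (hw : w ∈ vanish τ M) :
    p * w ∈ vanish τ M := fun s => by
  classical
  rw [MvPolynomial.coeff_mul]
  exact Finset.dvd_sum fun x _ => (hw x.2).mul_left _

theorem pdOp_vanish {τ : ℍ} {M : ℕ} (i : ℕ+ ⊕ ℕ+) {w : Dch} (hw : w ∈ vanish τ M) :
    pdOp i w ∈ vanish τ M := fun s => by
  rw [coeff_pdOp, nsmul_eq_mul]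
  exact (hw _).mul_left _

theorem aOp_vanish {τ : ℍ} {M : ℕ} (n : ℤ) {w : Dch} (hw : w ∈ vanish τ (M + 1)) :
    aOp n w ∈ vanish τ M := by
  obtain ⟨k, rfl⟩ | rfl | ⟨k, rfl⟩ := int_cases n
  · rw [aOp_pos]; exact pdOp_vanish _ (vanish_succ_le _ _ hw)
  · intro s
    rw [aOp_zero, coeff_D0]
    exact dvd_dHol (hw s)
  · rw [aOp_neg]; exact mul_vanish _ (vanish_succ_le _ _ hw)

theorem bOp_vanish {τ : ℍ} {M : ℕ} (n : ℤ) {w : Dch} (hw : w ∈ vanish τ M) :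
    bOp n w ∈ vanish τ M := by
  obtain ⟨k, rfl⟩ | rfl | ⟨k, rfl⟩ := int_cases n
  · rw [bOp_pos]; exact neg_mem (pdOp_vanish _ hw)
  · exact mul_vanish _ hw
  · rw [bOp_neg]; exact mul_vanish _ hw

theorem jop_vanish {τ : ℍ} {M : ℕ} (γ δ : ℂ) (n : ℤ) {w : Dch} (hw : w ∈ vanish τ M) :
    jop bOp γ δ n w ∈ vanish τ M := by
  rw [jop, LinearMap.add_apply]
  exact add_mem (Submodule.smul_mem _ _ (bOp_vanish n hw)) (Submodule.smul_mem _ _ hw)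

theorem piAop_vanish {τ : ℍ} {M : ℕ} (γ δ : ℂ) (n : ℕ+) {w : Dch} (hw : w ∈ vanish τ (M + 1)) :
    piAop γ δ n w ∈ vanish τ M := by
  rw [piAop, LinearMap.add_apply]
  refine add_mem (lsum_mem (heisD.locFin_Gop _) _ fun p => ?_)
    (Submodule.smul_mem _ _ (bOp_vanish _ (vanish_succ_le _ _ hw)))
  unfold nrm
  split_ifs
  · rw [Module.End.mul_apply, Module.End.mul_apply]
    exact aOp_vanish _ (jop_vanish _ _ _ (jop_vanish _ _ _ hw))
  · rw [Module.End.mul_apply, Module.End.mul_apply]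
    exact jop_vanish _ _ _ (jop_vanish _ _ _ (aOp_vanish _ hw))

/-- The linear maps `𝒪(ℍ) → 𝒟^ch(ℍ)` of finite order at every point `τ`: the values on functions
that vanish to high order at `τ` vanish at `τ`. -/
def FinOrder : Submodule ℂ (Hol →ₗ[ℂ] Dch) where
  carrier := {T | ∀ τ, ∃ N : ℕ, ∀ h, T (tH τ ^ N * h) ∈ vanish τ 1}
  add_mem' := by
    rintro S T hS hT τ
    obtain ⟨N, hN⟩ := hS τ
    obtain ⟨N', hN'⟩ := hT τ
    refine ⟨N + N', fun h => add_mem ?_ ?_⟩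
    · rw [pow_add, mul_assoc]; exact hN _
    · rw [add_comm, pow_add, mul_assoc]; exact hN' _
  zero_mem' τ := ⟨0, fun _ => zero_mem _⟩
  smul_mem' := by
    rintro c T hT τ
    obtain ⟨N, hN⟩ := hT τ
    exact ⟨N, fun h => Submodule.smul_mem _ _ (hN h)⟩

/-- Up to terms that vanish to high order at `τ`, every function is a polynomial in `j`, since
`b - τ` is one for `γ ≠ 0`. -/
theorem eq_zero_of_finOrder {g : SL(2, ℝ)} (hg : (g 1 0 : ℂ) ≠ 0) {T : Hol →ₗ[ℂ] Dch}
    (hT : T ∈ FinOrder) (h0 : ∀ m, T (jz g m) = 0) : T = 0 := by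
  refine LinearMap.ext fun h => MvPolynomial.ext _ _ fun s => Hol.ext fun τ => ?_
  obtain ⟨N, hN⟩ := hT τ
  obtain ⟨r, hr, h1, rfl⟩ := exists_eq_add_tH_pow_mul hg τ h N
  have hr0 : T r = 0 := by
    induction hr using Submodule.span_induction with
    | mem x hx => obtain ⟨n, rfl⟩ := hx; exact h0 n
    | zero => exact map_zero T
    | add x y _ _ hx hy => rw [map_add, hx, hy, add_zero]
    | smul c x _ hx => rw [map_smul, hx, smul_zero]
  rw [map_add, hr0, zero_add]
  obtain ⟨q, hq⟩ := hN h1 s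
  rw [hq, pow_one]
  change ((τ : ℂ) - (τ : ℂ)) * q.1 τ = 0
  rw [sub_self, zero_mul]

theorem finOrder_of_lower {T : Hol →ₗ[ℂ] Dch} (k : ℕ)
    (h : ∀ τ M f, tH τ ^ (M + k) ∣ f → T f ∈ vanish τ M) : T ∈ FinOrder := fun τ =>
  ⟨1 + k, fun _ => h τ 1 _ (dvd_mul_right _ _)⟩

theorem ofHol_vanish {τ : ℍ} {M : ℕ} {f : Hol} (hf : tH τ ^ M ∣ f) : ofHol f ∈ vanish τ M :=
  fun s => by
    classical
    rw [ofHol, MvPolynomial.coeff_C]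
    split_ifs
    · exact hf
    · exact dvd_zero _

theorem dvd_dHol_pow {τ : ℍ} {M k : ℕ} {f : Hol} (h : tH τ ^ (M + k) ∣ f) :
    tH τ ^ M ∣ (dHol ^ k) f := by
  induction k generalizing M with
  | zero => exact h
  | succ k ih =>
    rw [pow_succ', Module.End.mul_apply]
    exact dvd_dHol (ih (by rwa [show M + 1 + k = M + (k + 1) by ring]))

theorem dvd_theta_pow {τ : ℍ} {M k : ℕ} {f : Hol} (γ δ : ℂ) (h : tH τ ^ (M + k) ∣ f) :
    tH τ ^ M ∣ (theta γ δ ^ k) f := by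
  induction k generalizing M with
  | zero => exact h
  | succ k ih =>
    rw [pow_succ', Module.End.mul_apply, theta_apply]
    exact (dvd_dHol (ih (by rwa [show M + 1 + k = M + (k + 1) by ring]))).mul_left _

theorem monomial_vanish {τ : ℍ} {M : ℕ} {f : Hol} (hf : tH τ ^ M ∣ f) (s : ℕ+ ⊕ ℕ+ →₀ ℕ) :
    MvPolynomial.monomial s f ∈ vanish τ M := fun t => by
  classical
  rw [MvPolynomial.coeff_monomial]
  split_ifs
  · exact hf
  · exact dvd_zero _

theorem liftL_vanish (g : SL(2, ℝ)) (x : Ptn × Ptn) {τ : ℍ} {M : ℕ} {f : Hol}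
    (hf : tH τ ^ (M + (parts x.1).length) ∣ f) : liftL g x f ∈ vanish τ M := by
  have hA : ∀ (l : List ℕ+) (M : ℕ) (w : Dch), w ∈ vanish τ (M + l.length) →
      (l.map (piAop (g 1 0 : ℂ) (g 1 1 : ℂ))).prod w ∈ vanish τ M := by
    intro l
    induction l with
    | nil => exact fun M w hw => hw
    | cons n l ih =>
      intro M w hw
      rw [List.map_cons, List.prod_cons, Module.End.mul_apply]
      refine piAop_vanish _ _ _ (ih _ _ ?_)
      rwa [List.length_cons, ← add_assoc, add_right_comm] at hw
  exact hA _ _ _ (mul_vanish _ (ofHol_vanish hf))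

theorem tilL_finOrder (g : SL(2, ℝ)) (x : Ptn × Ptn) (k : ℕ) : tilL g x k ∈ FinOrder :=
  finOrder_of_lower ((parts x.1).length + k) fun _ _ _ hf =>
    liftL_vanish g x (dvd_theta_pow _ _ (by rwa [add_assoc]))

theorem actL_mul_finOrder (x : Ptn × Ptn) (k : ℕ) (φ : Hol) :
    actL x k ∘ₗ LinearMap.mulLeft ℂ φ ∈ FinOrder :=
  finOrder_of_lower k fun _ _ _ hf =>
    monomial_vanish (dvd_dHol_pow (Dvd.dvd.mul_left hf φ)) _

/-! ### The chain rule -/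

theorem pull_dHol (g : SL(2, ℝ)) (f : Hol) :
    pull g (dHol f) = theta (g 1 0 : ℂ) (g 1 1 : ℂ) (pull g f) := by
  refine Hol.ext fun τ => ?_
  have hdet : 0 < (g : GL (Fin 2) ℝ).val.det := by simp
  have h1 := (UpperHalfPlane.hasStrictDerivAt_smul hdet τ).hasDerivAt
  have h2 := (UpperHalfPlane.mdifferentiableAt_iff.mp
    ((f.2 : MDiff f.1) ((g : GL (Fin 2) ℝ) • τ))).hasDerivAt
  have e : (((g : GL (Fin 2) ℝ) • UpperHalfPlane.ofComplex (τ : ℂ) : ℍ) : ℂ) =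
      (((g : GL (Fin 2) ℝ) • τ : ℍ) : ℂ) := by rw [UpperHalfPlane.ofComplex_apply]
  rw [← e] at h2
  have h3 := (h2.comp (τ : ℂ) h1).deriv
  have e2 : ((f.1 ∘ UpperHalfPlane.ofComplex) ∘ fun z : ℂ =>
      (((g : GL (Fin 2) ℝ) • UpperHalfPlane.ofComplex z : ℍ) : ℂ)) =
      (pull g f).1 ∘ UpperHalfPlane.ofComplex := by
    funext z
    simp only [Function.comp_apply, UpperHalfPlane.ofComplex_apply]
    rfl
  rw [e2, e] at h3
  change deriv (f.1 ∘ UpperHalfPlane.ofComplex) ((((g : GL (Fin 2) ℝ) • τ : ℍ)) : ℂ) =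
    ((g 1 0 : ℂ) * (τ : ℂ) + (g 1 1 : ℂ) * 1) ^ 2 *
      deriv ((pull g f).1 ∘ UpperHalfPlane.ofComplex) (τ : ℂ)
  have hj : UpperHalfPlane.denom (g : GL (Fin 2) ℝ) (τ : ℂ) =
      (g 1 0 : ℂ) * (τ : ℂ) + (g 1 1 : ℂ) * 1 := by
    rw [mul_one]; rfl
  have hj0 := UpperHalfPlane.denom_ne_zero (g : GL (Fin 2) ℝ) τ
  rw [h3, ← hj]
  have hd1 : (g : GL (Fin 2) ℝ).val.det = 1 := by simp
  rw [hd1]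
  field_simp
  push_cast
  ring

theorem pull_dHol_pow (g : SL(2, ℝ)) (k : ℕ) (f : Hol) :
    pull g ((dHol ^ k) f) = (theta (g 1 0 : ℂ) (g 1 1 : ℂ) ^ k) (pull g f) := by
  induction k with
  | zero => rfl
  | succ k ih =>
    rw [pow_succ', pow_succ', Module.End.mul_apply, Module.End.mul_apply, pull_dHol, ih]

theorem piAct_actL (g : SL(2, ℝ)) (x : Ptn × Ptn) (k : ℕ) (f : Hol) :
    piAct g (actL x k f) = tilL g x k (pull g f) := by
  change piAct g (MvPolynomial.monomial (expo x) ((dHol ^ k) f)) = _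
  rw [piAct_monomial, pull_dHol_pow]
  rfl

theorem Gop_zero_tilL (g : SL(2, ℝ)) (hg : (g 1 0 : ℂ) ≠ 0) (x : Ptn × Ptn) (k : ℕ) (h : Hol) :
    Gop aOp bOp (g 1 0 : ℂ) (g 1 1 : ℂ) 0 (tilL g x k h) =
      tilL g x k (theta (g 1 0 : ℂ) (g 1 1 : ℂ) h) := by
  have e : (theta (g 1 0 : ℂ) (g 1 1 : ℂ) ^ k) (theta (g 1 0 : ℂ) (g 1 1 : ℂ) h) =
      theta (g 1 0 : ℂ) (g 1 1 : ℂ) ((theta (g 1 0 : ℂ) (g 1 1 : ℂ) ^ k) h) := by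
    rw [← Module.End.mul_apply, ← Module.End.mul_apply, ← pow_succ, ← pow_succ']
  change Gop _ _ _ _ 0 (liftL g x _) = liftL g x _
  rw [Gop_zero_liftL g hg, e, theta_apply]

/-! ### The lower triangular entry zero -/

theorem Gop_gamma_zero (δ : ℂ) (n : ℤ) : Gop aOp bOp 0 δ n = δ ^ 2 • aOp n := by
  have hj : ∀ m, jop bOp 0 δ m = if m = 0 then δ • 1 else 0 := fun m => by
    rw [jop, zero_smul, zero_add]; split_ifs <;> simp
  classical
  have e : (fun p : ℤ × ℤ => nrm aOp p.1 (jop bOp 0 δ p.2 * jop bOp 0 δ (n - p.1 - p.2))) =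
      fun p => if p = (n, 0) then δ ^ 2 • aOp n else 0 := by
    funext p
    obtain ⟨i, k⟩ := p
    rw [hj, hj]
    by_cases hk : k = 0
    · by_cases hi : i = n
      · subst hk hi
        simp only [sub_self, if_pos]
        unfold nrm
        split_ifs
        · rw [smul_mul_smul_comm, mul_one, mul_smul_comm, mul_one, sq]
        · rw [smul_mul_smul_comm, mul_one, smul_mul_assoc, one_mul, sq]
      · have h1 : n - i - k ≠ 0 := by omega
        have h2 : (i, k) ≠ (n, 0) := fun h => hi (Prod.mk.inj h).1
        simp only [if_neg h1, if_neg h2, mul_zero, nrm_zero]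
    · have h2 : (i, k) ≠ (n, 0) := fun h => hk (Prod.mk.inj h).2
      simp only [if_neg hk, if_neg h2, zero_mul, nrm_zero]
  rw [Gop, e, lsum_single]

theorem liftL_gamma_zero {g : SL(2, ℝ)} (hg : (g 1 0 : ℂ) = 0) (x : Ptn × Ptn) (φ : Hol) :
    liftL g x φ = MvPolynomial.monomial (expo x) (jz g (2 * ldiff x) * φ) := by
  have hj1 : jz g 1 = (g 1 1 : ℂ) • 1 := by rw [jz_one, jHol, hg, zero_smul, zero_add]
  have hj2 : jz g 2 = (g 1 1 : ℂ) ^ 2 • 1 := by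
    rw [← one_add_one_eq_two, jz_add, hj1, smul_mul_smul_comm, one_mul, sq]
  have hA : ∀ n w, piAop (g 1 0 : ℂ) (g 1 1 : ℂ) n w =
      MvPolynomial.X (Sum.inl n) * (MvPolynomial.C (jz g 2) * w) := by
    intro n w
    rw [piAop, hg, Gop_gamma_zero, hj2, LinearMap.add_apply, LinearMap.smul_apply, aOp_neg,
      zero_pow two_ne_zero, mul_zero, zero_smul, LinearMap.zero_apply, add_zero, mulOp_apply,
      smul_eq_cst, cst, Algebra.algebraMap_eq_smul_one]
    ring
  have hB : ∀ n, piB g n = MvPolynomial.X (Sum.inr n) * MvPolynomial.C (jz g (-2)) := by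
    intro n
    have hn := n.pos
    rw [piB, Finset.sum_eq_single (Composition.single (n : ℕ) hn)]
    · rw [Composition.single_length, Composition.single_blocks, List.map_singleton,
        List.prod_singleton, Nat.sub_self, pow_zero, one_smul, mul_comm, ← jz_neg_one,
        show (-2 : ℤ) = -1 + -1 by norm_num, jz_add, ← sq]
      congr 3
      simp
    · intro c _ hc
      have h1 : c.length - 1 ≠ 0 := by
        intro h
        have h2 := c.length_pos_of_pos hn
        exact hc ((Composition.eq_single_iff_length hn).2 (by omega))
      rw [hg, neg_zero, zero_pow h1, zero_smul, map_zero, zero_mul]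
    · exact fun h => absurd (Finset.mem_univ _) h
  have hBs : ∀ s : Ptn, (s.map (piB g)).prod * MvPolynomial.C φ =
      MvPolynomial.monomial (expo (0, s)) (jz g (2 * ldiff (0, s)) * φ) := by
    intro s
    induction s using Multiset.induction_on with
    | empty =>
      have e0 : ldiff (0, 0) = 0 := rfl
      rw [Multiset.map_zero, Multiset.prod_zero, one_mul, expo_zero, e0, mul_zero, jz_zero, one_mul]
      rfl
    | cons n s ih =>
      have e0 : ldiff (0, n ::ₘ s) = ldiff (0, s) - 1 := by
        simp only [ldiff, Multiset.card_cons]; push_cast; ring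
      rw [Multiset.map_cons, Multiset.prod_cons, mul_assoc, ih, hB, mul_assoc,
        X_mul_C_mul_monomial, expo_cons_snd, e0, ← mul_assoc, ← jz_add]
      congr 3
      ring
  have hAs : ∀ l : List ℕ+, (l.map (piAop (g 1 0 : ℂ) (g 1 1 : ℂ))).prod
      (MvPolynomial.monomial (expo (0, x.2)) (jz g (2 * ldiff (0, x.2)) * φ)) =
      MvPolynomial.monomial (expo (l, x.2)) (jz g (2 * ldiff (l, x.2)) * φ) := by
    intro l
    induction l with
    | nil => rfl
    | cons n l ih =>
      have e0 : ldiff ((n :: l : List ℕ+), x.2) = ldiff (l, x.2) + 1 := by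
        simp only [ldiff, Multiset.coe_card, List.length_cons]; push_cast; ring
      rw [List.map_cons, List.prod_cons, Module.End.mul_apply, ih, hA,
        X_mul_C_mul_monomial, ← Multiset.cons_coe, expo_cons_fst, Multiset.cons_coe, e0,
        ← mul_assoc, ← jz_add]
      congr 3
      ring
  have h := hAs (parts x.1)
  rw [← hBs] at h
  have e : ((parts x.1 : List ℕ+) : Ptn) = x.1 := Multiset.sort_eq _ _
  rw [e] at h
  exact h

theorem dHol_jz_mul {g : SL(2, ℝ)} (hg : (g 1 0 : ℂ) = 0) (n : ℤ) (k : ℕ) (h : Hol) :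
    (dHol ^ k) (jz g n * h) = jz g n * (dHol ^ k) h := by
  induction k with
  | zero => rfl
  | succ k ih =>
    rw [pow_succ', Module.End.mul_apply, ih, dHol_mul, dHol_jz, hg, mul_zero, zero_smul, zero_mul,
      add_zero, Module.End.mul_apply]

theorem tilL_gamma_zero {g : SL(2, ℝ)} (hg : (g 1 0 : ℂ) = 0) (x : Ptn × Ptn) (k : ℕ) (h : Hol) :
    tilL g x k h = actL x k (jz g (2 * (ldiff x + k)) * h) := by
  have hk : (theta (g 1 0 : ℂ) (g 1 1 : ℂ) ^ k) h = jz g (2 * k) * (dHol ^ k) h := by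
    induction k with
    | zero => rw [Nat.cast_zero, mul_zero, jz_zero, one_mul]; rfl
    | succ k ih =>
      have e : (dHol ^ (k + 1)) h = dHol ((dHol ^ k) h) := by
        rw [pow_succ', Module.End.mul_apply]
      rw [pow_succ', Module.End.mul_apply, ih, theta_apply, dHol_mul, dHol_jz, ← jz_two, hg,
        mul_zero, zero_smul, zero_mul, add_zero, e, ← mul_assoc, ← jz_add]
      congr 2
      push_cast
      ring
  change liftL g x _ = MvPolynomial.monomial (expo x) _
  rw [liftL_gamma_zero hg, hk, ← mul_assoc, ← jz_add, dHol_jz_mul hg]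
  congr 3
  ring

/-! ### Transformation of the vectors `A f` -/

/-- The pairing `(A, f) ↦ A f` as a bilinear map. -/
def applyL : Q →ₗ[ℂ] Hol →ₗ[ℂ] Dch :=
  LinearMap.mk₂ ℂ applyOp (fun A B f => by simp [applyOp, map_add])
    (fun c A f => by simp [applyOp, map_smul])
    (fun A f h => by
      induction A using Submodule.Quotient.induction_on with
      | _ u =>
        change act u (ofHolL (f + h)) = act u (ofHolL f) + act u (ofHolL h)
        rw [map_add, map_add])
    (fun c A f => by
      induction A using Submodule.Quotient.induction_on with
      | _ u =>
        change act u (ofHolL (c • f)) = c • act u (ofHolL f)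
        rw [map_smul, map_smul])

theorem applyL_mk (u : U) (f : Hol) : applyL (mk u) f = act u (ofHol f) := rfl

theorem ofHol_D0 (f : Hol) : aOp 0 (ofHol f) = ofHol (dHol f) := by
  rw [aOp_zero]; exact D0_C f

theorem X_mul_monomial (i : ℕ+ ⊕ ℕ+) (f : Hol) (s : ℕ+ ⊕ ℕ+ →₀ ℕ) :
    (MvPolynomial.X i * MvPolynomial.monomial s f : Dch) =
      MvPolynomial.monomial (s + Finsupp.single i 1) f := by
  rw [MvPolynomial.X, MvPolynomial.monomial_mul, one_mul, add_comm]

theorem applyL_mono (s : Idx) (f : Hol) :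
    applyL (mk (mono s)) f = actL s.pr s.k (coordH ^ s.l * f) := by
  have h0 : ∀ l, (aOp 0 ^ s.k) ((bOp 0 ^ l) (ofHol f)) =
      ofHol ((dHol ^ s.k) (coordH ^ l * f)) := by
    intro l
    have hb : (bOp 0 ^ l) (ofHol f) = ofHol (coordH ^ l * f) := by
      induction l with
      | zero => rw [pow_zero, pow_zero, one_mul]; rfl
      | succ l ih =>
        rw [pow_succ', Module.End.mul_apply, ih, bOp_zero, mulOp_apply, ofHol, ofHol, ← map_mul,
          pow_succ', mul_assoc]
    rw [hb]
    induction s.k with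
    | zero => rfl
    | succ k ih =>
      rw [pow_succ', Module.End.mul_apply, ih, ofHol_D0, pow_succ', Module.End.mul_apply]
  have hb : ∀ (l : List ℕ+) (φ : Hol), (l.map fun n : ℕ+ => bOp (-(n : ℤ))).prod (ofHol φ) =
      MvPolynomial.monomial (expo (0, (l : Ptn))) φ := by
    intro l φ
    induction l with
    | nil => rw [Multiset.coe_nil, expo_zero]; rfl
    | cons n l ih =>
      rw [List.map_cons, List.prod_cons, Module.End.mul_apply, ih, bOp_neg, mulOp_apply,
        X_mul_monomial, ← Multiset.cons_coe, expo_cons_snd]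
  have ha : ∀ (l : List ℕ+) (m : Ptn) (φ : Hol), (l.map fun n : ℕ+ => aOp (-(n : ℤ))).prod
      (MvPolynomial.monomial (expo (0, m)) φ) = MvPolynomial.monomial (expo ((l : Ptn), m)) φ := by
    intro l m φ
    induction l with
    | nil => rfl
    | cons n l ih =>
      rw [List.map_cons, List.prod_cons, Module.End.mul_apply, ih, aOp_neg, mulOp_apply,
        X_mul_monomial, ← Multiset.cons_coe, expo_cons_fst]
  have e : ∀ l : Ptn, ((parts l : List ℕ+) : Ptn) = l := fun l => Multiset.sort_eq _ _
  rw [applyL_mk, mono, map_mul, map_mul, map_mul, map_pow, map_pow, map_list_prod, map_list_prod,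
    List.map_map, List.map_map, act_a, act_b, Module.End.mul_apply, Module.End.mul_apply,
    Module.End.mul_apply, h0]
  have e1 : (act ∘ fun n : ℕ+ => a (-(n : ℤ))) = fun n : ℕ+ => aOp (-(n : ℤ)) :=
    funext fun n => act_a _
  have e2 : (act ∘ fun n : ℕ+ => b (-(n : ℤ))) = fun n : ℕ+ => bOp (-(n : ℤ)) :=
    funext fun n => act_b _
  rw [e1, e2, hb, ha, e, e]
  rfl

/-- The span of the basis elements `a_{-λ} b_{-μ} a_0^k` with `l(λ, μ) + k = l`. -/
def Slab (l : ℤ) : Submodule ℂ Q :=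
  Submodule.span ℂ {q | ∃ (y : Ptn × Ptn) (k : ℕ), ldiff y + k = l ∧ q = mk (mono ⟨y, k, 0⟩)}

theorem applyL_mono_zero (y : Ptn × Ptn) (k : ℕ) : applyL (mk (mono ⟨y, k, 0⟩)) = actL y k := by
  refine LinearMap.ext fun f => ?_
  rw [applyL_mono]
  simp only
  rw [pow_zero, one_mul]

/-- For `A` in `Slab l` the transformed vectors `π(g) (A f)` are the values `T (f(g b))` of a linear
map `T` that intertwines `j ^ 2 d/db` with the zero mode of `a j ^ 2`, and that is comparable with
`h ↦ A (j ^ (2 l) h)`: the difference is of finite order, and of lower order on the powers of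
`j`. -/
theorem exists_tilde {g : SL(2, ℝ)} (hg : (g 1 0 : ℂ) ≠ 0) {l : ℤ} {A : Q} (hA : A ∈ Slab l) :
    ∃ T : Hol →ₗ[ℂ] Dch, T - applyL A ∘ₗ LinearMap.mulLeft ℂ (jz g (2 * l)) ∈ FinOrder ∧
      (∀ f, piAct g (applyL A f) = T (pull g f)) ∧
      (∀ h, Gop aOp bOp (g 1 0 : ℂ) (g 1 1 : ℂ) 0 (T h) =
        T (theta (g 1 0 : ℂ) (g 1 1 : ℂ) h)) ∧
      (fun m : ℤ => T (jz g m) - applyL A (jz g (m + 2 * l))) ∈ Fam g (l - 1) l := by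
  induction hA using Submodule.span_induction with
  | mem x hx =>
    obtain ⟨y, k, hk, rfl⟩ := hx
    rw [applyL_mono_zero]
    exact ⟨tilL g y k, sub_mem (tilL_finOrder g y k) (actL_mul_finOrder y k _),
      piAct_actL g y k, Gop_zero_tilL g hg y k, tilL_sub_actL_mem y k hk⟩
  | zero =>
    rw [map_zero]
    refine ⟨0, ?_, fun f => ?_, fun h => ?_, ?_⟩
    · rw [LinearMap.zero_comp, sub_zero]; exact zero_mem _
    · rw [LinearMap.zero_apply, LinearMap.zero_apply]
      simpa using piAct_smul g 0 0
    · rw [LinearMap.zero_apply, LinearMap.zero_apply, map_zero]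
    · simp only [LinearMap.zero_apply, sub_zero]
      exact zero_mem _
  | add A B _ _ hA hB =>
    obtain ⟨T, h1, h2, h3, h4⟩ := hA
    obtain ⟨S, h1', h2', h3', h4'⟩ := hB
    rw [map_add]
    refine ⟨T + S, ?_, fun f => ?_, fun h => ?_, ?_⟩
    · rw [LinearMap.add_comp, add_sub_add_comm]; exact add_mem h1 h1'
    · rw [LinearMap.add_apply, LinearMap.add_apply, piAct_add, h2, h2']
    · rw [LinearMap.add_apply, LinearMap.add_apply, map_add, h3, h3']
    · refine cast (congrArg (· ∈ Fam g _ _) (funext fun m => ?_)) (add_mem h4 h4')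
      simp only [Pi.add_apply, LinearMap.add_apply]
      abel
  | smul c A _ hA =>
    obtain ⟨T, h1, h2, h3, h4⟩ := hA
    rw [map_smul]
    refine ⟨c • T, ?_, fun f => ?_, fun h => ?_, ?_⟩
    · have := FinOrder.smul_mem c h1
      rwa [smul_sub, ← LinearMap.smul_comp] at this
    · rw [LinearMap.smul_apply, LinearMap.smul_apply, piAct_smul, h2]
    · rw [LinearMap.smul_apply, LinearMap.smul_apply, map_smul, h3]
    · refine cast (congrArg (· ∈ Fam g _ _) (funext fun m => ?_)) ((Fam g _ _).smul_mem c h4)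
      simp only [Pi.smul_apply, LinearMap.smul_apply, smul_sub]

/-- The key step: if the zero mode of `a j ^ 2` acts on the vectors `A f` as
`f ↦ j ^ 2 f' - 2 l γ j f`, then `π(g) (A f) = A (j ^ (2 l) f(g b))`. -/
theorem piAct_applyL (g : SL(2, ℝ)) {l : ℤ} {A : Q} (hA : A ∈ Slab l)
    (h : ∀ f, Gop aOp bOp (g 1 0 : ℂ) (g 1 1 : ℂ) 0 (applyL A f) =
      applyL A (theta (g 1 0 : ℂ) (g 1 1 : ℂ) f -
        (2 * (l : ℂ) * (g 1 0 : ℂ)) • (jHol (g 1 0 : ℂ) (g 1 1 : ℂ) * f))) (f : Hol) :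
    piAct g (applyL A f) = applyL A (jz g (2 * l) * pull g f) := by
  by_cases hg : (g 1 0 : ℂ) = 0
  · clear h
    induction hA using Submodule.span_induction generalizing f with
    | mem x hx =>
      obtain ⟨y, k, hk, rfl⟩ := hx
      rw [applyL_mono_zero, piAct_actL, tilL_gamma_zero hg, hk]
    | zero =>
      rw [map_zero, LinearMap.zero_apply, LinearMap.zero_apply]
      simpa using piAct_smul g 0 0
    | add A B _ _ hA hB =>
      rw [map_add, LinearMap.add_apply, LinearMap.add_apply, piAct_add, hA, hB]
    | smul c A _ hA =>
      rw [map_smul, LinearMap.smul_apply, LinearMap.smul_apply, piAct_smul, hA]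
  · obtain ⟨T, h1, h2, h3, h4⟩ := exists_tilde hg hA
    have h5 := fam_eq_zero hg h4 fun m => by
      rw [map_sub, h3, h, theta_jz, theta_jz, ← jz_one, ← jz_add, map_smul,
        add_comm 1 (m + 2 * l), ← sub_smul, map_smul, smul_sub, add_right_comm m 1 (2 * l)]
      congr 2
      push_cast
      ring
    have h6 := eq_zero_of_finOrder hg h1 fun m => by
      have := congrFun h5 m
      rw [add_comm, jz_add] at this
      exact this
    rw [h2, sub_eq_zero.1 h6]
    rfl

/-! ### The Heisenberg module `𝒰 / K` -/

/-- Left multiplication on `𝒰 / K`. -/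
def lQ : U →ₐ[ℂ] Module.End ℂ Q := Algebra.lsmul ℂ ℂ Q

/-- Left multiplication by `a_n`. -/
def aQ (n : ℤ) : Module.End ℂ Q := lQ (a n)

/-- Left multiplication by `b_n`. -/
def bQ (n : ℤ) : Module.End ℂ Q := lQ (b n)

theorem lQ_mk (v u : U) : lQ v (mk u) = mk (v * u) := rfl

theorem mk_eq_zero {u : U} : mk u = 0 ↔ u ∈ K := Submodule.Quotient.mk_eq_zero K

theorem mk_surjective : Function.Surjective mk := Submodule.Quotient.mk_surjective K

theorem mk_add (u v : U) : mk (u + v) = mk u + mk v := rfl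

theorem mk_sub (u v : U) : mk (u - v) = mk u - mk v := rfl

theorem mk_smul (c : ℂ) (u : U) : mk (c • u) = c • mk u := rfl

theorem heisQ : Heis aQ bQ where
  aa m n := by rw [aQ, aQ, ← map_mul, a_comm, map_mul]
  bb m n := by rw [bQ, bQ, ← map_mul, b_comm, map_mul]
  ab m n := by
    rw [aQ, bQ, ← map_mul, ab_comm, map_add, map_mul]
    split_ifs <;> simp
  loc q := by
    obtain ⟨v, rfl⟩ := mk_surjective q
    obtain ⟨N, hN⟩ := exists_bound v
    exact ⟨N, fun n hn => ⟨mk_eq_zero.2 (hN n hn).1, mk_eq_zero.2 (hN n hn).2⟩⟩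

theorem jop_one_zero {W : Type*} [AddCommGroup W] [Module ℂ W] (β : ℤ → Module.End ℂ W) (m : ℤ) :
    jop β 1 0 m = β m := by simp [jop]

theorem Heis.Pop_apply {W : Type*} [AddCommGroup W] [Module ℂ W] {α β : ℤ → Module.End ℂ W}
    (H : Heis α β) (q : W) : Pop α β 1 0 0 q = β 0 (α 0 q) + chg α β q := by
  rw [H.Pop_zero, jop_one_zero, one_smul]; rfl

theorem Heis.Gop_apply {W : Type*} [AddCommGroup W] [Module ℂ W] {α β : ℤ → Module.End ℂ W}
    (H : Heis α β) (q : W) : Gop α β 1 0 0 q =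
      β 0 (β 0 (α 0 q)) + (2 : ℂ) • β 0 (chg α β q) + Rop α β 1 0 q := by
  rw [H.Gop_zero, jop_one_zero, mul_one]; rfl

theorem lQ_nord (i : ℤ) (x : U) : lQ (nord i x) = nrm aQ i (lQ x) := by
  unfold nord nrm
  split_ifs <;> rw [map_mul] <;> rfl

theorem hTerm_mem_K {i : ℤ} (hi : i ≠ 0) : hTerm i ∈ K := by
  refine mul_mem_K _ ?_
  unfold nord
  split_ifs
  · exact mul_mem_K _ (b_mem_K (by omega))
  · exact mul_mem_K _ (a_mem_K (by omega))

theorem fTerm_mem_K {p : ℤ × ℤ} (hp : p ≠ (0, 0)) : fTerm p ∈ K := by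
  obtain ⟨i, j⟩ := p
  have hb : ∀ m n : ℤ, 1 ≤ m ∨ 1 ≤ n → b m * b n ∈ K := by
    rintro m n (h | h)
    · rw [b_comm]; exact mul_mem_K _ (b_mem_K h)
    · exact mul_mem_K _ (b_mem_K h)
  simp only [fTerm]
  unfold nord
  split_ifs with h0
  · exact mul_mem_K _ (hb _ _ (by omega))
  · by_cases hi : 1 ≤ i
    · exact mul_mem_K _ (a_mem_K hi)
    · obtain rfl : i = 0 := by omega
      have hj : j ≠ 0 := fun h => hp (by rw [h])
      rw [mul_assoc, ← ab_swap (by omega), ← mul_assoc, ← ab_swap (by omega), mul_assoc]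
      exact mul_mem_K _ (hb _ _ (by omega))

theorem adj_mk {ι : Type} {w : ι → U} (hfin : ∀ v, {i | w i * v ∉ K}.Finite)
    (hK : ∀ i, ∀ u ∈ K, w i * u - u * w i ∈ K) (i₀ : ι) (h : ∀ i, i ≠ i₀ → w i ∈ K) (u : U) :
    adj w hfin hK (mk u) = lsum (fun i => lQ (w i)) (mk u) - mk (u * w i₀) := by
  classical
  have hl : LocFin fun i => lQ (w i) := fun q => by
    obtain ⟨v, rfl⟩ := mk_surjective q
    exact (hfin v).subset fun i hi hc => hi (mk_eq_zero.2 hc)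
  have e : (fun i => mk (u * w i)) = fun i => if i = i₀ then mk (u * w i₀) else 0 := by
    funext i
    split_ifs with hi
    · rw [hi]
    · exact mk_eq_zero.2 (mul_mem_K _ (h i hi))
  have hs : (Function.support fun i => mk (u * w i)).Finite := by
    rw [e]
    exact (Set.finite_singleton i₀).subset fun i hi => by
      by_contra hc
      exact hi (if_neg hc)
  rw [lsum_apply hl]
  have e2 : mk (u * w i₀) = ∑ᶠ i, mk (u * w i) := by
    rw [e, finsum_eq_single _ i₀ fun i hi => if_neg hi, if_pos rfl]
  rw [e2]
  exact finsum_sub_distrib (hl (mk u)) hs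

theorem neg_two_mul_eq {R : Type*} [Ring R] [Algebra ℂ R] (x : R) : -2 * x = (-2 : ℂ) • x := by
  rw [neg_mul, neg_smul, two_mul, two_smul]

theorem hTerm_eq (i : ℤ) : hTerm i = (-2 : ℂ) • nord i (b (-i)) := by
  exact neg_two_mul_eq _

theorem adH_mk (u : U) :
    adH (mk u) = (-2 : ℂ) • (Pop aQ bQ 1 0 0 (mk u) - mk (u * (b 0 * a 0))) := by
  have e : (fun i => lQ (hTerm i)) = fun i => (-2 : ℂ) • nrm aQ i (jop bQ 1 0 (0 - i)) := by
    funext i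
    rw [hTerm_eq, map_smul, lQ_nord, jop_one_zero, zero_sub]
    rfl
  have e0 : u * hTerm 0 = (-2 : ℂ) • (u * (b 0 * a 0)) := by
    rw [hTerm_eq, nord, if_neg (lt_irrefl _), neg_zero, mul_smul_comm]
  rw [adH, adj_mk _ _ 0 (fun i hi => hTerm_mem_K hi), e, lsum_smul _ (heisQ.locFin_Pop 0),
    LinearMap.smul_apply, e0, mk_smul, ← smul_sub]
  rfl

theorem adF_mk (u : U) :
    adF (mk u) = Gop aQ bQ 1 0 0 (mk u) - mk (u * (b 0 * b 0 * a 0)) := by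
  have e : (fun p => lQ (fTerm p)) = fun p : ℤ × ℤ =>
      nrm aQ p.1 (jop bQ 1 0 p.2 * jop bQ 1 0 (0 - p.1 - p.2)) := by
    funext p
    rw [fTerm, lQ_nord, jop_one_zero, jop_one_zero, zero_sub, map_mul]
    rfl
  have e0 : fTerm (0, 0) = b 0 * b 0 * a 0 := by
    rw [fTerm, nord, if_neg (lt_irrefl _), neg_zero, sub_zero]
  rw [adF, adj_mk _ _ (0, 0) (fun i hi => fTerm_mem_K hi), e, e0]
  rfl

/-! ### Multiplication of the basis elements by modes -/

/-- The element `a_{-λ} b_{-μ}` of `𝒰`. -/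
def wU (y : Ptn × Ptn) : U :=
  ((parts y.1).map (fun n : ℕ+ => a (-(n : ℤ)))).prod *
  ((parts y.2).map (fun n : ℕ+ => b (-(n : ℤ)))).prod

theorem mono_eq (y : Ptn × Ptn) (k l : ℕ) : mono ⟨y, k, l⟩ = wU y * a 0 ^ k * b 0 ^ l := rfl

theorem parts_cons_perm (n : ℕ+) (l : Ptn) : (parts (n ::ₘ l)).Perm (n :: parts l) := by
  rw [← Multiset.coe_eq_coe, ← Multiset.cons_coe]
  change ((Multiset.sort (n ::ₘ l) (· ≥ ·) : List ℕ+) : Multiset ℕ+) =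
    n ::ₘ ((Multiset.sort l (· ≥ ·) : List ℕ+) : Multiset ℕ+)
  rw [Multiset.sort_eq, Multiset.sort_eq]

theorem prod_parts_cons {f : ℕ+ → U} (hf : ∀ m n, f m * f n = f n * f m) (n : ℕ+) (l : Ptn) :
    ((parts (n ::ₘ l)).map f).prod = f n * ((parts l).map f).prod := by
  have h := ((parts_cons_perm n l).map f).prod_eq' (by
    rw [List.pairwise_map]
    exact List.pairwise_of_forall fun x y => hf x y)
  rw [h, List.map_cons, List.prod_cons]

theorem wU_zero : wU (0, 0) = 1 := by
  have : parts 0 = [] := by simp [parts]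
  rw [wU]
  simp only [this, List.map_nil, List.prod_nil, mul_one]

theorem wU_cons_fst (n : ℕ+) (l m : Ptn) : wU (n ::ₘ l, m) = a (-(n : ℤ)) * wU (l, m) := by
  rw [wU, wU, prod_parts_cons (fun _ _ => a_comm _ _), mul_assoc]

theorem wU_cons_snd (n : ℕ+) (l m : Ptn) : wU (l, n ::ₘ m) = b (-(n : ℤ)) * wU (l, m) := by
  have h : Commute (b (-(n : ℤ))) ((parts l).map fun n : ℕ+ => a (-(n : ℤ))).prod := by
    refine Commute.list_prod_right _ _ fun x hx => ?_
    obtain ⟨i, _, rfl⟩ := List.mem_map.1 hx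
    have h1 := i.pos
    have h2 := n.pos
    exact (ab_swap (by omega)).symm
  rw [wU, wU, prod_parts_cons (fun _ _ => b_comm _ _)]
  simp only
  rw [← mul_assoc, ← mul_assoc, h.eq]

theorem ptnPair_induction {P : Ptn × Ptn → Prop} (h0 : P (0, 0))
    (hb : ∀ n m, P (0, m) → P (0, n ::ₘ m)) (ha : ∀ n l m, P (l, m) → P (n ::ₘ l, m))
    (y : Ptn × Ptn) : P y := by
  obtain ⟨l, m⟩ := y
  induction l using Multiset.induction_on with
  | empty =>
    induction m using Multiset.induction_on with
    | empty => exact h0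
    | cons n m ih => exact hb n m ih
  | cons n l ih => exact ha n l m ih

theorem wU_comm (y : Ptn × Ptn) : a 0 * wU y = wU y * a 0 ∧ b 0 * wU y = wU y * b 0 := by
  refine ptnPair_induction (P := fun y => a 0 * wU y = wU y * a 0 ∧ b 0 * wU y = wU y * b 0)
    ?_ (fun n m ih => ?_) (fun n l m ih => ?_) y
  · rw [wU_zero, mul_one, one_mul, mul_one, one_mul]; exact ⟨rfl, rfl⟩
  · have hn := n.pos
    rw [wU_cons_snd]
    exact ⟨Commute.mul_right (ab_swap (by omega)) ih.1, Commute.mul_right (b_comm _ _) ih.2⟩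
  · have hn := n.pos
    rw [wU_cons_fst]
    exact ⟨Commute.mul_right (a_comm _ _) ih.1,
      Commute.mul_right (ab_swap (by omega)).symm ih.2⟩

theorem a_mul_b : a 0 * b 0 = b 0 * a 0 + 1 := by rw [ab_comm, if_pos (by simp)]

section Weyl

variable {R : Type*} [Ring R] [Algebra ℂ R] {p q : R} (h : p * q = q * p + 1)
include h

theorem weyl_mul_pow (k : ℕ) : q * p ^ k = p ^ k * q - (k : ℂ) • p ^ (k - 1) := by
  rw [eq_sub_iff_add_eq, eq_comm]
  induction k with
  | zero => simp
  | succ k ih =>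
    rw [pow_succ, mul_assoc, h, mul_add, mul_one, ← mul_assoc, ih, add_mul, smul_mul_assoc,
      mul_assoc]
    rcases k with _ | k
    · simp
    · rw [Nat.add_sub_cancel, Nat.add_sub_cancel, ← pow_succ p k, Nat.cast_succ (k + 1), add_smul,
        one_smul, add_assoc]

theorem weyl_number_mul_pow_left (k : ℕ) :
    q * p * p ^ k = p ^ k * (q * p) - (k : ℂ) • p ^ k := by
  rw [mul_assoc, ← pow_succ', pow_succ, ← mul_assoc, ← mul_assoc, weyl_mul_pow h, sub_mul]
  rcases k with _ | k
  · simp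
  · rw [Nat.add_sub_cancel, smul_mul_assoc, ← pow_succ]

theorem weyl_number_mul_pow_right (l : ℕ) :
    q * p * q ^ l = q ^ l * (q * p) + (l : ℂ) • q ^ l := by
  induction l with
  | zero => simp
  | succ l ih =>
    rw [pow_succ, ← mul_assoc, ih, add_mul, mul_assoc, mul_assoc, h, mul_add, mul_one,
      mul_add, smul_mul_assoc, Nat.cast_succ, add_smul, one_smul, ← pow_succ, ← mul_assoc (q ^ l),
      ← pow_succ]
    abel

theorem weyl_number_comm {w : R} (hp : p * w = w * p) (hq : q * w = w * q) (k l : ℕ) :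
    q * (p * (w * p ^ k * q ^ l)) - w * p ^ k * q ^ l * (q * p) =
      ((l : ℂ) - k) • (w * p ^ k * q ^ l) := by
  have hw : q * p * w = w * (q * p) := by rw [mul_assoc, hp, ← mul_assoc, hq, mul_assoc]
  rw [← mul_assoc, ← mul_assoc (q * p), ← mul_assoc (q * p), hw, mul_assoc w,
    weyl_number_mul_pow_left h, mul_sub, sub_mul, ← mul_assoc w, mul_assoc (w * p ^ k),
    weyl_number_mul_pow_right h, mul_add, mul_smul_comm, mul_smul_comm, smul_mul_assoc,
    ← mul_assoc (w * p ^ k), sub_smul]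
  abel

/-- The commutator of `p ^ k` with `q ^ 2 p`, and the image of `p ^ k` under `q`. -/
theorem weyl_sq_comm {w : R} (hp : p * w = w * p) (hq : q * w = w * q) (k : ℕ) :
    q * (q * (p * (w * p ^ k))) - w * p ^ k * (q * q * p) =
      (-2 * (k : ℂ)) • (w * p ^ k * q) + ((k : ℂ) * (k + 1)) • (w * p ^ (k - 1)) := by
  have e1 : q * (q * (p * (w * p ^ k))) = w * (q * (q * p ^ (k + 1))) := by
    rw [pow_succ', ← mul_assoc p, hp, mul_assoc w, ← mul_assoc q w, hq, mul_assoc w,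
      ← mul_assoc q w, hq, mul_assoc w]
  have e2 : p ^ k * (q * q * p) = p ^ (k + 1) * q * q - (2 : ℂ) • (p ^ k * q) := by
    have : q * q * p = p * q * q - (2 : ℂ) • q := by
      have h' : q * p = p * q - 1 := eq_sub_iff_add_eq.2 h.symm
      rw [mul_assoc, h', mul_sub, ← mul_assoc, h', two_smul]
      noncomm_ring
    rw [this, mul_sub, mul_smul_comm, pow_succ]
    simp only [mul_assoc]
  have e3 : q * (q * p ^ (k + 1)) = p ^ (k + 1) * q * q - (2 * ((k : ℂ) + 1)) • (p ^ k * q) +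
      ((k : ℂ) * (k + 1)) • p ^ (k - 1) := by
    rw [weyl_mul_pow h, mul_sub, mul_smul_comm, ← mul_assoc, Nat.add_sub_cancel, weyl_mul_pow h,
      weyl_mul_pow h, sub_mul, Nat.add_sub_cancel, smul_mul_assoc]
    push_cast
    module
  rw [e1, mul_assoc w, e2, e3, ← mul_sub]
  trans w * ((-2 * (k : ℂ)) • (p ^ k * q) + ((k : ℂ) * (k + 1)) • p ^ (k - 1))
  · congr 1
    module
  · rw [mul_add, mul_smul_comm, mul_smul_comm, mul_assoc w]

end Weyl

theorem chg_mono (y : Ptn × Ptn) (k l : ℕ) :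
    chg aQ bQ (mk (mono ⟨y, k, l⟩)) = (-(ldiff y : ℂ)) • mk (mono ⟨y, k, l⟩) := by
  refine ptnPair_induction (P := fun y => chg aQ bQ (mk (mono ⟨y, k, l⟩)) =
    (-(ldiff y : ℂ)) • mk (mono ⟨y, k, l⟩)) ?_ (fun n m ih => ?_) (fun n l' m ih => ?_) y
  · have h1 := (heisQ.Gop_zero_vac (γ := 1) (δ := 0) (v := mk 1) fun n hn => ⟨by
      rw [aQ, lQ_mk, mul_one, mk_eq_zero]; exact a_mem_K hn, by
      rw [bQ, lQ_mk, mul_one, mk_eq_zero]; exact b_mem_K hn⟩).1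
    have e : mk (mono ⟨(0, 0), k, l⟩) = (aQ 0 ^ k) ((bQ 0 ^ l) (mk 1)) := by
      rw [mono_eq, wU_zero, one_mul, aQ, bQ, ← map_pow, ← map_pow, lQ_mk, lQ_mk, mul_one]
    have e0 : ldiff (0, 0) = 0 := rfl
    have ca : Commute (chg aQ bQ) (aQ 0) := sub_eq_zero.1 ((heisQ.chg_a 0).trans (if_pos rfl))
    have cb : Commute (chg aQ bQ) (bQ 0) := sub_eq_zero.1 ((heisQ.chg_b 0).trans (if_pos rfl))
    have := (ca.pow_right k).mul_right (cb.pow_right l)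
    have h2 := LinearMap.congr_fun this.eq (mk 1)
    rw [Module.End.mul_apply, Module.End.mul_apply, Module.End.mul_apply, h1, map_zero] at h2
    rw [e, e0, h2, Int.cast_zero, neg_zero]
    exact (zero_smul ℂ (A := Q) _).symm
  · have hn := n.pos
    have e0 : ldiff (0, n ::ₘ m) = ldiff (0, m) - 1 := by
      simp only [ldiff, Multiset.card_cons]; push_cast; ring
    have e : mk (mono ⟨(0, n ::ₘ m), k, l⟩) = bQ (-(n : ℤ)) (mk (mono ⟨(0, m), k, l⟩)) := by
      rw [mono_eq, mono_eq, wU_cons_snd, bQ, lQ_mk, mul_assoc, mul_assoc, mul_assoc]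
    have h := LinearMap.congr_fun (heisQ.chg_b (-(n : ℤ))) (mk (mono ⟨(0, m), k, l⟩))
    rw [if_neg (by omega), LinearMap.sub_apply, Module.End.mul_apply, Module.End.mul_apply, ih,
      map_smul, ← e, sub_eq_iff_eq_add] at h
    rw [h, e0]
    push_cast
    module
  · have hn := n.pos
    have e0 : ldiff (n ::ₘ l', m) = ldiff (l', m) + 1 := by
      simp only [ldiff, Multiset.card_cons]; push_cast; ring
    have e : mk (mono ⟨(n ::ₘ l', m), k, l⟩) = aQ (-(n : ℤ)) (mk (mono ⟨(l', m), k, l⟩)) := by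
      rw [mono_eq, mono_eq, wU_cons_fst, aQ, lQ_mk, mul_assoc, mul_assoc, mul_assoc]
    have h := LinearMap.congr_fun (heisQ.chg_a (-(n : ℤ))) (mk (mono ⟨(l', m), k, l⟩))
    rw [if_neg (by omega), LinearMap.sub_apply, Module.End.mul_apply, Module.End.mul_apply, ih,
      map_smul, LinearMap.neg_apply, ← e, sub_eq_iff_eq_add] at h
    rw [h, e0]
    push_cast
    module

/-- The basis elements are eigenvectors of `H_{(0)}`. -/
theorem adH_mono (y : Ptn × Ptn) (k l : ℕ) : adH (mk (mono ⟨y, k, l⟩)) =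
    ((2 * (ldiff y + k - l) : ℤ) : ℂ) • mk (mono ⟨y, k, l⟩) := by
  have e : b 0 * (a 0 * mono ⟨y, k, l⟩) - mono ⟨y, k, l⟩ * (b 0 * a 0) =
      ((l : ℂ) - k) • mono ⟨y, k, l⟩ :=
    weyl_number_comm a_mul_b (wU_comm y).1 (wU_comm y).2 k l
  have e1 : bQ 0 (aQ 0 (mk (mono ⟨y, k, l⟩))) = mk (mono ⟨y, k, l⟩ * (b 0 * a 0)) +
      ((l : ℂ) - k) • mk (mono ⟨y, k, l⟩) := by
    rw [← mk_smul, ← e, mk_sub, add_sub_cancel]; rfl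
  rw [adH_mk, heisQ.Pop_apply, chg_mono, e1]
  push_cast
  module

theorem mk_wU (y : Ptn × Ptn) (k : ℕ) : mk (mono ⟨y, k, 0⟩) = mk (wU y * a 0 ^ k) := by
  rw [mono_eq, pow_zero, mul_one]

/-- The action of `F_{(0)}` on the basis elements without `b_0`. -/
theorem adF_mono (y : Ptn × Ptn) (k : ℕ) : adF (mk (mono ⟨y, k, 0⟩)) =
    (-2 * ((ldiff y : ℂ) + k)) • mk (mono ⟨y, k, 1⟩) +
      ((k : ℂ) * (k + 1 + 2 * ldiff y)) • mk (mono ⟨y, k - 1, 0⟩) +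
      Rop aQ bQ 1 0 (mk (mono ⟨y, k, 0⟩)) := by
  have h1 : bQ 0 (bQ 0 (aQ 0 (mk (mono ⟨y, k, 0⟩)))) =
      mk (mono ⟨y, k, 0⟩ * (b 0 * b 0 * a 0)) + ((-2 * (k : ℂ)) • mk (mono ⟨y, k, 1⟩) +
        ((k : ℂ) * (k + 1)) • mk (mono ⟨y, k - 1, 0⟩)) := by
    have h := congrArg mk (weyl_sq_comm a_mul_b (wU_comm y).1 (wU_comm y).2 k)
    rw [mk_wU, mk_wU, mono_eq, mono_eq, pow_one, pow_zero, mul_one, ← mk_smul, ← mk_smul, ← mk_add, ← h, mk_sub,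
      add_sub_cancel]
    rfl
  have h2 : bQ 0 (mk (mono ⟨y, k, 0⟩)) =
      mk (mono ⟨y, k, 1⟩) - (k : ℂ) • mk (mono ⟨y, k - 1, 0⟩) := by
    have h : b 0 * (wU y * a 0 ^ k) =
        wU y * a 0 ^ k * b 0 - (k : ℂ) • (wU y * a 0 ^ (k - 1)) := by
      rw [← mul_assoc, (wU_comm y).2, mul_assoc, weyl_mul_pow a_mul_b, mul_sub, mul_smul_comm,
        mul_assoc]
    rw [mk_wU, mk_wU, mono_eq, pow_one, ← mk_smul, ← mk_sub, ← h]
    rfl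
  rw [adF_mk, heisQ.Gop_apply, chg_mono, map_smul, h1, h2]
  module

/-! ### The filtration of `𝒰 / K` by the degree difference -/

/-- The span of the `a_{-λ} b_{-μ} a_0^k` with `l(λ, μ) ≤ d`, `l(λ, μ) + k = h` and weight `N`. -/
def Fil (d h N : ℤ) : Submodule ℂ Q :=
  Submodule.span ℂ {q | ∃ (y : Ptn × Ptn) (k : ℕ), (ldiff y ≤ d ∧ ldiff y + k = h ∧ (wt y : ℤ) = N) ∧
    q = mk (mono ⟨y, k, 0⟩)}

theorem mono_mem_Fil {d h N : ℤ} (y : Ptn × Ptn) (k : ℕ) (h1 : ldiff y ≤ d) (h2 : ldiff y + k = h)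
    (h3 : (wt y : ℤ) = N) : mk (mono ⟨y, k, 0⟩) ∈ Fil d h N :=
  Submodule.subset_span ⟨y, k, ⟨h1, h2, h3⟩, rfl⟩

theorem Fil_mono {d d' h N : ℤ} (hd : d ≤ d') : Fil d h N ≤ Fil d' h N :=
  Submodule.span_mono fun _ ⟨y, k, ⟨h1, h2, h3⟩, e⟩ => ⟨y, k, ⟨h1.trans hd, h2, h3⟩, e⟩

theorem Fil_map {d h N d' h' N' : ℤ} (X : Module.End ℂ Q)
    (hX : ∀ (y : Ptn × Ptn) (k : ℕ), ldiff y ≤ d → ldiff y + k = h → (wt y : ℤ) = N →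
      X (mk (mono ⟨y, k, 0⟩)) ∈ Fil d' h' N') {q : Q} (hq : q ∈ Fil d h N) : X q ∈ Fil d' h' N' := by
  induction hq using Submodule.span_induction with
  | mem q hq => obtain ⟨y, k, ⟨h1, h2, h3⟩, rfl⟩ := hq; exact hX y k h1 h2 h3
  | zero => rw [map_zero]; exact zero_mem _
  | add x y _ _ hx hy => rw [map_add]; exact add_mem hx hy
  | smul c x _ hx => rw [map_smul]; exact Submodule.smul_mem _ _ hx

theorem ldiff_cons_fst (n : ℕ+) (l m : Ptn) : ldiff (n ::ₘ l, m) = ldiff (l, m) + 1 := by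
  simp only [ldiff, Multiset.card_cons]; push_cast; ring

theorem ldiff_cons_snd (n : ℕ+) (l m : Ptn) : ldiff (l, n ::ₘ m) = ldiff (l, m) - 1 := by
  simp only [ldiff, Multiset.card_cons]; push_cast; ring

theorem size_cons (n : ℕ+) (l : Ptn) : size (n ::ₘ l) = n + size l := by
  simp [size]

theorem wt_cons_fst (n : ℕ+) (l m : Ptn) : (wt (n ::ₘ l, m) : ℤ) = wt (l, m) + n := by
  simp only [wt, size_cons]; push_cast; ring

theorem wt_cons_snd (n : ℕ+) (l m : Ptn) : (wt (l, n ::ₘ m) : ℤ) = wt (l, m) + n := by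
  simp only [wt, size_cons]; push_cast; ring

theorem mono_cons_fst (n : ℕ+) (l m : Ptn) (k : ℕ) :
    mk (mono ⟨(n ::ₘ l, m), k, 0⟩) = aQ (-(n : ℤ)) (mk (mono ⟨(l, m), k, 0⟩)) := by
  rw [mk_wU, mk_wU, wU_cons_fst, aQ, lQ_mk, mul_assoc]

theorem mono_cons_snd (n : ℕ+) (l m : Ptn) (k : ℕ) :
    mk (mono ⟨(l, n ::ₘ m), k, 0⟩) = bQ (-(n : ℤ)) (mk (mono ⟨(l, m), k, 0⟩)) := by
  rw [mk_wU, mk_wU, wU_cons_snd, bQ, lQ_mk, mul_assoc]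

theorem Fil_aQ_neg {d h N : ℤ} (n : ℕ+) {q : Q} (hq : q ∈ Fil d h N) :
    aQ (-(n : ℤ)) q ∈ Fil (d + 1) (h + 1) (N + n) := by
  refine Fil_map _ (fun y k h1 h2 h3 => ?_) hq
  obtain ⟨l, m⟩ := y
  rw [← mono_cons_fst]
  refine mono_mem_Fil _ _ ?_ ?_ ?_
  · rw [ldiff_cons_fst]; omega
  · rw [ldiff_cons_fst]; omega
  · rw [wt_cons_fst]; omega

theorem Fil_bQ_neg {d h N : ℤ} (n : ℕ+) {q : Q} (hq : q ∈ Fil d h N) :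
    bQ (-(n : ℤ)) q ∈ Fil (d - 1) (h - 1) (N + n) := by
  refine Fil_map _ (fun y k h1 h2 h3 => ?_) hq
  obtain ⟨l, m⟩ := y
  rw [← mono_cons_snd]
  refine mono_mem_Fil _ _ ?_ ?_ ?_
  · rw [ldiff_cons_snd]; omega
  · rw [ldiff_cons_snd]; omega
  · rw [wt_cons_snd]; omega

theorem Fil_pos (n : ℕ+) (k : ℕ) (y : Ptn × Ptn) :
    aQ (n : ℤ) (mk (mono ⟨y, k, 0⟩)) ∈ Fil (ldiff y + 1) (ldiff y + k + 1) (wt y - n) ∧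
    bQ (n : ℤ) (mk (mono ⟨y, k, 0⟩)) ∈ Fil (ldiff y - 1) (ldiff y + k - 1) (wt y - n) := by
  have hn := n.pos
  refine ptnPair_induction (P := fun y =>
    aQ (n : ℤ) (mk (mono ⟨y, k, 0⟩)) ∈ Fil (ldiff y + 1) (ldiff y + k + 1) (wt y - n) ∧
    bQ (n : ℤ) (mk (mono ⟨y, k, 0⟩)) ∈ Fil (ldiff y - 1) (ldiff y + k - 1) (wt y - n))
    ?_ (fun i m ih => ?_) (fun i l m ih => ?_) y
  · have ha : aQ (n : ℤ) (mk (mono ⟨(0, 0), k, 0⟩)) = 0 := by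
      have : Commute (a n) (a 0 ^ k) := Commute.pow_right (a_comm _ _) k
      rw [mk_wU, wU_zero, one_mul, aQ, lQ_mk, this.eq, mk_eq_zero]
      exact mul_mem_K _ (a_mem_K (by omega))
    have hb : bQ (n : ℤ) (mk (mono ⟨(0, 0), k, 0⟩)) = 0 := by
      have : Commute (b n) (a 0 ^ k) := Commute.pow_right (ab_swap (by omega)).symm k
      rw [mk_wU, wU_zero, one_mul, bQ, lQ_mk, this.eq, mk_eq_zero]
      exact mul_mem_K _ (b_mem_K (by omega))
    rw [ha, hb]
    exact ⟨zero_mem _, zero_mem _⟩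
  · have hi := i.pos
    have h1 := Fil_bQ_neg i ih.1
    have h2 := Fil_bQ_neg i ih.2
    rw [mono_cons_snd, ldiff_cons_snd, wt_cons_snd, ← Module.End.mul_apply, ← Module.End.mul_apply,
      heisQ.ab, heisQ.bb, LinearMap.add_apply, Module.End.mul_apply, Module.End.mul_apply]
    refine ⟨add_mem ?_ ?_, ?_⟩
    · convert h1 using 1; congr 1 <;> ring
    · split_ifs with hni
      · exact mono_mem_Fil _ _ (by omega) (by omega) (by omega)
      · exact zero_mem _
    · convert h2 using 1; congr 1 <;> ring
  · have hi := i.pos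
    have h1 := Fil_aQ_neg i ih.1
    have h2 := Fil_aQ_neg i ih.2
    have hba : bQ (n : ℤ) * aQ (-(i : ℤ)) = aQ (-(i : ℤ)) * bQ (n : ℤ) -
        if (-(i : ℤ)) = -(n : ℤ) then 1 else 0 := by rw [heisQ.ab, add_sub_cancel_right]
    rw [mono_cons_fst, ldiff_cons_fst, wt_cons_fst, ← Module.End.mul_apply, ← Module.End.mul_apply,
      heisQ.aa, hba, LinearMap.sub_apply, Module.End.mul_apply, Module.End.mul_apply]
    refine ⟨?_, sub_mem ?_ ?_⟩
    · convert h1 using 1; congr 1 <;> ring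
    · convert h2 using 1; congr 1 <;> ring
    · split_ifs with hni
      · exact mono_mem_Fil _ _ (by omega) (by omega) (by omega)
      · exact zero_mem _

theorem Fil_aQ {d h N : ℤ} (n : ℤ) {q : Q} (hq : q ∈ Fil d h N) :
    aQ n q ∈ Fil (d + 1) (h + 1) (N - n) := by
  obtain ⟨m, rfl⟩ | rfl | ⟨m, rfl⟩ := int_cases n
  · refine Fil_map _ (fun y k h1 h2 h3 => ?_) hq
    subst h2 h3
    exact Fil_mono (by omega) (Fil_pos m k y).1
  · refine Fil_map _ (fun y k h1 h2 h3 => ?_) hq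
    have e : aQ 0 (mk (mono ⟨y, k, 0⟩)) = mk (mono ⟨y, k + 1, 0⟩) := by
      rw [mk_wU, mk_wU, aQ, lQ_mk, ← mul_assoc, (wU_comm y).1, mul_assoc, pow_succ']
    rw [e]
    exact mono_mem_Fil _ _ (by omega) (by push_cast; omega) (by omega)
  · rw [sub_neg_eq_add]; exact Fil_aQ_neg m hq

theorem Fil_bQ {d h N : ℤ} {n : ℤ} (hn : n ≠ 0) {q : Q} (hq : q ∈ Fil d h N) :
    bQ n q ∈ Fil (d - 1) (h - 1) (N - n) := by
  obtain ⟨m, rfl⟩ | h0 | ⟨m, rfl⟩ := int_cases n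
  · refine Fil_map _ (fun y k h1 h2 h3 => ?_) hq
    subst h2 h3
    exact Fil_mono (by omega) (Fil_pos m k y).2
  · exact absurd h0 hn
  · rw [sub_neg_eq_add]; exact Fil_bQ_neg m hq

/-- The part of `F_{(0)}` without `b_0` lowers the degree difference. -/
theorem Fil_Rop {d h N : ℤ} {q : Q} (hq : q ∈ Fil d h N) :
    Rop aQ bQ 1 0 q ∈ Fil (d - 1) (h - 1) N := by
  refine lsum_mem heisQ.locFin_Rop _ fun p => ?_
  split_ifs with hp
  · rw [jop_one_zero, jop_one_zero]
    have h2 : 0 - p.1 - p.2 ≠ 0 := by omega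
    unfold nrm
    split_ifs
    · rw [Module.End.mul_apply, Module.End.mul_apply]
      have := Fil_aQ p.1 (Fil_bQ hp.1 (Fil_bQ h2 hq))
      convert this using 1; congr 1 <;> ring
    · rw [Module.End.mul_apply, Module.End.mul_apply]
      have := Fil_bQ hp.1 (Fil_bQ h2 (Fil_aQ p.1 hq))
      convert this using 1; congr 1 <;> ring
  · exact zero_mem _

theorem Fil_eq_bot {d h N : ℤ} (hd : d < -N) : Fil d h N = ⊥ := by
  refine Submodule.span_eq_bot.2 ?_
  rintro q ⟨y, k, ⟨h1, _, h3⟩, _⟩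
  have hs : ∀ s : Ptn, Multiset.card s ≤ size s := by
    intro s
    induction s using Multiset.induction_on with
    | empty => exact le_rfl
    | cons n s ih =>
      have := n.pos
      rw [size_cons, Multiset.card_cons]
      omega
  have h2 := hs y.2
  have : wt y = size y.1 + size y.2 := rfl
  have e : ldiff y = (Multiset.card y.1 : ℤ) - (Multiset.card y.2 : ℤ) := rfl
  omega

/-! ### Weight spaces of `M` -/

/-- An eigenvector in the span of some eigenvectors lies in the span of those among them with the
same eigenvalue. The linear independence of the `v i` is not needed for this, so that no
Poincaré–Birkhoff–Witt theorem for `𝒰 / K` enters. -/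
theorem mem_span_of_eigen {E ι : Type*} [AddCommGroup E] [Module ℂ E] (f : Module.End ℂ E)
    (v : ι → E) (μ : ι → ℂ) (P : ι → Prop) (hv : ∀ i, f (v i) = μ i • v i) {m : ℂ} {x : E}
    (hx : x ∈ Submodule.span ℂ {q | ∃ i, P i ∧ q = v i}) (hm : f x = m • x) :
    x ∈ Submodule.span ℂ {q | ∃ i, (P i ∧ μ i = m) ∧ q = v i} := by
  have key : ∀ x ∈ Submodule.span ℂ {q | ∃ i, P i ∧ q = v i},
      x ∈ Submodule.span ℂ {q | ∃ i, (P i ∧ μ i = m) ∧ q = v i} ⊔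
        ⨆ ν, ⨆ (_ : ν ≠ m), f.eigenspace ν := by
    intro x hx
    induction hx using Submodule.span_induction with
    | mem q hq =>
      obtain ⟨i, hi, rfl⟩ := hq
      by_cases h : μ i = m
      · exact Submodule.mem_sup_left (Submodule.subset_span ⟨i, ⟨hi, h⟩, rfl⟩)
      · exact Submodule.mem_sup_right (Submodule.mem_iSup_of_mem (μ i)
          (Submodule.mem_iSup_of_mem h (Module.End.mem_eigenspace_iff.2 (hv i))))
    | zero => exact zero_mem _
    | add x y _ _ hx hy => exact add_mem hx hy
    | smul c x _ hx => exact Submodule.smul_mem _ c hx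
  obtain ⟨p, hp, q, hq, rfl⟩ := Submodule.mem_sup.1 (key x hx)
  have hpe : p ∈ f.eigenspace m := by
    refine Submodule.span_le.2 ?_ hp
    rintro _ ⟨i, ⟨_, hi⟩, rfl⟩
    exact Module.End.mem_eigenspace_iff.2 (by rw [hv, hi])
  have hqe : q ∈ f.eigenspace m := by
    have := sub_mem (Module.End.mem_eigenspace_iff.2 hm) hpe
    rwa [add_sub_cancel_left] at this
  have hq0 : q = 0 := Submodule.disjoint_def.1 (f.eigenspaces_iSupIndep m) q hqe hq
  rw [hq0, add_zero]
  exact hp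

/-- The pairs `(λ, μ) ≤ (λ₀, μ₀)` of the same weight. -/
def PairLE (x y : Ptn × Ptn) : Prop := (pairLT y x ∨ y = x) ∧ wt y = wt x

theorem inS_iff {x : Ptn × Ptn} {s : Idx} :
    inS x s ↔ PairLE x s.pr ∧ ldiff s.pr + s.k ≤ ldiff x := by
  obtain ⟨y, k, l⟩ := s
  rw [inS, PairLE, ← and_assoc]
  refine and_congr_left fun hk => and_congr_left fun _ => ?_
  simp only [idxLT] at hk ⊢
  constructor
  · rintro ((h | h | h) | h)
    · exact Or.inl h
    · exact Or.inr h.1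
    · exact Or.inr h.1
    · exact Or.inr (congrArg Idx.pr h)
  · rintro (h | rfl)
    · exact Or.inl (Or.inl h)
    · obtain rfl : k = 0 := by omega
      obtain rfl | hl := Nat.eq_zero_or_pos l
      · exact Or.inr rfl
      · exact Or.inl (Or.inr (Or.inr ⟨rfl, rfl, hl⟩))

theorem mem_Mwt {x : Ptn × Ptn} {s : Idx} (h1 : PairLE x s.pr) (h2 : ldiff s.pr + s.k ≤ ldiff x)
    {m : ℤ} (h3 : 2 * (ldiff s.pr + s.k - s.l) = m) : mk (mono s) ∈ Mwt x m := by
  refine ⟨Submodule.subset_span ⟨s, inS_iff.2 ⟨h1, h2⟩, rfl⟩, ?_⟩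
  rw [SetLike.mem_coe, Module.End.mem_eigenspace_iff, ← h3]
  exact adH_mono s.pr s.k s.l

theorem adH_mono' (s : Idx) : adH (mk (mono s)) =
    ((2 * (ldiff s.pr + s.k - s.l) : ℤ) : ℂ) • mk (mono s) := adH_mono s.pr s.k s.l

/-- The weight space `M(2 l₀)` is spanned by basis elements `a_{-λ} b_{-μ} a_0^k` without
`b_0`. -/
theorem Mwt_eq_span (x : Ptn × Ptn) : Mwt x (2 * ldiff x) =
    Submodule.span ℂ {q | ∃ (y : Ptn × Ptn) (k : ℕ), (PairLE x y ∧ ldiff y + k = ldiff x) ∧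
      q = mk (mono ⟨y, k, 0⟩)} := by
  refine le_antisymm (fun q hq => ?_) (Submodule.span_le.2 ?_)
  · have h := mem_span_of_eigen adH (fun s => mk (mono s)) _ (inS x) adH_mono' hq.1
      (Module.End.mem_eigenspace_iff.1 hq.2)
    refine Submodule.span_mono ?_ h
    rintro _ ⟨⟨y, k, l⟩, ⟨hs, he⟩, rfl⟩
    have h1 := inS_iff.1 hs
    have h2 := Int.cast_injective he
    simp only at h1 h2
    obtain rfl : l = 0 := by omega
    exact ⟨y, k, ⟨h1.1, by omega⟩, rfl⟩
  · rintro _ ⟨y, k, ⟨h1, h2⟩, rfl⟩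
    exact mem_Mwt h1 h2.le (by simp only; push_cast; omega)

theorem Mwt_le_Slab (x : Ptn × Ptn) : Mwt x (2 * ldiff x) ≤ Slab (ldiff x) := by
  rw [Mwt_eq_span]
  exact Submodule.span_mono fun _ ⟨y, k, ⟨_, h⟩, e⟩ => ⟨y, k, h, e⟩

theorem PairLE_of_lt {x y : Ptn × Ptn} (h : ldiff y < ldiff x) (hw : wt y = wt x) : PairLE x y :=
  ⟨Or.inl (Or.inl h), hw⟩

theorem PairLE.ldiff_le {x y : Ptn × Ptn} (h : PairLE x y) : ldiff y ≤ ldiff x := by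
  obtain ⟨(h | h | h) | rfl, _⟩ := h
  · exact h.le
  · exact h.1.le
  · rw [ldiff, ldiff, h.1, h.2.1]
  · exact le_rfl

theorem Fil_le_Mwt {x : Ptn × Ptn} {d h : ℤ} (hd : d < ldiff x) (hh : h ≤ ldiff x) :
    Fil d h (wt x) ≤ Mwt x (2 * h) := by
  refine Submodule.span_le.2 ?_
  rintro _ ⟨y, k, ⟨h1, h2, h3⟩, rfl⟩
  exact mem_Mwt (PairLE_of_lt (by simp only; omega) (by simp only; omega)) (by simp only; omega)
    (by simp only; push_cast; omega)

theorem mem_mulB {N : Submodule ℂ Q} {q : Q} : q ∈ mulB N ↔ ∃ u, mk u ∈ N ∧ q = mk (u * b 0) := by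
  constructor
  · rintro ⟨_, ⟨u, hu, rfl⟩, rfl⟩
    exact ⟨u, hu, rfl⟩
  · rintro ⟨u, hu, rfl⟩
    exact ⟨_, ⟨u, hu, rfl⟩, rfl⟩

theorem mul_b_mem_K {u : U} (hu : u ∈ K) : u * b 0 ∈ K := by
  have h := comm_mem_K (b 0) (fun n hn => by
    rw [b_comm 0 n, sub_self, ← ab_swap (m := n) (n := 0) (by omega), sub_self]
    exact ⟨zero_mem _, zero_mem _⟩) u hu
  have := K.sub_mem (mul_mem_K (b 0) hu) h
  rwa [sub_sub_cancel] at this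

/-- Right multiplication by `b_0` on `𝒰 / K`. -/
theorem exists_mul_b {S : Set Q} {N : Submodule ℂ Q} (hS : ∀ u, mk u ∈ S → mk (u * b 0) ∈ N) {u : U}
    (hu : mk u ∈ Submodule.span ℂ S) : mk (u * b 0) ∈ N := by
  suffices h : ∀ q ∈ Submodule.span ℂ S, ∀ u, mk u = q → mk (u * b 0) ∈ N from h _ hu u rfl
  intro q hq
  induction hq using Submodule.span_induction with
  | mem q hq => rintro u rfl; exact hS u hq
  | zero =>
    intro u hu
    rw [mk_eq_zero.2 (mul_b_mem_K (mk_eq_zero.1 hu))]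
    exact zero_mem _
  | add p q _ _ hp hq =>
    intro u hu
    obtain ⟨v, rfl⟩ := mk_surjective p
    obtain ⟨w, rfl⟩ := mk_surjective q
    have h1 : u - (v + w) ∈ K := mk_eq_zero.1 (by rw [mk_sub, hu, mk_add, sub_self])
    have h2 := mk_eq_zero.2 (mul_b_mem_K h1)
    rw [sub_mul, mk_sub, sub_eq_zero, add_mul, mk_add] at h2
    rw [h2]
    exact add_mem (hp v rfl) (hq w rfl)
  | smul c q _ hq =>
    intro u hu
    obtain ⟨v, rfl⟩ := mk_surjective q
    have h1 : u - c • v ∈ K := mk_eq_zero.1 (by rw [mk_sub, hu, mk_smul, sub_self])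
    have h2 := mk_eq_zero.2 (mul_b_mem_K h1)
    rw [sub_mul, mk_sub, sub_eq_zero, smul_mul_assoc, mk_smul] at h2
    rw [h2]
    exact N.smul_mem c (hq v rfl)

theorem mk_mul_b_eq {u v : U} (h : mk u = mk v) : mk (u * b 0) = mk (v * b 0) := by
  have h1 : u - v ∈ K := mk_eq_zero.1 (by rw [mk_sub, h, sub_self])
  have h2 := mk_eq_zero.2 (mul_b_mem_K h1)
  rwa [sub_mul, mk_sub, sub_eq_zero] at h2

theorem mono_mul_b (y : Ptn × Ptn) (k : ℕ) : mono ⟨y, k, 0⟩ * b 0 = mono ⟨y, k, 1⟩ := by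
  rw [mono_eq, mono_eq, pow_zero, pow_one, mul_one]

theorem mulB_Mwt_le (x : Ptn × Ptn) :
    mulB (Mwt x (2 * ldiff x)) ≤ Mwt x (2 * ldiff x - 2) := by
  intro q hq
  obtain ⟨u, hu, rfl⟩ := mem_mulB.1 hq
  rw [Mwt_eq_span] at hu
  refine exists_mul_b (fun u hu => ?_) hu
  obtain ⟨y, k, ⟨h1, h2⟩, e⟩ := hu
  rw [mk_mul_b_eq e, mono_mul_b]
  exact mem_Mwt h1 h2.le (by simp only; push_cast; omega)

theorem adF_Mwt (x : Ptn × Ptn) {B : Q} (hB : B ∈ Mwt x (2 * ldiff x)) :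
    adF B ∈ Mwt x (2 * ldiff x - 2) := by
  rw [Mwt_eq_span] at hB
  induction hB using Submodule.span_induction with
  | mem q hq =>
    obtain ⟨y, k, ⟨h1, h2⟩, rfl⟩ := hq
    rw [adF_mono]
    refine add_mem (add_mem (Submodule.smul_mem _ _ ?_) ?_) ?_
    · exact mem_Mwt h1 h2.le (by simp only; push_cast; omega)
    · rcases k with _ | k
      · rw [Nat.cast_zero, zero_mul]
        have e : (0 : ℂ) • mk (mono ⟨y, 0 - 1, 0⟩) = 0 := zero_smul ℂ (A := Q) _
        rw [e]
        exact zero_mem _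
      · refine Submodule.smul_mem _ _ (mem_Mwt h1 ?_ ?_)
        · simp only [Nat.add_sub_cancel]; push_cast at h2; omega
        · simp only [Nat.add_sub_cancel]; push_cast at h2 ⊢; omega
    · have h3 := Fil_Rop (mono_mem_Fil y k h1.ldiff_le h2 rfl)
      have h4 : wt y = wt x := h1.2
      rw [h4] at h3
      have := Fil_le_Mwt (by omega) (by omega) h3
      rwa [mul_sub, mul_one] at this
  | zero => rw [map_zero]; exact zero_mem _
  | add x y _ _ hx hy => rw [map_add]; exact add_mem hx hy
  | smul c x _ hx => rw [map_smul]; exact Submodule.smul_mem _ c hx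

/-! ### Existence of an element with a given leading term -/

/-- Modulo `M(2 l₀) b_0`, lower order terms are in the image of `F_{(0)}`. The induction on `n` is a
descent on `d`, which is bounded below since `l(λ, μ)` is at least minus the weight. -/
theorem exists_preimage (x : Ptn × Ptn) (hx : ldiff x ≤ -1) (n : ℕ) :
    ∀ d : ℤ, d < ldiff x → d + wt x < n → ∀ r ∈ Fil d (ldiff x - 1) (wt x),
      ∃ q ∈ Fil d (ldiff x) (wt x), adF q - r ∈ mulB (Mwt x (2 * ldiff x)) := by
  induction n with
  | zero =>
    intro d _ hd r hr
    rw [Fil_eq_bot (by push_cast at hd; omega), Submodule.mem_bot] at hr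
    exact ⟨0, zero_mem _, by rw [hr, map_zero, sub_zero]; exact zero_mem _⟩
  | succ n ih =>
    intro d hdx hd r hr
    induction hr using Submodule.span_induction with
    | mem r hr =>
      obtain ⟨y, k, ⟨h1, h2, h3⟩, rfl⟩ := hr
      have hy : mk (mono ⟨y, k + 1, 0⟩) ∈ Fil d (ldiff x) (wt x) :=
        mono_mem_Fil _ _ h1 (by push_cast; omega) h3
      have hR := Fil_Rop hy
      obtain ⟨q, hq, hq'⟩ := ih (d - 1) (by omega) (by push_cast at hd; omega) _ hR
      -- equal to `(k + 1) (l₀ + l(λ, μ) + 1)`, where `l(λ, μ) < l₀ ≤ -1`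
      set c : ℂ := ((k + 1 : ℕ) : ℂ) * ((k + 1 : ℕ) + 1 + 2 * ldiff y) with hc
      have hc0 : c ≠ 0 := by
        have : c = (((k + 1 : ℤ) * (k + 1 + 1 + 2 * ldiff y) : ℤ) : ℂ) := by
          rw [hc]; push_cast; ring
        rw [this, Int.cast_ne_zero]
        exact mul_ne_zero (by omega) (by omega)
      refine ⟨c⁻¹ • (mk (mono ⟨y, k + 1, 0⟩) - q),
        Submodule.smul_mem _ _ (sub_mem hy (Fil_mono (by omega) hq)), ?_⟩
      have hb : mk (mono ⟨y, k + 1, 1⟩) ∈ mulB (Mwt x (2 * ldiff x)) :=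
        mem_mulB.2 ⟨mono ⟨y, k + 1, 0⟩, mem_Mwt (PairLE_of_lt (by simp only; omega)
          (by simp only; omega)) (by simp only; push_cast; omega)
          (by simp only; push_cast; omega), by rw [mono_mul_b]⟩
      have e : adF (c⁻¹ • (mk (mono ⟨y, k + 1, 0⟩) - q)) - mk (mono ⟨y, k, 0⟩) =
          c⁻¹ • ((-2 * ((ldiff y : ℂ) + (k + 1 : ℕ))) • mk (mono ⟨y, k + 1, 1⟩) -
            (adF q - Rop aQ bQ 1 0 (mk (mono ⟨y, k + 1, 0⟩)))) := by
        have h1 := (inv_smul_smul₀ hc0 (mk (mono ⟨y, k, 0⟩))).symm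
        have h2 : adF (mk (mono ⟨y, k + 1, 0⟩) - q) - c • mk (mono ⟨y, k, 0⟩) =
            (-2 * ((ldiff y : ℂ) + (k + 1 : ℕ))) • mk (mono ⟨y, k + 1, 1⟩) -
              (adF q - Rop aQ bQ 1 0 (mk (mono ⟨y, k + 1, 0⟩))) := by
          rw [map_sub, adF_mono, ← hc, Nat.add_sub_cancel]
          abel
        rw [← h2, map_smul]
        conv_lhs => rw [h1]
        exact (smul_sub c⁻¹ (adF (mk (mono ⟨y, k + 1, 0⟩) - q)) (c • mk (mono ⟨y, k, 0⟩))).symm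
      rw [e]
      exact Submodule.smul_mem _ _ (sub_mem (Submodule.smul_mem _ _ hb) hq')
    | zero => exact ⟨0, zero_mem _, by rw [map_zero, sub_zero]; exact zero_mem _⟩
    | add r s _ _ hr hs =>
      obtain ⟨p, hp, hp'⟩ := hr
      obtain ⟨q, hq, hq'⟩ := hs
      refine ⟨p + q, add_mem hp hq, ?_⟩
      rw [map_add, add_sub_add_comm]
      exact add_mem hp' hq'
    | smul c r _ hr =>
      obtain ⟨p, hp, hp'⟩ := hr
      refine ⟨c • p, Submodule.smul_mem _ _ hp, ?_⟩
      rw [map_smul]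
      have := Submodule.smul_mem _ c hp'
      rwa [smul_sub c (adF p) r] at this

theorem exists_leading (x : Ptn × Ptn) (hx : ldiff x ≤ -1) :
    ∃ A ∈ Mwt x (2 * ldiff x), HasLeadingTerm x A ∧ adF A ∈ mulB (Mwt x (2 * ldiff x)) := by
  have h0 : mk (mono ⟨x, 0, 0⟩) ∈ Fil (ldiff x) (ldiff x) (wt x) :=
    mono_mem_Fil _ _ le_rfl (by simp) rfl
  obtain ⟨q, hq, hq'⟩ := exists_preimage x hx ((ldiff x + wt x).toNat + 1) (ldiff x - 1) (by omega)
    (by omega) _ (Fil_Rop h0)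
  have hx0 : PairLE x x := ⟨Or.inr rfl, rfl⟩
  refine ⟨mk (mono ⟨x, 0, 0⟩) - q, sub_mem (mem_Mwt hx0 (by simp) (by simp))
    (Fil_le_Mwt (by omega) le_rfl hq), ?_, ?_⟩
  · rw [HasLeadingTerm, sub_sub_cancel_left]
    refine neg_mem (Submodule.span_mono ?_ hq)
    rintro _ ⟨y, k, ⟨h1, h2, h3⟩, rfl⟩
    exact ⟨_, Or.inl (Or.inl (by simp only; omega)), rfl⟩
  · have e : adF (mk (mono ⟨x, 0, 0⟩) - q) = (-2 * (ldiff x : ℂ)) • mk (mono ⟨x, 0, 1⟩) -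
        (adF q - Rop aQ bQ 1 0 (mk (mono ⟨x, 0, 0⟩))) := by
      rw [map_sub, adF_mono, Nat.cast_zero]
      module
    rw [e]
    refine sub_mem (Submodule.smul_mem _ _ (mem_mulB.2 ⟨mono ⟨x, 0, 0⟩, ?_, ?_⟩)) hq'
    · exact mem_Mwt hx0 (by simp) (by simp)
    · rw [mono_mul_b]

/-! ### From `𝒰 / K` to `𝒟^ch(ℍ)` -/

theorem applyL_lQ (v : U) (B : Q) (f : Hol) : applyL (lQ v B) f = act v (applyL B f) := by
  obtain ⟨u, rfl⟩ := mk_surjective B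
  rw [lQ_mk, applyL_mk, applyL_mk, map_mul, Module.End.mul_apply]

theorem applyL_aQ (n : ℤ) (B : Q) (f : Hol) : applyL (aQ n B) f = aOp n (applyL B f) := by
  rw [aQ, applyL_lQ, act_a]

theorem applyL_bQ (n : ℤ) (B : Q) (f : Hol) : applyL (bQ n B) f = bOp n (applyL B f) := by
  rw [bQ, applyL_lQ, act_b]

theorem applyL_lsum {ι : Type*} {T : ι → Module.End ℂ Q} {S : ι → Module.End ℂ Dch} (hT : LocFin T)
    (hS : LocFin S) (f : Hol) (h : ∀ i B, applyL (T i B) f = S i (applyL B f)) (B : Q) :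
    applyL (lsum T B) f = lsum S (applyL B f) := by
  rw [lsum_apply hT, lsum_apply hS]
  have h1 := (applyL.flip f).toAddMonoidHom.map_finsum (hT B)
  refine Eq.trans h1 (finsum_congr fun i => h i B)

theorem applyL_nrm (i : ℤ) {S : Module.End ℂ Q} {S' : Module.End ℂ Dch} (f : Hol)
    (h : ∀ B, applyL (S B) f = S' (applyL B f)) (B : Q) :
    applyL (nrm aQ i S B) f = nrm aOp i S' (applyL B f) := by
  unfold nrm
  split_ifs
  · rw [Module.End.mul_apply, Module.End.mul_apply, applyL_aQ, h]
  · rw [Module.End.mul_apply, Module.End.mul_apply, h, applyL_aQ]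

theorem applyL_Pop (B : Q) (f : Hol) :
    applyL (Pop aQ bQ 1 0 0 B) f = Pop aOp bOp 1 0 0 (applyL B f) := by
  refine applyL_lsum (heisQ.locFin_Pop 0) (heisD.locFin_Pop 0) f
    (fun i B => applyL_nrm i f (fun B => ?_) B) B
  rw [jop_one_zero, jop_one_zero, applyL_bQ]

theorem applyL_Gop (B : Q) (f : Hol) :
    applyL (Gop aQ bQ 1 0 0 B) f = Gop aOp bOp 1 0 0 (applyL B f) := by
  refine applyL_lsum (heisQ.locFin_Gop 0) (heisD.locFin_Gop 0) f
    (fun p B => applyL_nrm p.1 f (fun B => ?_) B) B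
  rw [jop_one_zero, jop_one_zero, jop_one_zero, jop_one_zero, Module.End.mul_apply,
    Module.End.mul_apply, applyL_bQ, applyL_bQ]

theorem act_b_ofHol (f : Hol) : act (b 0) (ofHol f) = ofHol (coordH * f) := by
  rw [act_b, bOp_zero, mulOp_apply, ofHol, ofHol, map_mul]

theorem act_a_ofHol (f : Hol) : act (a 0) (ofHol f) = ofHol (dHol f) := by
  rw [act_a, ofHol_D0]

theorem applyL_mk_mul (u v : U) (f : Hol) :
    applyL (mk (u * v)) f = act u (act v (ofHol f)) := by
  rw [applyL_mk, map_mul, Module.End.mul_apply]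

/-- `a_0` acts on the vectors `A f` through `f`. -/
theorem D0_applyL {l : ℤ} {A : Q} (hA : A ∈ Slab l) (f : Hol) :
    aOp 0 (applyL A f) = applyL A (dHol f) := by
  induction hA using Submodule.span_induction with
  | mem q hq =>
    obtain ⟨y, k, _, rfl⟩ := hq
    rw [applyL_mono_zero]
    have e : (dHol ^ k) (dHol f) = dHol ((dHol ^ k) f) := by
      rw [← Module.End.mul_apply, ← Module.End.mul_apply, ← pow_succ, ← pow_succ']
    refine MvPolynomial.ext _ _ fun s => ?_
    rw [aOp_zero, coeff_D0]
    change dHol (MvPolynomial.coeff s (MvPolynomial.monomial (expo y) ((dHol ^ k) f))) =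
      MvPolynomial.coeff s (MvPolynomial.monomial (expo y) ((dHol ^ k) (dHol f)))
    classical
    rw [MvPolynomial.coeff_monomial, MvPolynomial.coeff_monomial, e]
    split_ifs
    · rfl
    · exact map_zero _
  | zero => rw [map_zero, LinearMap.zero_apply, LinearMap.zero_apply, map_zero]
  | add x y _ _ hx hy => rw [map_add, LinearMap.add_apply, LinearMap.add_apply, map_add, hx, hy]
  | smul c x _ hx => rw [map_smul, LinearMap.smul_apply, LinearMap.smul_apply, map_smul, hx]

/-- The zero mode of `a (γ b + δ) ^ 2` on the vectors `A f`, for `A` in the kernel of `F̄`. -/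
theorem Gop_zero_applyL {x : Ptn × Ptn} {A : Q} (hA : A ∈ Mwt x (2 * ldiff x))
    (hF : adF A ∈ mulB (Mwt x (2 * ldiff x))) (γ δ : ℂ) (f : Hol) :
    Gop aOp bOp γ δ 0 (applyL A f) = applyL A (theta γ δ f -
      (2 * (ldiff x : ℂ) * γ) • (jHol γ δ * f)) := by
  set l : ℂ := (ldiff x : ℂ) with hl
  have hAS := Mwt_le_Slab x hA
  have hH : adH A = (2 * l) • A := by
    have := Module.End.mem_eigenspace_iff.1 hA.2
    rwa [Int.cast_mul, Int.cast_ofNat] at this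
  obtain ⟨u, hu, hFu⟩ := mem_mulB.1 hF
  have huS := Mwt_le_Slab x hu
  obtain ⟨v, rfl⟩ := mk_surjective A
  have hP : ∀ f, Pop aOp bOp 1 0 0 (applyL (mk v) f) =
      applyL (mk v) (coordH * dHol f) - l • applyL (mk v) f := by
    intro f
    have h1 := congrArg (fun B => applyL B f) ((adH_mk v).symm.trans hH)
    rw [map_smul, map_smul, map_sub, LinearMap.smul_apply, LinearMap.smul_apply,
      LinearMap.sub_apply, applyL_Pop, applyL_mk_mul, map_mul, Module.End.mul_apply, act_a_ofHol,
      act_b_ofHol, ← applyL_mk] at h1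
    have h2 : (2 : ℂ) • (Pop aOp bOp 1 0 0 (applyL (mk v) f) -
        (applyL (mk v) (coordH * dHol f) - l • applyL (mk v) f)) = 0 := by
      rw [← neg_eq_zero, ← sub_eq_zero.2 h1]
      module
    exact sub_eq_zero.1 ((smul_eq_zero.1 h2).resolve_left two_ne_zero)
  have hG : ∀ f, Gop aOp bOp 1 0 0 (applyL (mk v) f) =
      applyL (mk u) (coordH * f) + applyL (mk v) (coordH * (coordH * dHol f)) := by
    intro f
    have h1 := congrArg (fun B => applyL B f) ((adF_mk v).symm.trans hFu)
    rw [map_sub, LinearMap.sub_apply, applyL_Gop, applyL_mk_mul, applyL_mk_mul, map_mul, map_mul,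
      Module.End.mul_apply, Module.End.mul_apply, act_a_ofHol, act_b_ofHol, act_b_ofHol,
      act_b_ofHol, ← applyL_mk, ← applyL_mk, sub_eq_iff_eq_add] at h1
    exact h1
  -- the commutator of `F_{(0)}` with `a_0` determines the vectors `u f`
  have hu : ∀ f, applyL (mk u) f = (-2 * l) • applyL (mk v) f := by
    intro f
    have h1 := LinearMap.congr_fun (heisD.Gop_a (γ := 1) (δ := 0) 0 0) (applyL (mk v) f)
    rw [LinearMap.sub_apply, Module.End.mul_apply, Module.End.mul_apply, D0_applyL hAS, hG, hG,
      map_add, D0_applyL huS, D0_applyL hAS, add_zero, LinearMap.smul_apply, hP, dHol_mul, dHol_mul,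
      dHol_mul, dHol_coordH] at h1
    have e : coordH * (coordH * dHol (dHol f) + 1 * dHol f) + 1 * (coordH * dHol f) =
        coordH * (coordH * dHol (dHol f)) + (2 : ℂ) • (coordH * dHol f) := by
      rw [two_smul]; ring
    rw [e, one_mul, map_add, map_add, map_smul] at h1
    rw [← sub_eq_zero, ← neg_eq_zero, ← sub_eq_zero.2 h1]
    module
  have e : theta γ δ f - (2 * l * γ) • (jHol γ δ * f) =
      γ ^ 2 • (coordH * (coordH * dHol f) + (-2 * l) • (coordH * f)) +
        (2 * γ * δ) • (coordH * dHol f - l • f) + δ ^ 2 • dHol f := by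
    rw [theta_apply, jHol]
    simp only [Algebra.smul_def, map_mul, map_pow, map_neg, map_ofNat]
    ring
  rw [heisD.Gop_zero_expand, LinearMap.add_apply, LinearMap.add_apply, LinearMap.smul_apply,
    LinearMap.smul_apply, LinearMap.smul_apply, hG, hP, D0_applyL hAS, hu, e]
  simp only [map_add, map_sub, map_smul]
  module

/-- The transformation law of the vectors `A f`, for `A` in the kernel of `F̄`. -/
theorem piAct_applyOp (g : SL(2, ℝ)) {x : Ptn × Ptn} {A : Q} (hA : A ∈ Mwt x (2 * ldiff x))
    (hF : adF A ∈ mulB (Mwt x (2 * ldiff x))) (f : Hol) :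
    piAct g (applyOp A f) = applyOp A (jz g (2 * ldiff x) * pull g f) :=
  piAct_applyL g (Mwt_le_Slab x hA) (Gop_zero_applyL hA hF _ _) f

/-! ### The coefficients of the vectors `A f` -/

theorem coef_actL (x y : Ptn × Ptn) (k : ℕ) (f : Hol) :
    coef x (actL y k f) = if y = x then (dHol ^ k) f else 0 := by
  classical
  change MvPolynomial.coeff (expo x) (MvPolynomial.monomial (expo y) ((dHol ^ k) f)) = _
  rw [MvPolynomial.coeff_monomial]
  simp only [expo_injective.eq_iff]

theorem coef_add (x : Ptn × Ptn) (v w : Dch) : coef x (v + w) = coef x v + coef x w :=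
  MvPolynomial.coeff_add _ _ _

theorem coef_smul (x : Ptn × Ptn) (c : ℂ) (v : Dch) : coef x (c • v) = c • coef x v :=
  MvPolynomial.coeff_smul _ _ _

theorem applyOp_mem_V {x : Ptn × Ptn} {A : Q} (hA : A ∈ Mwt x (2 * ldiff x)) (f : Hol) :
    applyOp A f ∈ V x := by
  intro y
  contrapose!
  intro hy
  change coef y (applyL A f) = 0
  rw [Mwt_eq_span] at hA
  induction hA using Submodule.span_induction with
  | mem q hq =>
    obtain ⟨z, k, ⟨hz, _⟩, rfl⟩ := hq
    rw [applyL_mono_zero, coef_actL, if_neg]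
    rintro rfl
    exact hy hz.1 hz.2
  | zero => rw [map_zero]; exact MvPolynomial.coeff_zero _
  | add p q _ _ hp hq => rw [map_add, LinearMap.add_apply, coef_add, hp, hq, add_zero]
  | smul c q _ hq => rw [map_smul, LinearMap.smul_apply, coef_smul, hq, smul_zero]

theorem pairLT_irrefl (x : Ptn × Ptn) : ¬ pairLT x x := by
  rintro (h | ⟨_, h⟩ | ⟨_, _, h⟩)
  · exact lt_irrefl _ h
  · exact lt_irrefl (parts x.1) h
  · exact lt_irrefl (parts x.2) h

/-- The leading coefficient of `A f` is `f`. -/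
theorem coef_applyOp {x : Ptn × Ptn} {A : Q} (hA : A ∈ Mwt x (2 * ldiff x))
    (hL : HasLeadingTerm x A) (f : Hol) : coef x (applyOp A f) = f := by
  have h0 : adH (A - mk (mono ⟨x, 0, 0⟩)) = ((2 * ldiff x : ℤ) : ℂ) • (A - mk (mono ⟨x, 0, 0⟩)) := by
    have h1 := Module.End.mem_eigenspace_iff.1 hA.2
    have h2 := adH_mono x 0 0
    rw [Nat.cast_zero, add_zero, sub_zero] at h2
    rw [map_sub, h1, h2]
    exact (smul_sub _ A (mk (mono ⟨x, 0, 0⟩))).symm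
  have h3 := mem_span_of_eigen adH (fun s => mk (mono s)) _ (fun s => idxLT s ⟨x, 0, 0⟩) adH_mono'
    hL h0
  have h4 : ∀ B ∈ Submodule.span ℂ {q | ∃ s : Idx, (idxLT s ⟨x, 0, 0⟩ ∧
      ((2 * (ldiff s.pr + s.k - s.l) : ℤ) : ℂ) = ((2 * ldiff x : ℤ) : ℂ)) ∧ q = mk (mono s)},
      coef x (applyL B f) = 0 := by
    intro B hB
    induction hB using Submodule.span_induction with
    | mem q hq =>
      obtain ⟨s, ⟨hs, he⟩, rfl⟩ := hq
      have he := Int.cast_injective he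
      rw [applyL_mono, coef_actL, if_neg]
      rintro hx
      obtain h | ⟨_, h⟩ | ⟨_, h, h'⟩ := hs
      · simp only [hx] at h
        exact pairLT_irrefl _ h
      · exact absurd h (Nat.not_lt_zero _)
      · simp only at h h'
        rw [hx] at he
        omega
    | zero => rw [map_zero]; exact MvPolynomial.coeff_zero _
    | add p q _ _ hp hq => rw [map_add, LinearMap.add_apply, coef_add, hp, hq, add_zero]
    | smul c q _ hq => rw [map_smul, LinearMap.smul_apply, coef_smul, hq, smul_zero]
  have e : A = (A - mk (mono ⟨x, 0, 0⟩)) + mk (mono ⟨x, 0, 0⟩) := by abel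
  change coef x (applyL A f) = f
  rw [e, map_add, LinearMap.add_apply, coef_add, h4 _ h3, zero_add, applyL_mono_zero, coef_actL,
    if_pos rfl]
  rfl

/-- The coefficients of `A f` lie in every subspace that is closed under differentiation and
contains `f`. -/
theorem coef_applyOp_mem {l : ℤ} {A : Q} (hA : A ∈ Slab l) (W : Submodule ℂ Hol)
    (hW : ∀ f ∈ W, dHol f ∈ W) {f : Hol} (hf : f ∈ W) (y : Ptn × Ptn) : coef y (applyOp A f) ∈ W := by
  change coef y (applyL A f) ∈ W
  induction hA using Submodule.span_induction with
  | mem q hq =>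
    obtain ⟨z, k, _, rfl⟩ := hq
    rw [applyL_mono_zero, coef_actL]
    have hk : (dHol ^ k) f ∈ W := by
      clear * - hW hf
      induction k with
      | zero => exact hf
      | succ k ih => rw [pow_succ', Module.End.mul_apply]; exact hW _ ih
    split_ifs
    · exact hk
    · exact zero_mem _
  | zero =>
    rw [map_zero]
    have : coef y ((0 : Hol →ₗ[ℂ] Dch) f) = 0 := MvPolynomial.coeff_zero _
    rw [this]
    exact zero_mem _
  | add p q _ _ hp hq => rw [map_add, LinearMap.add_apply, coef_add]; exact add_mem hp hq
  | smul c q _ hq =>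
    rw [map_smul, LinearMap.smul_apply, coef_smul]
    exact Submodule.smul_mem _ c hq

/-! ### Holomorphy at the cusps -/

section Cusps

/-- If `f` is bounded at `i∞` then so is `f'`, by Cauchy's estimate on discs of radius `1`. -/
theorem isBounded_dHol {f : Hol} (hf : UpperHalfPlane.IsBoundedAtImInfty f.1) :
    UpperHalfPlane.IsBoundedAtImInfty (dHol f).1 := by
  rw [UpperHalfPlane.isBoundedAtImInfty_iff] at hf ⊢
  obtain ⟨C, A, hC⟩ := hf
  refine ⟨C, max A 0 + 2, fun τ hτ => ?_⟩
  have him : ∀ z ∈ Metric.closedBall (τ : ℂ) 1, max A 0 + 1 ≤ z.im := by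
    intro z hz
    have h1 := Complex.abs_im_le_norm (z - τ)
    rw [Metric.mem_closedBall, dist_eq_norm] at hz
    have h2 := (abs_le.1 (h1.trans hz)).1
    rw [Complex.sub_im] at h2
    have h3 : (τ : ℂ).im = τ.im := rfl
    linarith
  have hpos : ∀ z ∈ Metric.closedBall (τ : ℂ) 1, 0 < z.im := fun z hz => by
    have := him z hz
    have h0 := le_max_right A 0
    linarith
  have hh : MDiff f.1 := f.2
  rw [UpperHalfPlane.mdifferentiable_iff] at hh
  have hd : DiffContOnCl ℂ (f.1 ∘ UpperHalfPlane.ofComplex) (Metric.ball (τ : ℂ) 1) := by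
    refine DifferentiableOn.diffContOnCl (hh.mono fun z hz => ?_)
    exact hpos z (Metric.closure_ball_subset_closedBall hz)
  have h := Complex.norm_deriv_le_of_forall_mem_sphere_norm_le (C := C) one_pos hd fun z hz => by
    have hz' := Metric.sphere_subset_closedBall hz
    rw [Function.comp_apply, UpperHalfPlane.ofComplex_apply_of_im_pos (hpos z hz')]
    refine hC _ ?_
    have := him z hz'
    have h0 := le_max_left A 0
    change A ≤ z.im
    linarith
  rw [div_one] at h
  exact h

/-- The holomorphic functions of period `N` that are bounded at `i∞`. -/
def Bdd (N : ℕ) : Submodule ℂ Hol where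
  carrier := {f | Function.Periodic (f.1 ∘ UpperHalfPlane.ofComplex) ((N : ℝ) : ℂ) ∧
    UpperHalfPlane.IsBoundedAtImInfty f.1}
  add_mem' hf hg := ⟨fun z => congrArg₂ (· + ·) (hf.1 z) (hg.1 z), hf.2.add hg.2⟩
  zero_mem' := ⟨fun _ => rfl, UpperHalfPlane.zero_form_isBoundedAtImInfty⟩
  smul_mem' c _ hf := ⟨fun z => congrArg (c * ·) (hf.1 z), hf.2.const_smul_left c⟩

theorem dHol_mem_Bdd {N : ℕ} {f : Hol} (hf : f ∈ Bdd N) : dHol f ∈ Bdd N := by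
  refine ⟨fun z => ?_, isBounded_dHol hf.2⟩
  have hN : (z + ((N : ℝ) : ℂ)).im = z.im := by simp
  have hd : deriv (f.1 ∘ UpperHalfPlane.ofComplex) (z + ((N : ℝ) : ℂ)) =
      deriv (f.1 ∘ UpperHalfPlane.ofComplex) z := by
    rw [← deriv_comp_add_const]
    congr 1
    exact funext hf.1
  rw [Function.comp_apply, Function.comp_apply]
  by_cases hz : 0 < z.im
  · rw [UpperHalfPlane.ofComplex_apply_of_im_pos hz,
      UpperHalfPlane.ofComplex_apply_of_im_pos (hN.symm ▸ hz)]
    exact hd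
  · rw [UpperHalfPlane.ofComplex_apply_of_im_nonpos (not_lt.1 hz),
      UpperHalfPlane.ofComplex_apply_of_im_nonpos (by rw [hN]; exact not_lt.1 hz)]

theorem holAtInfty_of_mem_Bdd {N : ℕ} (hN : 0 < N) {f : Hol} (hf : f ∈ Bdd N) :
    HolAtInfty f := by
  refine ⟨N, hN, fun m => (UpperHalfPlane.qExpansion (N : ℝ) f.1).coeff m, fun τ => ?_⟩
  have h := UpperHalfPlane.hasSum_qExpansion (h := (N : ℝ)) (by exact_mod_cast hN) hf.1 f.2 hf.2 τ
  refine h.congr_fun fun m => ?_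
  rw [smul_eq_mul, Function.Periodic.qParam, ← Complex.exp_nat_mul]
  congr 2
  push_cast
  ring

theorem jz_apply (g : SL(2, ℝ)) (n : ℤ) (τ : ℍ) :
    (jz g n).1 τ = ((g 1 0 : ℂ) * τ + (g 1 1 : ℂ)) ^ n := by
  let ev : Hol →* ℂ := { toFun := fun f => f.1 τ, map_one' := rfl, map_mul' := fun _ _ => rfl }
  have h1 : ((Units.map ev (jU g ^ n) : ℂˣ) : ℂ) = (jz g n).1 τ := rfl
  have h2 : ((Units.map ev (jU g) : ℂˣ) : ℂ) = (g 1 0 : ℂ) * τ + (g 1 1 : ℂ) := by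
    change (g 1 0 : ℂ) * (τ : ℂ) + (g 1 1 : ℂ) * 1 = _
    rw [mul_one]
  rw [← h1, map_zpow, Units.val_zpow_eq_zpow_val, h2]

theorem jz_mul_pull_eq_slash (ρ : SL(2, ℤ)) (f : Hol) (k : ℤ) (τ : ℍ) :
    (jz (toR ρ) (-k) * pull (toR ρ) f).1 τ = (SlashAction.map k ρ f.1 : ℍ → ℂ) τ := by
  rw [ModularForm.SL_slash_apply]
  change (jz (toR ρ) (-k)).1 τ * f.1 (toR ρ • τ) = _
  rw [jz_apply]
  exact mul_comm _ _

variable {Γ : Subgroup SL(2, ℤ)} {k : ℤ}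

theorem jz_mul_pull_modularForm
    (f : ModularForm (Γ.map (Matrix.SpecialLinearGroup.mapGL ℝ)) k) {g : SL(2, ℤ)} (hg : g ∈ Γ) :
    jz (toR g) (-k) * pull (toR g) (ofModularForm f) = ofModularForm f := by
  refine Hol.ext fun τ => ?_
  rw [jz_mul_pull_eq_slash]
  exact congrFun (SlashInvariantForm.slash_action_eqn f _ (Subgroup.mem_map_of_mem _ hg)) τ

/-- If `Γ` contains `Γ(N)` then `f ∣ ρ` has period `N`, as `Γ(N)` is normal in `SL(2, ℤ)`. -/
theorem jz_mul_pull_mem_Bdd {N : ℕ} (hN : N ≠ 0) (hΓ : CongruenceSubgroup.Gamma N ≤ Γ)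
    (f : ModularForm (Γ.map (Matrix.SpecialLinearGroup.mapGL ℝ)) k) (ρ : SL(2, ℤ)) :
    jz (toR ρ) (-k) * pull (toR ρ) (ofModularForm f) ∈ Bdd N := by
  have : Γ.FiniteIndex := CongruenceSubgroup.IsCongruenceSubgroup.finiteIndex ⟨N, hN, hΓ⟩
  have e : (jz (toR ρ) (-k) * pull (toR ρ) (ofModularForm f)).1 =
      (SlashAction.map k ρ (f : ℍ → ℂ) : ℍ → ℂ) :=
    funext fun τ => jz_mul_pull_eq_slash ρ (ofModularForm f) k τ
  refine ⟨?_, ?_⟩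
  · rw [e]
    set T : SL(2, ℤ) := ModularGroup.T ^ (N : ℤ)
    have hT : ρ * T * ρ⁻¹ ∈ Γ := hΓ (by
      have := CongruenceSubgroup.ModularGroup_T_pow_mem_Gamma N N dvd_rfl
      rw [Int.natAbs_natCast] at this
      exact (CongruenceSubgroup.Gamma_normal N).conj_mem _ this ρ)
    have h1 : (SlashAction.map k (ρ * T * ρ⁻¹) (f : ℍ → ℂ) : ℍ → ℂ) = f :=
      SlashInvariantForm.slash_action_eqn f _ (Subgroup.mem_map_of_mem _ hT)
    have h2 : (SlashAction.map k T (SlashAction.map k ρ (f : ℍ → ℂ)) : ℍ → ℂ) =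
        SlashAction.map k ρ (f : ℍ → ℂ) := by
      conv_rhs => rw [← h1]
      rw [← SlashAction.slash_mul, ← SlashAction.slash_mul, inv_mul_cancel_right]
    have h3 : ∀ τ : ℍ, (SlashAction.map k ρ (f : ℍ → ℂ) : ℍ → ℂ) (T • τ) =
        (SlashAction.map k ρ (f : ℍ → ℂ) : ℍ → ℂ) τ := by
      intro τ
      have hT' : (T : Matrix (Fin 2) (Fin 2) ℤ) = !![1, (N : ℤ); 0, 1] := ModularGroup.coe_T_zpow _
      have h10 : (T : Matrix (Fin 2) (Fin 2) ℤ) 1 0 = 0 := by rw [hT']; rfl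
      have h11 : (T : Matrix (Fin 2) (Fin 2) ℤ) 1 1 = 1 := by rw [hT']; rfl
      have hden : UpperHalfPlane.denom (T : GL (Fin 2) ℝ) (τ : ℂ) = 1 := by
        change (((T 1 0 : ℤ) : ℝ) : ℂ) * (τ : ℂ) + (((T 1 1 : ℤ) : ℝ) : ℂ) = 1
        rw [h10, h11]
        simp
      have h4 := ModularForm.SL_slash_apply (k := k) (SlashAction.map k ρ (f : ℍ → ℂ)) T τ
      rw [hden, one_zpow, mul_one, congrFun h2 τ] at h4
      exact h4.symm
    intro z
    have hzN : (z + ((N : ℝ) : ℂ)).im = z.im := by simp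
    rw [Function.comp_apply, Function.comp_apply]
    by_cases hz : 0 < z.im
    · refine Eq.trans (congrArg _ (UpperHalfPlane.ext ?_)) (h3 _)
      rw [ModularGroup.coe_T_zpow_smul_eq, UpperHalfPlane.ofComplex_apply_of_im_pos hz,
        UpperHalfPlane.ofComplex_apply_of_im_pos (hzN.symm ▸ hz)]
      simp
    · rw [UpperHalfPlane.ofComplex_apply_of_im_nonpos (not_lt.1 hz),
        UpperHalfPlane.ofComplex_apply_of_im_nonpos (by rw [hzN]; exact not_lt.1 hz)]
  · rw [e]
    exact ModularFormClass.bdd_at_infty_slash f ρ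

end Cusps

end CDO

end

theorem theorem3p5 (lam mu : CDO.Ptn) (hl : CDO.ldiff (lam, mu) ≤ -1) :
    -- `F_{(0)}` and right multiplication by `b_0` map `M(2l₀)` into `M(2l₀ - 2)`
    (∀ B ∈ CDO.Mwt (lam, mu) (2 * CDO.ldiff (lam, mu)),
      CDO.adF B ∈ CDO.Mwt (lam, mu) (2 * CDO.ldiff (lam, mu) - 2)) ∧
    CDO.mulB (CDO.Mwt (lam, mu) (2 * CDO.ldiff (lam, mu))) ≤
      CDO.Mwt (lam, mu) (2 * CDO.ldiff (lam, mu) - 2) ∧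
    -- the kernel of `F̄` contains an element with leading term `a_{-λ₀} b_{-μ₀}`
    (∃ A : CDO.Mwt (lam, mu) (2 * CDO.ldiff (lam, mu)),
      CDO.HasLeadingTerm (lam, mu) (A : CDO.Q) ∧ CDO.Fbar (lam, mu) A = 0) ∧
    -- every such element lifts all modular forms of weight `2 (p(μ₀) - p(λ₀))`
    (∀ A : CDO.Mwt (lam, mu) (2 * CDO.ldiff (lam, mu)),
      CDO.HasLeadingTerm (lam, mu) (A : CDO.Q) → CDO.Fbar (lam, mu) A = 0 →
      ∀ Γ : Subgroup (Matrix.SpecialLinearGroup (Fin 2) ℤ),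
        CongruenceSubgroup.IsCongruenceSubgroup Γ →
        ∀ f : ModularForm (Γ.map (Matrix.SpecialLinearGroup.mapGL ℝ))
            (2 * ((Multiset.card mu : ℤ) - (Multiset.card lam : ℤ))),
          CDO.applyOp (A : CDO.Q) (CDO.ofModularForm f) ∈ CDO.VInv Γ (lam, mu) ∧
          CDO.coef (lam, mu) (CDO.applyOp (A : CDO.Q) (CDO.ofModularForm f)) =
            CDO.ofModularForm f) := by
  have hker : ∀ A : CDO.Mwt (lam, mu) (2 * CDO.ldiff (lam, mu)), CDO.Fbar (lam, mu) A = 0 ↔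
      CDO.adF (A : CDO.Q) ∈ CDO.mulB (CDO.Mwt (lam, mu) (2 * CDO.ldiff (lam, mu))) := fun A =>
    Submodule.Quotient.mk_eq_zero _
  refine ⟨fun B hB => CDO.adF_Mwt _ hB, CDO.mulB_Mwt_le _, ?_, fun A hL hA Γ hΓ f => ?_⟩
  · obtain ⟨A, hA, hL, hF⟩ := CDO.exists_leading (lam, mu) hl
    exact ⟨⟨A, hA⟩, hL, (hker _).2 hF⟩
  · have hF := (hker A).1 hA
    obtain ⟨N, hN, hNΓ⟩ := hΓ
    have hw : 2 * CDO.ldiff (lam, mu) =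
        -(2 * ((Multiset.card mu : ℤ) - (Multiset.card lam : ℤ))) := by
      rw [CDO.ldiff]; ring
    refine ⟨⟨CDO.applyOp_mem_V A.2 _, fun g hg => ?_, fun ρ y => ?_⟩, CDO.coef_applyOp A.2 hL _⟩
    · have h := CDO.jz_mul_pull_modularForm f hg
      rw [← hw] at h
      rw [CDO.piAct_applyOp _ A.2 hF, h]
    · have h := CDO.jz_mul_pull_mem_Bdd hN hNΓ f ρ
      rw [← hw] at h
      rw [CDO.piAct_applyOp _ A.2 hF]
      exact CDO.holAtInfty_of_mem_Bdd (Nat.pos_of_ne_zero hN)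
        (CDO.coef_applyOp_mem (CDO.Mwt_le_Slab _ A.2) (CDO.Bdd N)
          (fun _ => CDO.dHol_mem_Bdd) h y)
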